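/- Let $\Sigma=\{0,1\}$ and identify $\Sigma^*$ with $\mathbb{N}$ via the bijection $\mathrm{enc}(w)=\sum_{i<|w|}(1+w(i))\,2^{|w|-1-i}$. All machines are deterministic multi-tape oracle Turing machines with a write-only oracle tape, which in space-bounded computations is subject to the space bound as well. For an oracle $X\subseteq\Sigma^*$ let $\mathrm{PSPACE}^X$ denote the sets decidable in polynomial space, $\mathrm{DTIME}^X(t)$ the sets decidable in time $O(t)$, and $\mathrm{FP}^X$ the total functions $\Sigma^*\to\Sigma^*$ computable in polynomial time, each with oracle $X$. A proof system for $L\subseteq\Sigma^*$ relative to $X$ is a function $f\in\mathrm{FP}^X$ with $\mathrm{ran}(f)=L$. It is p-optimal relative to $X$ if for every $g\in\mathrm{FP}^X$ with $\mathrm{ran}(g)=L$ there are $\pi\in\mathrm{FP}^X$ and a polynomial $p$ with $|\pi(x)|\le p(|x|)$ and $f(\pi(x))=g(x)$ for all $x\in\Sigma^*$. A function $t:\mathbb{N}\to\mathbb{N}$ is time-constructible if $t(n)\ge n$ for all $n$ and the map sending $x$ to the binary representation of $t(|x|)$ is computable by a Turing machine without oracle in time $O(t(|x|))$. **Theorem.**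 For every $A\subseteq 2\mathbb{N}$ there is a tally set $O\subseteq 0^*$ with $O\subseteq 2\mathbb{N}+1$ such that: 1. every nonempty set in $\mathrm{PSPACE}^{O\cup A}$ has a p-optimal proof system relative to $O\cup A$; 2. for every time-constructible function $t$ there is a set $L\subseteq\Sigma^*$ that is decidable relative to $O\cup A$, has a p-optimal proof system relative to $O\cup A$, and satisfies $L\notin\mathrm{DTIME}^{O\cup A}(t)$. -/

import Mathlib

namespace OracleComplexity

/-- Words over `Σ = {0, 1}`; `false` is the letter `0`, `true` is the letter `1`. -/
abbrev Word : Type := List Bool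

/-- The bijection `enc : Σ* → ℕ`, `enc w = ∑_{i < |w|} (1 + w(i)) * 2 ^ (|w| - 1 - i)`,
through which words and natural numbers are identified. -/
def enc (w : Word) : ℕ :=
  ∑ i : Fin w.length, (1 + (w.get i).toNat) * 2 ^ (w.length - 1 - (i : ℕ))

/-- A set `T ⊆ 0*`. -/
def IsTally (T : Set Word) : Prop :=
  ∀ w ∈ T, ∃ n : ℕ, w = List.replicate n false

/-! ### Deterministic multi-tape oracle Turing machines

Tape cells hold a letter or a blank (`none`); since the number of tapes is arbitrary, larger tape
alphabets would only change running times by constant factors.  Besides its two-way infinite read-write tapes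
(tape `0` initially holds the input) a machine has a write-only oracle tape and a write-only
output tape.  The content of a write-only tape is the word written so far. -/

/-- What a machine with state set `S` and `m` read-write tapes does in one step. -/
inductive Instr (S : Type) (m : ℕ) : Type
  /-- Stop, and accept or reject. -/
  | halt (accept : Bool)
  /-- Ask whether the word on the oracle tape belongs to the oracle, erase the oracle tape, and
  continue in state `yes` or `no` according to the answer. -/
  | query (yes no : S)
  /-- Go to state `next`; on every read-write tape overwrite the scanned cell and move the head by
  `-1`, `0` or `1` cells; possibly append a letter on the oracle tape and on the output tape. -/
  | step (next : S) (write : Fin m → Option Bool) (move : Fin m → SignType)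
      (oracleWrite outputWrite : Option Bool)

/-- Deterministic oracle Turing machines (also used as transducers). -/
structure OracleTM where
  /-- The finite set of states. -/
  State : Type
  finite_state : Finite State
  /-- The number of read-write tapes in addition to tape `0`. -/
  k : ℕ
  start : State
  /-- The transition function: state and scanned symbols determine the next instruction. -/
  δ : State → (Fin (k + 1) → Option Bool) → Instr State (k + 1)

namespace OracleTM

/-- Configurations. -/
structure Cfg (M : OracleTM) where
  state : M.State
  head : Fin (M.k + 1) → ℤ
  tape : Fin (M.k + 1) → ℤ → Option Bool
  oracleTape : Word
  output : Word

variable (M : OracleTM)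

/-- The instruction that is to be executed in the configuration `c`. -/
def instr {M : OracleTM} (c : M.Cfg) : Instr M.State (M.k + 1) :=
  M.δ c.state (fun i => c.tape i (c.head i))

/-- The start configuration: the input is in the cells `0, …, |x| - 1` of tape `0`, all other cells
are blank, all heads are on cell `0`. -/
def init (x : Word) : M.Cfg where
  state := M.start
  head := fun _ => 0
  tape := fun i j => if i = 0 ∧ 0 ≤ j then x[j.toNat]? else none
  oracleTape := []
  output := []

open scoped Classical in
/-- One step with oracle `X`; a halted machine stays where it is. -/
noncomputable def next {M : OracleTM} (X : Set Word) (c : M.Cfg) : M.Cfg :=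
  match instr c with
  | .halt _ => c
  | .query yes no =>
      { c with state := if c.oracleTape ∈ X then yes else no, oracleTape := [] }
  | .step q w mv o r =>
      { state := q
        head := fun i => c.head i + (mv i : ℤ)
        tape := fun i => Function.update (c.tape i) (c.head i) (w i)
        oracleTape := c.oracleTape ++ o.toList
        output := c.output ++ r.toList }

/-- The configuration after `n` steps on input `x` with oracle `X`. -/
noncomputable def cfgAt (X : Set Word) (x : Word) (n : ℕ) : M.Cfg :=
  (next X)^[n] (M.init x)

/-- On input `x` with oracle `X`, the machine halts after at most `n` steps with verdict `b`. -/
def HaltsWithin (X : Set Word) (x : Word) (n : ℕ) (b : Bool) : Prop :=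
  instr (M.cfgAt X x n) = Instr.halt b

/-- `M` with oracle `X` decides `L`: it halts on every input and accepts exactly the words of `L`. -/
def Decides (X : Set Word) (L : Set Word) : Prop :=
  ∀ x, (x ∈ L → ∃ n, M.HaltsWithin X x n true) ∧ (x ∉ L → ∃ n, M.HaltsWithin X x n false)

/-- `M` with oracle `X` decides `L` in time `T`. -/
def DecidesInTime (X : Set Word) (L : Set Word) (T : ℕ → ℕ) : Prop :=
  ∀ x, (x ∈ L → M.HaltsWithin X x (T x.length) true) ∧
    (x ∉ L → M.HaltsWithin X x (T x.length) false)

/-- On input `x` with oracle `X`, all heads stay within distance `s |x|` of their start position, and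
the oracle tape, which underlies the same bound, never holds more than `s |x|` letters. -/
def UsesSpace (X : Set Word) (s : ℕ → ℕ) : Prop :=
  ∀ x n, (∀ i, |(M.cfgAt X x n).head i| ≤ (s x.length : ℤ)) ∧
    (M.cfgAt X x n).oracleTape.length ≤ s x.length

/-- `M` with oracle `X` computes the total function `f` in time `T`. -/
def ComputesInTime (X : Set Word) (f : Word → Word) (T : ℕ → ℕ) : Prop :=
  ∀ x, (∃ b, M.HaltsWithin X x (T x.length) b) ∧ (M.cfgAt X x (T x.length)).output = f x

end OracleTM

/-- Sets decidable relative to the oracle `X`. -/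
def DecidableRelativeTo (X : Set Word) (L : Set Word) : Prop :=
  ∃ M : OracleTM, M.Decides X L

/-- `DTIME^X(t)`: the sets decidable in time `O(t)` relative to `X`. -/
def DTIME (X : Set Word) (t : ℕ → ℕ) : Set (Set Word) :=
  {L | ∃ (M : OracleTM) (c : ℕ), M.DecidesInTime X L (fun n => c * (t n + 1))}

/-- `PSPACE^X`. -/
def PSPACE (X : Set Word) : Set (Set Word) :=
  {L | ∃ (M : OracleTM) (p : Polynomial ℕ), M.Decides X L ∧ M.UsesSpace X (fun n => p.eval n)}

/-- `FP^X`: the total functions computable in polynomial time relative to `X`. -/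
def FP (X : Set Word) : Set (Word → Word) :=
  {f | ∃ (M : OracleTM) (p : Polynomial ℕ), M.ComputesInTime X f (fun n => p.eval n)}

/-- `t` is time-constructible (without any oracle): `t n ≥ n`, and the binary representation of
`t |x|` (most significant bit first) can be computed from `x` in time `O(t |x|)`. -/
def TimeConstructible (t : ℕ → ℕ) : Prop :=
  (∀ n, n ≤ t n) ∧
    ∃ (M : OracleTM) (c : ℕ),
      M.ComputesInTime ∅ (fun x => (Nat.bits (t x.length)).reverse) (fun n => c * (t n + 1))

/-- `f` is a proof system for `L` relative to `X`. -/
def IsProofSystem (X : Set Word) (f : Word → Word) (L : Set Word) : Prop :=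
  f ∈ FP X ∧ Set.range f = L

/-- `g` is p-simulated by `f` relative to `X`. -/
def PSimulatedBy (X : Set Word) (g f : Word → Word) : Prop :=
  ∃ π ∈ FP X, ∃ p : Polynomial ℕ, ∀ x, (π x).length ≤ p.eval x.length ∧ f (π x) = g x

/-- `L` has a p-optimal proof system relative to `X`. -/
def HasPOptimalProofSystem (X : Set Word) (L : Set Word) : Prop :=
  ∃ f, IsProofSystem X f L ∧ ∀ g, IsProofSystem X g L → PSimulatedBy X g f

end OracleComplexity

open OracleComplexity

/-!
The oracle `O` consists of words `0 ^ m` with `m ≥ 1`; these have the odd numbers `2 ^ m - 1`, so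
that `O` and `A` do not interfere. Put `X = O ∪ A`. The words in `O` answer questions about `X`
itself: a question `P X m` is attached to each `m`, and `0 ^ m` is put into `O` iff `P X' m` holds
for all oracles `X'` that coincide with `X` below length `m`. This is a definition by recursion on
`m` (`exists_oracle`). An answer "yes" is correct; an answer "no" is only reliable if `P X m`
depends on short words alone.

All proof systems are given by one verifier (`verify`). It reads the trace of a run of some
machine `N`, checks the trace, and gives the output of the run if there is a certificate for `N`,
which is an oracle word saying that, up to a time bound `T`, the machine `N` only outputs words of
the language `L` (`CertOK`). The verifier must run in polynomial time with a fixed polynomial, for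
all machines `N` at once. Hence no simulation of `N` takes place: the trace is checked letter by
letter. That it is a sequence of steps of one machine is checked by asking the oracle for the
edges of an infinite automaton whose nodes are written in unary notation into the trace (`PathOK`,
`EdgeCode`), so that `N` contributes to the length of the trace, but not to the program of the
verifier; the oracle answers are checked by repeating the queries, and the tapes one by one, each
with two stacks (`AnswersOK`, `TapesOK`). The number `T` and the index of `N` are read off from
the number of letters `wt` in the trace. Then the outputs of the verifier belong to `L`
(`range_verify_subset`), and conversely a machine with certificates for all `T` is p-simulated,
since its traces can be written in polynomial time by a machine that executes it
(`pSimulatedBy_verify`).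

So it remains to show that machines with range in `L` have certificates, which means that their
outputs belong to `L` robustly: changing `X` at words longer than a polynomial in the running time
does not matter. The exponent of this polynomial is `2 ^ d` for a parameter `d` of the verifier, and
since each machine has arbitrarily large indices, certificates may be assumed to be longer than a
constant that depends on the machine (`hasPOptimalProofSystem_of_robust`). For `L` in `PSPACE` the
robustness follows from the space bound on the oracle tape
(`hasPOptimalProofSystem_of_mem_PSPACE`).

For the second part, `L` is the set of all `0 ^ n` with `n` in a diagonal set `Diag t X`, on which
two sorts of requirements act: each machine that outputs `0 ^ n`, and each machine that accepts
`0 ^ n`, within a time budget that exceeds all multiples of `t`, claims `n`; and each requirement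
deletes the first number that it claims from some threshold on. A machine that decides `L` in time
`O(t)` would have to claim infinitely many elements, hence delete one of them, which is impossible
(`diagWords_notMem_DTIME`). A machine with range in `L` never claims a number from its threshold
on, so that it needs more time for the output `0 ^ n` than the budget for `n`, whereas
`n ∈ Diag t X` only depends on words shorter than this budget (`robust_diagWords`). Finally `L` is
decidable since the oracle also contains, at sparse positions, the list of the budgets together with the
elements of the diagonal set (`decidable_diagWords`).
-/

namespace OracleComplexity

/-! ### Elementary facts about runs -/

/-- `X` and `Y` contain the same words of length less than `m`. -/
def AgreeBelow (m : ℕ) (X Y : Set Word) : Prop :=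
  ∀ w : Word, w.length < m → (w ∈ X ↔ w ∈ Y)

theorem AgreeBelow.mono {m n : ℕ} {X Y : Set Word} (h : AgreeBelow m X Y) (hn : n ≤ m) :
    AgreeBelow n X Y :=
  fun w hw => h w (hw.trans_le hn)

theorem AgreeBelow.refl (m : ℕ) (X : Set Word) : AgreeBelow m X X := fun _ _ => Iff.rfl

namespace OracleTM

variable {M : OracleTM} {X Y : Set Word} {x : Word}

theorem cfgAt_succ (n : ℕ) : M.cfgAt X x (n + 1) = next X (M.cfgAt X x n) := by
  simp [cfgAt, Function.iterate_succ_apply']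

theorem next_of_halt {c : M.Cfg} {b : Bool} (h : instr c = Instr.halt b) : next X c = c := by
  simp [next, h]

open scoped Classical in
theorem next_of_query {c : M.Cfg} {y n : M.State} (h : instr c = Instr.query y n) :
    next X c = { c with state := if c.oracleTape ∈ X then y else n, oracleTape := [] } := by
  simp only [next, h]

theorem next_of_query_mem {c : M.Cfg} {y n : M.State} (h : instr c = Instr.query y n)
    (hX : c.oracleTape ∈ X) : next X c = { c with state := y, oracleTape := [] } := by
  rw [next_of_query h, if_pos hX]

theorem next_of_query_notMem {c : M.Cfg} {y n : M.State} (h : instr c = Instr.query y n)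
    (hX : c.oracleTape ∉ X) : next X c = { c with state := n, oracleTape := [] } := by
  rw [next_of_query h, if_neg hX]

theorem next_of_step {c : M.Cfg} {q : M.State} {w : Fin (M.k + 1) → Option Bool}
    {mv : Fin (M.k + 1) → SignType} {o r : Option Bool}
    (h : instr c = Instr.step q w mv o r) :
    next X c =
      { state := q
        head := fun i => c.head i + (mv i : ℤ)
        tape := fun i => Function.update (c.tape i) (c.head i) (w i)
        oracleTape := c.oracleTape ++ o.toList
        output := c.output ++ r.toList } := by
  simp only [next, h]

theorem iterate_next_of_halt {c : M.Cfg} {b : Bool} (h : instr c = Instr.halt b) (n : ℕ) :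
    (next X)^[n] c = c :=
  Function.iterate_fixed (next_of_halt h) n

theorem HaltsWithin.cfgAt_eq {n m : ℕ} {b : Bool} (h : M.HaltsWithin X x n b) (hnm : n ≤ m) :
    M.cfgAt X x m = M.cfgAt X x n := by
  obtain ⟨k, rfl⟩ := Nat.exists_eq_add_of_le' hnm
  rw [cfgAt, Function.iterate_add_apply]
  exact iterate_next_of_halt h k

theorem HaltsWithin.mono {n m : ℕ} {b : Bool} (h : M.HaltsWithin X x n b) (hnm : n ≤ m) :
    M.HaltsWithin X x m b := by
  unfold HaltsWithin
  rw [h.cfgAt_eq hnm]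
  exact h

theorem HaltsWithin.cfgAt_eq_cfgAt {n m : ℕ} {b b' : Bool} (h : M.HaltsWithin X x n b)
    (h' : M.HaltsWithin X x m b') : M.cfgAt X x n = M.cfgAt X x m := by
  rcases le_total n m with hl | hl
  · exact (h.cfgAt_eq hl).symm
  · exact h'.cfgAt_eq hl

theorem HaltsWithin.verdict_unique {n m : ℕ} {b b' : Bool} (h : M.HaltsWithin X x n b)
    (h' : M.HaltsWithin X x m b') : b = b' := by
  have := h.cfgAt_eq_cfgAt h'
  unfold HaltsWithin at h h'
  rw [this, h'] at h
  exact (Instr.halt.inj h).symm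

theorem Decides.mem_of_haltsWithin {L : Set Word} (hM : M.Decides X L) {n : ℕ}
    (h : M.HaltsWithin X x n true) : x ∈ L := by
  by_contra hx
  obtain ⟨m, hm⟩ := (hM x).2 hx
  exact absurd (h.verdict_unique hm) (by simp)

theorem length_oracleTape_next (c : M.Cfg) :
    (next X c).oracleTape.length ≤ c.oracleTape.length + 1 := by
  unfold next
  split
  · simp
  · simp
  · rename_i o r _
    cases o <;> simp

theorem length_output_next (c : M.Cfg) :
    (next X c).output.length ≤ c.output.length + 1 := by
  unfold next
  split
  · simp
  · simp
  · rename_i o r _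
    cases r <;> simp

theorem length_oracleTape_cfgAt (n : ℕ) : (M.cfgAt X x n).oracleTape.length ≤ n := by
  induction n with
  | zero => simp [cfgAt, init]
  | succ n ih =>
    rw [cfgAt_succ]
    exact (length_oracleTape_next _).trans (by omega)

theorem length_output_cfgAt (n : ℕ) : (M.cfgAt X x n).output.length ≤ n := by
  induction n with
  | zero => simp [cfgAt, init]
  | succ n ih =>
    rw [cfgAt_succ]
    exact (length_output_next _).trans (by omega)

theorem next_congr {c : M.Cfg} (h : c.oracleTape ∈ X ↔ c.oracleTape ∈ Y) :
    next X c = next Y c := by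
  rcases hc : instr c with b | ⟨y, n⟩ | ⟨q, w, mv, o, r⟩
  · rw [next_of_halt hc, next_of_halt hc]
  · rw [next_of_query hc, next_of_query hc]
    by_cases hX : c.oracleTape ∈ X
    · rw [if_pos hX, if_pos (h.1 hX)]
    · rw [if_neg hX, if_neg fun hY => hX (h.2 hY)]
  · rw [next_of_step hc, next_of_step hc]

/-- The first `n` steps only query words of length less than `n`. -/
theorem cfgAt_congr {n : ℕ} (h : AgreeBelow n X Y) : M.cfgAt X x n = M.cfgAt Y x n := by
  induction n with
  | zero => rfl
  | succ n ih =>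
    have ih := ih (h.mono n.le_succ)
    rw [cfgAt_succ, cfgAt_succ, ← ih]
    exact next_congr (h _ (Nat.lt_succ_of_le (length_oracleTape_cfgAt n)))

theorem cfgAt_congr_of_usesSpace {s : ℕ → ℕ} (hs : M.UsesSpace X s) {m : ℕ}
    (h : AgreeBelow m X Y) (hm : s x.length < m) (n : ℕ) : M.cfgAt X x n = M.cfgAt Y x n := by
  induction n with
  | zero => rfl
  | succ n ih =>
    rw [cfgAt_succ, cfgAt_succ, ← ih]
    exact next_congr (h _ ((hs x n).2.trans_lt hm))

theorem haltsWithin_congr {n : ℕ} {b : Bool} (h : AgreeBelow n X Y) :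
    M.HaltsWithin X x n b ↔ M.HaltsWithin Y x n b := by
  unfold HaltsWithin
  rw [cfgAt_congr h]

end OracleTM

/-! ### An enumeration of all machines -/

/-- Rename the states in an instruction. -/
def Instr.map {S S' : Type} {m : ℕ} (e : S → S') : Instr S m → Instr S' m
  | .halt b => .halt b
  | .query y n => .query (e y) (e n)
  | .step q w mv o r => .step (e q) w mv o r

instance {S : Type} {m : ℕ} [Countable S] : Countable (Instr S m) := by
  let φ : Instr S m → Bool ⊕ (S × S) ⊕
      (S × (Fin m → Option Bool) × (Fin m → SignType) × Option Bool × Option Bool)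
    | .halt b => .inl b
    | .query y n => .inr (.inl (y, n))
    | .step q w mv o r => .inr (.inr (q, w, mv, o, r))
  refine Function.Injective.countable (f := φ) ?_
  intro a b h
  cases a <;> cases b <;> simp_all [φ]

/-- Machines whose states are an initial segment of `ℕ`; these form a countable type. -/
abbrev FinTM : Type :=
  Σ (p : ℕ × ℕ), Fin p.1 × (Fin p.1 → (Fin (p.2 + 1) → Option Bool) → Instr (Fin p.1) (p.2 + 1))

/-- A `FinTM` as a machine. -/
def FinTM.toTM (N : FinTM) : OracleTM where
  State := Fin N.1.1
  finite_state := inferInstance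
  k := N.1.2
  start := N.2.1
  δ := N.2.2

theorem exists_surjective_nat_finTM : ∃ f : ℕ → FinTM, Function.Surjective f := by
  have : Nonempty FinTM := ⟨⟨(1, 0), 0, fun _ _ => .halt true⟩⟩
  exact exists_surjective_nat FinTM

/-- An enumeration of all machines, up to the names of the states. -/
noncomputable def mach (k : ℕ) : OracleTM := (exists_surjective_nat_finTM.choose k).toTM

/-- The two machines behave in the same way on all inputs and with all oracles. -/
def SameBehaviour (M N : OracleTM) : Prop :=
  ∀ X x n, (∀ b, N.HaltsWithin X x n b ↔ M.HaltsWithin X x n b) ∧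
    (N.cfgAt X x n).output = (M.cfgAt X x n).output

/-- Rename the states of a machine along a bijection. -/
def OracleTM.rename (M : OracleTM) {n : ℕ} (e : M.State ≃ Fin n) : OracleTM where
  State := Fin n
  finite_state := inferInstance
  k := M.k
  start := e M.start
  δ := fun q σ => (M.δ (e.symm q) σ).map e

theorem sameBehaviour_rename (M : OracleTM) {n : ℕ} (e : M.State ≃ Fin n) :
    SameBehaviour M (M.rename e) := by
  let φ : M.Cfg → (M.rename e).Cfg := fun c => ⟨e c.state, c.head, c.tape, c.oracleTape, c.output⟩
  have hinstr : ∀ c : M.Cfg, OracleTM.instr (φ c) = (OracleTM.instr c).map e := by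
    intro c
    simp only [OracleTM.instr, OracleTM.rename, φ, Equiv.symm_apply_apply]
  have hnext : ∀ X, ∀ c : M.Cfg, OracleTM.next X (φ c) = φ (OracleTM.next X c) := by
    intro X c
    have h := hinstr c
    rcases hc : OracleTM.instr c with b | ⟨y, n⟩ | ⟨q, w, mv, o, r⟩ <;>
      simp only [hc, Instr.map] at h
    · rw [OracleTM.next_of_halt h, OracleTM.next_of_halt hc]
    · rw [OracleTM.next_of_query h, OracleTM.next_of_query hc]
      by_cases hm : c.oracleTape ∈ X <;> simp [φ, hm]
    · rw [OracleTM.next_of_step h, OracleTM.next_of_step hc]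
      rfl
  have hcfg : ∀ X x n, (M.rename e).cfgAt X x n = φ (M.cfgAt X x n) := by
    intro X x n
    induction n with
    | zero => rfl
    | succ n ih => rw [OracleTM.cfgAt_succ, OracleTM.cfgAt_succ, ih, hnext]
  intro X x n
  refine ⟨fun b => ?_, by rw [hcfg]⟩
  unfold OracleTM.HaltsWithin
  rw [hcfg, hinstr]
  rcases OracleTM.instr (M.cfgAt X x n) with b | ⟨y, n⟩ | ⟨q, w, mv, o, r⟩
  · exact ⟨fun h => by rw [Instr.halt.inj h], fun h => by rw [Instr.halt.inj h]; rfl⟩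
  · simp [Instr.map]
  · simp [Instr.map]

theorem exists_mach_sameBehaviour (M : OracleTM) : ∃ k, SameBehaviour M (mach k) := by
  have := M.finite_state
  obtain ⟨n, ⟨e⟩⟩ := Finite.exists_equiv_fin M.State
  obtain ⟨k, hk⟩ := exists_surjective_nat_finTM.choose_spec
    (⟨(n, M.k), e M.start, fun q σ => (M.δ (e.symm q) σ).map e⟩ : FinTM)
  refine ⟨k, ?_⟩
  have : mach k = M.rename e := by
    unfold mach
    rw [hk]
    rfl
  rw [this]
  exact sameBehaviour_rename M e

/-! ### A language of stack programs, and its translation to machines -/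

/-- Structured programs that work on eight stacks of letters, the oracle tape and the output
tape. -/
inductive Prog : Type
  /-- Do nothing. -/
  | skip
  /-- Push a letter on stack `i`. -/
  | push (i : Fin 8) (b : Bool)
  /-- Append a letter on the oracle tape. -/
  | app (b : Bool)
  /-- Append a letter on the output tape. -/
  | out (b : Bool)
  /-- Sequential composition. -/
  | seq (p q : Prog)
  /-- Pop stack `i` and branch: stack was empty, letter `0`, letter `1`. -/
  | pop (i : Fin 8) (e f t : Prog)
  /-- Ask the oracle and branch. -/
  | query (y n : Prog)
  /-- While stack `i` is not empty, pop a letter and run `f` or `t` according to the letter. -/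
  | loop (i : Fin 8) (f t : Prog)

/-- The memory of a stack program. -/
structure Store : Type where
  r0 : List Bool
  r1 : List Bool
  r2 : List Bool
  r3 : List Bool
  r4 : List Bool
  r5 : List Bool
  r6 : List Bool
  r7 : List Bool
  orc : Word
  out : Word

namespace Store

/-- The content of stack `i`. -/
def get (s : Store) : Fin 8 → List Bool
  | 0 => s.r0
  | 1 => s.r1
  | 2 => s.r2
  | 3 => s.r3
  | 4 => s.r4
  | 5 => s.r5
  | 6 => s.r6
  | 7 => s.r7

/-- Replace the content of stack `i`. -/
def set (s : Store) (i : Fin 8) (l : List Bool) : Store :=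
  match i with
  | 0 => { s with r0 := l }
  | 1 => { s with r1 := l }
  | 2 => { s with r2 := l }
  | 3 => { s with r3 := l }
  | 4 => { s with r4 := l }
  | 5 => { s with r5 := l }
  | 6 => { s with r6 := l }
  | 7 => { s with r7 := l }

theorem get_set (s : Store) (i j : Fin 8) (l : List Bool) :
    (s.set i l).get j = if j = i then l else s.get j := by
  fin_cases i <;> fin_cases j <;> rfl

theorem orc_set (s : Store) (i : Fin 8) (l : List Bool) : (s.set i l).orc = s.orc := by
  fin_cases i <;> rfl

theorem out_set (s : Store) (i : Fin 8) (l : List Bool) : (s.set i l).out = s.out := by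
  fin_cases i <;> rfl

/-- The memory at the beginning: the input is on stack `0`, its first letter on top. -/
def input (x : Word) : Store := ⟨x, [], [], [], [], [], [], [], [], []⟩

end Store

namespace Prog

variable {X : Set Word}

/-- `Run X p s s' n`: with oracle `X`, the program `p` transforms the memory `s` into `s'`, and the
machine obtained from `p` needs exactly `n` steps for it. -/
inductive Run (X : Set Word) : Prog → Store → Store → ℕ → Prop
  | skip (s) : Run X .skip s s 1
  | push (i b s) : Run X (.push i b) s (s.set i (b :: s.get i)) 2
  | app (b s) : Run X (.app b) s { s with orc := s.orc ++ [b] } 1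
  | out (b s) : Run X (.out b) s { s with out := s.out ++ [b] } 1
  | seq {p q s s' s'' m n} : Run X p s s' m → Run X q s' s'' n → Run X (.seq p q) s s'' (1 + m + n)
  | popE {i e f t s s' n} : s.get i = [] → Run X e s s' n → Run X (.pop i e f t) s s' (1 + n)
  | popL {i e f t s s' b l n} : s.get i = b :: l → Run X (cond b t f) (s.set i l) s' n →
      Run X (.pop i e f t) s s' (1 + n)
  | queryY {y n s s' m} : s.orc ∈ X → Run X y { s with orc := [] } s' m →
      Run X (.query y n) s s' (1 + m)
  | queryN {y n s s' m} : s.orc ∉ X → Run X n { s with orc := [] } s' m →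
      Run X (.query y n) s s' (1 + m)
  | loopE {i f t s} : s.get i = [] → Run X (.loop i f t) s s 1
  | loopL {i f t s s' s'' b l m n} : s.get i = b :: l → Run X (cond b t f) (s.set i l) s' m →
      Run X (.loop i f t) s' s'' n → Run X (.loop i f t) s s'' (1 + m + n)

/-- The lists of programs still to be executed that can occur while `p` is executed in front of
the list `K`. -/
def conts : Prog → List Prog → Set (List Prog)
  | .skip, K => {.skip :: K}
  | .push i b, K => {.push i b :: K}
  | .app b, K => {.app b :: K}
  | .out b, K => {.out b :: K}
  | .seq p q, K => {.seq p q :: K} ∪ (conts p (q :: K) ∪ conts q K)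
  | .pop i e f t, K => {.pop i e f t :: K} ∪ (conts e K ∪ conts f K ∪ conts t K)
  | .query y n, K => {.query y n :: K} ∪ (conts y K ∪ conts n K)
  | .loop i f t, K =>
      {.loop i f t :: K} ∪ (conts f (.loop i f t :: K) ∪ conts t (.loop i f t :: K))

theorem finite_conts (p : Prog) : ∀ K, (conts p K).Finite := by
  induction p with
  | skip | push | app | out => intro K; exact Set.finite_singleton _
  | seq p q ihp ihq => intro K; exact (Set.finite_singleton _).union ((ihp _).union (ihq _))
  | pop i e f t ihe ihf iht =>
    intro K; exact (Set.finite_singleton _).union (((ihe _).union (ihf _)).union (iht _))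
  | query y n ihy ihn => intro K; exact (Set.finite_singleton _).union ((ihy _).union (ihn _))
  | loop i f t ihf iht => intro K; exact (Set.finite_singleton _).union ((ihf _).union (iht _))

theorem cons_mem_conts (p : Prog) (K : List Prog) : p :: K ∈ conts p K := by
  cases p <;> simp [conts]

/-- The instruction of the machine whose control state is a pending write (the second half of a
push) together with the list of programs still to be executed.  In the end the machine accepts
iff stack `1` is not empty. -/
def rawInstr : Option (Fin 8 × Bool) × List Prog → (Fin 8 → Option Bool) →
    Instr (Option (Fin 8 × Bool) × List Prog) 8
  | (some (i, b), K), σ => .step (none, K) (Function.update σ i (some b)) 0 none none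
  | (none, []), σ => .halt (σ 1).isSome
  | (none, .skip :: K), σ => .step (none, K) σ 0 none none
  | (none, .push i b :: K), σ => .step (some (i, b), K) σ (Function.update 0 i (-1)) none none
  | (none, .app b :: K), σ => .step (none, K) σ 0 (some b) none
  | (none, .out b :: K), σ => .step (none, K) σ 0 none (some b)
  | (none, .seq p q :: K), σ => .step (none, p :: q :: K) σ 0 none none
  | (none, .pop i e f t :: K), σ =>
      match σ i with
      | none => .step (none, e :: K) σ 0 none none
      | some b => .step (none, cond b t f :: K) (Function.update σ i none) (Function.update 0 i 1)
          none none
  | (none, .query y n :: K), _ => .query (none, y :: K) (none, n :: K)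
  | (none, .loop i f t :: K), σ =>
      match σ i with
      | none => .step (none, K) σ 0 none none
      | some b => .step (none, cond b t f :: .loop i f t :: K) (Function.update σ i none)
          (Function.update 0 i 1) none none

/-- The set of lists that serve as control states of the machine for `p`. -/
def controls (p : Prog) : Set (List Prog) := insert [] (conts p [])

open scoped Classical in
/-- Restriction of the control states to `p.controls`; other lists do not occur. -/
noncomputable def clamp (p : Prog) (q : Option (Fin 8 × Bool) × List Prog) :
    Option (Fin 8 × Bool) × p.controls :=
  (q.1, if h : q.2 ∈ p.controls then ⟨q.2, h⟩ else ⟨[], Set.mem_insert _ _⟩)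

/-- The machine that executes the program `p`. -/
noncomputable def toTM (p : Prog) : OracleTM where
  State := Option (Fin 8 × Bool) × p.controls
  finite_state := by
    have : Finite p.controls := ((finite_conts p []).insert []).to_subtype
    infer_instance
  k := 7
  start := (none, ⟨[p], Set.mem_insert_of_mem _ (cons_mem_conts p [])⟩)
  δ := fun q σ => (rawInstr (q.1, q.2.1) σ).map p.clamp

/-- The cells from position `h` on hold the list `l`, all other cells are blank. -/
def TapeIs (t : ℤ → Option Bool) (h : ℤ) (l : List Bool) : Prop :=
  ∀ z, t z = if h ≤ z then l[(z - h).toNat]? else none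

theorem TapeIs.scan {t : ℤ → Option Bool} {h : ℤ} {l : List Bool} (ht : TapeIs t h l) :
    t h = l.head? := by
  rw [ht h]
  simp [List.head?_eq_getElem?]

theorem TapeIs.pop {t : ℤ → Option Bool} {h : ℤ} {b : Bool} {l : List Bool}
    (ht : TapeIs t h (b :: l)) : TapeIs (Function.update t h none) (h + 1) l := by
  intro z
  rcases lt_trichotomy z h with hz | rfl | hz
  · rw [Function.update_of_ne hz.ne, ht, if_neg (by omega), if_neg (by omega)]
  · rw [Function.update_self, if_neg (by omega)]
  · rw [Function.update_of_ne hz.ne', ht, if_pos hz.le, if_pos (by omega),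
      show (z - h).toNat = (z - (h + 1)).toNat + 1 by omega, List.getElem?_cons_succ]

theorem TapeIs.push {t : ℤ → Option Bool} {h : ℤ} {l : List Bool} (b : Bool)
    (ht : TapeIs t h l) : TapeIs (Function.update t (h - 1) (some b)) (h - 1) (b :: l) := by
  intro z
  rcases lt_trichotomy z (h - 1) with hz | rfl | hz
  · rw [Function.update_of_ne hz.ne, ht, if_neg (by omega), if_neg (by omega)]
  · rw [Function.update_self, if_pos le_rfl]
    simp
  · rw [Function.update_of_ne hz.ne', ht, if_pos (by omega), if_pos (by omega),
      show (z - (h - 1)).toNat = (z - h).toNat + 1 by omega, List.getElem?_cons_succ]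

/-- The configuration `c` represents the memory `s` with the programs `K` to be executed. -/
structure Rep (p : Prog) (c : p.toTM.Cfg) (K : List Prog) (s : Store) : Prop where
  pending : c.state.1 = none
  control : c.state.2.1 = K
  stack : ∀ i : Fin 8, TapeIs (c.tape i) (c.head i) (s.get i)
  orc : c.oracleTape = s.orc
  out : c.output = s.out

theorem clamp_of_mem {p : Prog} {a : Option (Fin 8 × Bool)} {K : List Prog}
    (h : K ∈ p.controls) : p.clamp (a, K) = (a, ⟨K, h⟩) := by
  simp [clamp, h]

theorem Rep.instr {p : Prog} {c : p.toTM.Cfg} {K : List Prog} {s : Store} (h : Rep p c K s) :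
    OracleTM.instr c = (rawInstr (none, K) fun i => (s.get i).head?).map p.clamp := by
  have : (fun i : Fin 8 => c.tape i (c.head i)) = fun i => (s.get i).head? :=
    funext fun i => (h.stack i).scan
  change (rawInstr (c.state.1, c.state.2.1) (fun i : Fin 8 => c.tape i (c.head i))).map _ = _
  rw [h.pending, h.control, this]

theorem Rep.rewrite_tapes {p : Prog} {c : p.toTM.Cfg} {K : List Prog} {s : Store}
    (h : Rep p c K s) (i : Fin 8) :
    Function.update (c.tape i) (c.head i) (s.get i).head? = c.tape i := by
  rw [← (h.stack i).scan, Function.update_eq_self]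

/-- A step that only changes the control state, the oracle tape and the output tape. -/
theorem Rep.next_stay {p : Prog} {c : p.toTM.Cfg} {K K' : List Prog} {s : Store}
    (h : Rep p c K s) {o r : Option Bool} (hK' : K' ∈ p.controls)
    (hraw : rawInstr (none, K) (fun i => (s.get i).head?) =
      .step (none, K') (fun i => (s.get i).head?) 0 o r) (X : Set Word) :
    Rep p (OracleTM.next X c) K'
      { s with orc := s.orc ++ o.toList, out := s.out ++ r.toList } := by
  have hi := h.instr
  rw [hraw, Instr.map, clamp_of_mem hK'] at hi
  rw [OracleTM.next_of_step hi]
  refine ⟨rfl, rfl, fun i => ?_, ?_, ?_⟩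
  · change TapeIs (Function.update (c.tape i) (c.head i) (s.get i).head?)
      (c.head i + ((0 : SignType) : ℤ)) (s.get i)
    rw [h.rewrite_tapes]
    simpa using h.stack i
  · simp [h.orc]
  · simp [h.out]

/-- A step that pops a letter. -/
theorem Rep.next_pop {p : Prog} {c : p.toTM.Cfg} {K K' : List Prog} {s : Store}
    (h : Rep p c K s) {i : Fin 8} {b : Bool} {l : List Bool} (hK' : K' ∈ p.controls)
    (hl : s.get i = b :: l)
    (hraw : rawInstr (none, K) (fun i => (s.get i).head?) =
      .step (none, K') (Function.update (fun i => (s.get i).head?) i none)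
        (Function.update 0 i 1) none none) (X : Set Word) :
    Rep p (OracleTM.next X c) K' (s.set i l) := by
  have hi := h.instr
  rw [hraw, Instr.map, clamp_of_mem hK'] at hi
  rw [OracleTM.next_of_step hi]
  refine ⟨rfl, rfl, fun j => ?_, ?_, ?_⟩
  · change TapeIs (Function.update (c.tape j) (c.head j)
      (Function.update (fun i => (s.get i).head?) i none j))
      (c.head j + ((Function.update 0 i 1 : Fin 8 → SignType) j : ℤ)) _
    rw [Store.get_set]
    by_cases hj : j = i
    · subst hj
      simpa using ((hl ▸ h.stack j : TapeIs _ _ (b :: l))).pop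
    · rw [Function.update_of_ne hj, Function.update_of_ne hj, h.rewrite_tapes, if_neg hj]
      simpa using h.stack j
  · simp [h.orc, Store.orc_set]
  · simp [h.out, Store.out_set]

theorem Rep.next_push {p : Prog} {c : p.toTM.Cfg} {K : List Prog} {s : Store} {i : Fin 8}
    {b : Bool} (h : Rep p c (.push i b :: K) s) (hK : K ∈ p.controls) (X : Set Word) :
    Rep p (OracleTM.next X (OracleTM.next X c)) K (s.set i (b :: s.get i)) := by
  have hi := h.instr
  rw [rawInstr, Instr.map, clamp_of_mem hK] at hi
  set c' := OracleTM.next X c with hc'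
  rw [OracleTM.next_of_step hi] at hc'
  have hhead : ∀ j : Fin 8,
      c'.head j = c.head j + ((Function.update 0 i (-1) : Fin 8 → SignType) j : ℤ) := by
    intro j; rw [hc']
  have htape : ∀ j : Fin 8, c'.tape j = c.tape j := by
    intro j; rw [hc']; exact h.rewrite_tapes j
  have hi' : OracleTM.instr c' = (rawInstr (some (i, b), K)
      (fun j : Fin 8 => c'.tape j (c'.head j))).map p.clamp := by
    change (rawInstr (c'.state.1, c'.state.2.1) _).map _ = _
    rw [hc']
    rfl
  rw [rawInstr, Instr.map, clamp_of_mem hK] at hi'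
  have horc : c'.oracleTape = s.orc := by rw [hc']; simp [h.orc]
  have hout : c'.output = s.out := by rw [hc']; simp [h.out]
  rw [OracleTM.next_of_step hi']
  refine ⟨rfl, rfl, fun j => ?_, ?_, ?_⟩
  · change TapeIs (Function.update (c'.tape j) (c'.head j)
      (Function.update (fun j : Fin 8 => c'.tape j (c'.head j)) i (some b) j))
      (c'.head j + ((0 : SignType) : ℤ)) _
    rw [Store.get_set]
    by_cases hj : j = i
    · subst hj
      rw [Function.update_self, htape, hhead, Function.update_self, if_pos rfl]
      simpa [sub_eq_add_neg] using (h.stack j).push b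
    · rw [Function.update_of_ne hj, Function.update_eq_self, htape, hhead,
        Function.update_of_ne hj, if_neg hj]
      simpa using h.stack j
  · simp [horc, Store.orc_set]
  · simp [hout, Store.out_set]

theorem Rep.next_query {p : Prog} {c : p.toTM.Cfg} {K Ky Kn : List Prog} {s : Store}
    (h : Rep p c K s) (hy : Ky ∈ p.controls) (hn : Kn ∈ p.controls)
    (hraw : rawInstr (none, K) (fun i => (s.get i).head?) = .query (none, Ky) (none, Kn))
    (X : Set Word) :
    (s.orc ∈ X → Rep p (OracleTM.next X c) Ky { s with orc := [] }) ∧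
      (s.orc ∉ X → Rep p (OracleTM.next X c) Kn { s with orc := [] }) := by
  have hi := h.instr
  rw [hraw, Instr.map, clamp_of_mem hy, clamp_of_mem hn] at hi
  refine ⟨fun hX => ?_, fun hX => ?_⟩
  · rw [OracleTM.next_of_query_mem hi (h.orc ▸ hX)]
    exact ⟨rfl, rfl, h.stack, rfl, h.out⟩
  · rw [OracleTM.next_of_query_notMem hi (h.orc ▸ hX)]
    exact ⟨rfl, rfl, h.stack, rfl, h.out⟩

/-- The machine for `p₀` executes each part `p` of `p₀` as `Run` says. -/
theorem Run.rep {p₀ p : Prog} {s s' : Store} {n : ℕ} (hr : Run X p s s' n) :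
    ∀ K, conts p K ⊆ p₀.controls → K ∈ p₀.controls → ∀ c : p₀.toTM.Cfg,
      Rep p₀ c (p :: K) s → Rep p₀ ((OracleTM.next X)^[n] c) K s' := by
  induction hr with
  | skip s =>
    intro K _ hK c hc
    simpa using hc.next_stay hK rfl X
  | push i b s =>
    intro K _ hK c hc
    exact hc.next_push hK X
  | app b s =>
    intro K _ hK c hc
    simpa using hc.next_stay hK rfl X
  | out b s =>
    intro K _ hK c hc
    simpa using hc.next_stay hK rfl X
  | @seq p q s s' s'' m n _ _ ihp ihq =>
    intro K hsub hK c hc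
    have h1 : conts p (q :: K) ⊆ p₀.controls := fun L hL => hsub (.inr (.inl hL))
    have h2 : conts q K ⊆ p₀.controls := fun L hL => hsub (.inr (.inr hL))
    have h0 := hc.next_stay (h1 (cons_mem_conts p _)) rfl X
    simp only [Option.toList_none, List.append_nil] at h0
    rw [add_comm 1 m, add_comm, Function.iterate_add_apply, Function.iterate_succ_apply]
    exact ihq K h2 hK _ (ihp _ h1 (h2 (cons_mem_conts q K)) _ h0)
  | @popE i e f t s s' n hs _ ih =>
    intro K hsub hK c hc
    have h1 : conts e K ⊆ p₀.controls := fun L hL => hsub (.inr (.inl (.inl hL)))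
    have h0 := hc.next_stay (K' := e :: K) (o := none) (r := none) (h1 (cons_mem_conts e _))
      (by simp [rawInstr, hs]) X
    simp only [Option.toList_none, List.append_nil] at h0
    rw [add_comm, Function.iterate_succ_apply]
    exact ih K h1 hK _ h0
  | @popL i e f t s s' b l n hs _ ih =>
    intro K hsub hK c hc
    have h1 : conts (cond b t f) K ⊆ p₀.controls := by
      cases b
      · exact fun L hL => hsub (.inr (.inl (.inr hL)))
      · exact fun L hL => hsub (.inr (.inr hL))
    have h0 := hc.next_pop (K' := cond b t f :: K) (h1 (cons_mem_conts _ _)) hs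
      (by simp [rawInstr, hs]) X
    rw [add_comm, Function.iterate_succ_apply]
    exact ih K h1 hK _ h0
  | @queryY y n s s' m hs _ ih =>
    intro K hsub hK c hc
    have h1 : conts y K ⊆ p₀.controls := fun L hL => hsub (.inr (.inl hL))
    have h2 : conts n K ⊆ p₀.controls := fun L hL => hsub (.inr (.inr hL))
    have h0 := (hc.next_query (h1 (cons_mem_conts _ _)) (h2 (cons_mem_conts _ _)) rfl X).1 hs
    rw [add_comm, Function.iterate_succ_apply]
    exact ih K h1 hK _ h0
  | @queryN y n s s' m hs _ ih =>
    intro K hsub hK c hc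
    have h1 : conts y K ⊆ p₀.controls := fun L hL => hsub (.inr (.inl hL))
    have h2 : conts n K ⊆ p₀.controls := fun L hL => hsub (.inr (.inr hL))
    have h0 := (hc.next_query (h1 (cons_mem_conts _ _)) (h2 (cons_mem_conts _ _)) rfl X).2 hs
    rw [add_comm, Function.iterate_succ_apply]
    exact ih K h2 hK _ h0
  | @loopE i f t s hs =>
    intro K hsub hK c hc
    have h0 := hc.next_stay (K' := K) (o := none) (r := none) hK (by simp [rawInstr, hs]) X
    simpa using h0
  | @loopL i f t s s' s'' b l m n hs _ _ ih1 ih2 =>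
    intro K hsub hK c hc
    have h1 : conts (cond b t f) (.loop i f t :: K) ⊆ p₀.controls := by
      cases b
      · exact fun L hL => hsub (.inr (.inl hL))
      · exact fun L hL => hsub (.inr (.inr hL))
    have h0 := hc.next_pop (K' := cond b t f :: .loop i f t :: K) (h1 (cons_mem_conts _ _)) hs
      (by simp [rawInstr, hs]) X
    rw [add_comm 1 m, add_comm, Function.iterate_add_apply, Function.iterate_succ_apply]
    exact ih2 K hsub hK _ (ih1 _ h1 (hsub (cons_mem_conts _ _)) _ h0)

theorem rep_init (p : Prog) (x : Word) : Rep p (p.toTM.init x) [p] (Store.input x) := by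
  refine ⟨rfl, rfl, fun i z => ?_, rfl, rfl⟩
  change (if i = 0 ∧ 0 ≤ z then x[z.toNat]? else none) =
    if (0 : ℤ) ≤ z then ((Store.input x).get i)[(z - 0).toNat]? else none
  by_cases hz : 0 ≤ z
  · fin_cases i <;> simp [hz, Store.input, Store.get]
  · simp [hz]

theorem Run.cfgAt {p : Prog} {x : Word} {s : Store} {n : ℕ} (h : Run X p (Store.input x) s n) :
    Rep p (p.toTM.cfgAt X x n) [] s :=
  h.rep [] (Set.subset_insert _ _) (Set.mem_insert _ _) _ (rep_init p x)

/-- The machine accepts iff stack `1` is not empty in the end. -/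
theorem Run.haltsWithin {p : Prog} {x : Word} {s : Store} {n : ℕ}
    (h : Run X p (Store.input x) s n) :
    p.toTM.HaltsWithin X x n s.r1.head?.isSome := by
  have := h.cfgAt.instr
  simp only [rawInstr, Instr.map] at this
  exact this

/-- With oracle `X`, the program `p` transforms the memory `s` into `s'` in at most `T` steps. -/
def Runs (X : Set Word) (p : Prog) (s s' : Store) (T : ℕ) : Prop :=
  ∃ n ≤ T, Run X p s s' n

theorem mem_FP_of_runs (p : Prog) (q : Polynomial ℕ) (f : Word → Word)
    (h : ∀ x, ∃ s, Runs X p (Store.input x) s (q.eval x.length) ∧ s.out = f x) : f ∈ FP X := by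
  refine ⟨p.toTM, q, fun x => ?_⟩
  obtain ⟨s, ⟨n, hn, hr⟩, hs⟩ := h x
  refine ⟨⟨_, hr.haltsWithin.mono hn⟩, ?_⟩
  rw [hr.haltsWithin.cfgAt_eq hn, hr.cfgAt.out, hs]

end Prog

namespace Prog

variable {X : Set Word}

/-! ### Time-bounded execution of stack programs -/

theorem Runs.mono {p : Prog} {s s' : Store} {T T' : ℕ} (h : Runs X p s s' T) (hT : T ≤ T') :
    Runs X p s s' T' :=
  let ⟨n, hn, hr⟩ := h
  ⟨n, hn.trans hT, hr⟩

theorem Runs.skip (s : Store) : Runs X .skip s s 1 := ⟨1, le_rfl, .skip s⟩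

theorem Runs.push (i : Fin 8) (b : Bool) (s : Store) :
    Runs X (.push i b) s (s.set i (b :: s.get i)) 2 := ⟨2, le_rfl, .push i b s⟩

theorem Runs.app (b : Bool) (s : Store) :
    Runs X (.app b) s { s with orc := s.orc ++ [b] } 1 := ⟨1, le_rfl, .app b s⟩

theorem Runs.out (b : Bool) (s : Store) :
    Runs X (.out b) s { s with out := s.out ++ [b] } 1 := ⟨1, le_rfl, .out b s⟩

theorem Runs.seq {p q : Prog} {s s' s'' : Store} {a b : ℕ} (h : Runs X p s s' a)
    (h' : Runs X q s' s'' b) : Runs X (.seq p q) s s'' (1 + a + b) :=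
  let ⟨_, hm, hr⟩ := h
  let ⟨_, hn, hr'⟩ := h'
  ⟨_, by omega, hr.seq hr'⟩

theorem Runs.popE {i : Fin 8} {e f t : Prog} {s s' : Store} {a : ℕ} (hs : s.get i = [])
    (h : Runs X e s s' a) : Runs X (.pop i e f t) s s' (1 + a) :=
  let ⟨_, hm, hr⟩ := h
  ⟨_, by omega, .popE hs hr⟩

theorem Runs.popL {i : Fin 8} {e f t : Prog} {s s' : Store} {a : ℕ} {b : Bool} {l : List Bool}
    (hs : s.get i = b :: l) (h : Runs X (cond b t f) (s.set i l) s' a) :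
    Runs X (.pop i e f t) s s' (1 + a) :=
  let ⟨_, hm, hr⟩ := h
  ⟨_, by omega, .popL hs hr⟩

theorem Runs.queryY {y n : Prog} {s s' : Store} {a : ℕ} (hs : s.orc ∈ X)
    (h : Runs X y { s with orc := [] } s' a) : Runs X (.query y n) s s' (1 + a) :=
  let ⟨_, hm, hr⟩ := h
  ⟨_, by omega, .queryY hs hr⟩

theorem Runs.queryN {y n : Prog} {s s' : Store} {a : ℕ} (hs : s.orc ∉ X)
    (h : Runs X n { s with orc := [] } s' a) : Runs X (.query y n) s s' (1 + a) :=
  let ⟨_, hm, hr⟩ := h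
  ⟨_, by omega, .queryN hs hr⟩

theorem Runs.loopE {i : Fin 8} {f t : Prog} {s : Store} (hs : s.get i = []) :
    Runs X (.loop i f t) s s 1 := ⟨1, le_rfl, .loopE hs⟩

theorem Runs.loopL {i : Fin 8} {f t : Prog} {s s' s'' : Store} {a c : ℕ} {b : Bool}
    {l : List Bool} (hs : s.get i = b :: l) (h : Runs X (cond b t f) (s.set i l) s' a)
    (h' : Runs X (.loop i f t) s' s'' c) : Runs X (.loop i f t) s s'' (1 + a + c) :=
  let ⟨_, hm, hr⟩ := h
  let ⟨_, hn, hr'⟩ := h'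
  ⟨_, by omega, .loopL hs hr hr'⟩

/-- A loop that runs through the memories `S 0, …, S n`. -/
theorem Runs.loop {i : Fin 8} {p : Prog} {T : ℕ} : ∀ (n : ℕ) (S : ℕ → Store),
    (∀ k < n, ∃ b l, (S k).get i = b :: l ∧ Runs X p ((S k).set i l) (S (k + 1)) T) →
    (S n).get i = [] → Runs X (.loop i p p) (S 0) (S n) (n * (T + 1) + 1)
  | 0, S, _, h0 => (Runs.loopE h0).mono (by omega)
  | n + 1, S, hS, h0 => by
    obtain ⟨b, l, hb, hr⟩ := hS 0 n.succ_pos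
    have := Runs.loop n (fun k => S (k + 1)) (fun k hk => hS (k + 1) (by omega)) h0
    have h1 : Runs X (cond b p p) ((S 0).set i l) (S 1) T := by cases b <;> exact hr
    exact (Runs.loopL hb h1 this).mono (by ring_nf; omega)

/-- Push the letters of `l` one after the other. -/
def pushBits (i : Fin 8) : List Bool → Prog
  | [] => .skip
  | b :: l => .seq (.push i b) (pushBits i l)

theorem Store.set_set (s : Store) (i : Fin 8) (l l' : List Bool) :
    (s.set i l).set i l' = s.set i l' := by
  fin_cases i <;> rfl

theorem Store.set_get (s : Store) (i : Fin 8) : s.set i (s.get i) = s := by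
  fin_cases i <;> rfl

theorem runs_pushBits (i : Fin 8) (l : List Bool) (s : Store) :
    Runs X (pushBits i l) s (s.set i (l.reverse ++ s.get i)) (3 * l.length + 1) := by
  induction l generalizing s with
  | nil =>
    rw [List.reverse_nil, List.nil_append, Store.set_get]
    exact Runs.skip s
  | cons b l ih =>
    have := (Runs.push (X := X) i b s).seq (ih _)
    simp only [Store.set_set, Store.get_set, if_true] at this
    simp only [List.reverse_cons, List.append_assoc, List.singleton_append]
    exact this.mono (by simp; omega)

/-- Append `n` letters `0` on the oracle tape. -/
def appZeros : ℕ → Prog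
  | 0 => .skip
  | n + 1 => .seq (.app false) (appZeros n)

theorem runs_appZeros (n : ℕ) (s : Store) :
    Runs X (appZeros n) s { s with orc := s.orc ++ List.replicate n false } (2 * n + 1) := by
  induction n generalizing s with
  | zero =>
    rw [List.replicate_zero, List.append_nil]
    exact Runs.skip s
  | succ n ih =>
    have := (Runs.app (X := X) false s).seq (ih _)
    rw [List.append_assoc, List.singleton_append, ← List.replicate_succ] at this
    exact this.mono (by omega)

/-- Write a word on the output tape. -/
def outWord : Word → Prog
  | [] => .skip
  | b :: w => .seq (.out b) (outWord w)

theorem runs_outWord (w : Word) (s : Store) :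
    Runs X (outWord w) s { s with out := s.out ++ w } (2 * w.length + 1) := by
  induction w generalizing s with
  | nil =>
    rw [List.append_nil]
    exact Runs.skip s
  | cons b w ih =>
    have := (Runs.out (X := X) b s).seq (ih _)
    rw [List.append_assoc, List.singleton_append] at this
    exact this.mono (by simp; omega)

/-- Empty stack `i`. -/
def drain (i : Fin 8) : Prog := .loop i .skip .skip

theorem runs_drain (i : Fin 8) (l : List Bool) (s : Store) (hl : s.get i = l) :
    Runs X (drain i) s (s.set i []) (2 * l.length + 1) := by
  induction l generalizing s with
  | nil =>
    rw [← hl, Store.set_get, hl]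
    exact Runs.loopE hl
  | cons b l ih =>
    have h1 : Runs X (cond b Prog.skip Prog.skip) (s.set i l) (s.set i l) 1 := by
      cases b <;> exact Runs.skip _
    have := Runs.loopL hl h1 (ih (s.set i l) (by rw [Store.get_set, if_pos rfl]))
    rw [Store.set_set] at this
    exact this.mono (by simp; omega)

/-- Move stack `1` letter by letter to stack `0`. -/
def rewind : Prog := .loop 1 (.push 0 false) (.push 0 true)

theorem runs_rewind (l r0 r2 r3 r4 r5 r6 r7 : List Bool) (o w : Word) :
    Runs X rewind ⟨r0, l, r2, r3, r4, r5, r6, r7, o, w⟩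
      ⟨l.reverse ++ r0, [], r2, r3, r4, r5, r6, r7, o, w⟩ (3 * l.length + 1) := by
  induction l generalizing r0 with
  | nil => exact Runs.loopE rfl
  | cons b l ih =>
    have h1 : Runs X (cond b (Prog.push 0 true) (Prog.push 0 false))
        ⟨r0, l, r2, r3, r4, r5, r6, r7, o, w⟩ ⟨b :: r0, l, r2, r3, r4, r5, r6, r7, o, w⟩ 2 := by
      cases b <;> exact Runs.push _ _ _
    have := Runs.loopL (s := ⟨r0, b :: l, r2, r3, r4, r5, r6, r7, o, w⟩) rfl h1 (ih (b :: r0))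
    simp only [List.reverse_cons, List.append_assoc, List.singleton_append]
    exact this.mono (by simp; omega)

end Prog

/-! ### The alphabet of traces -/

/-- The letters of traces.  A trace describes a run of a machine: `blk` begins the description of
a step, `tp σ w m` says that on the next tape the symbol `σ` is read and replaced by `w` and the
head is moved by `m`, `ap b` and `ot b` say that `b` is appended on the oracle tape and on the
output tape, `an b` says that the oracle is asked and gives the answer `b`.  The letters `wt` serve
to count the steps, runs of letters `unit` are numbers of nodes of an automaton, and `init` and
`eof` do not occur in traces but in the names of edges of this automaton. -/
inductive Sym : Type
  | unit
  | wt
  | init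
  | eof
  | blk
  | ap (b : Bool)
  | an (b : Bool)
  | ot (b : Bool)
  | tp (σ w : Option Bool) (m : SignType)

/-- Two bits for the content of a tape cell. -/
def cellBits : Option Bool → List Bool
  | none => [false, false]
  | some b => [true, b]

namespace Sym

/-- Seven bits for each letter. -/
def bits : Sym → List Bool
  | unit => [false, false, false, false, false, false, false]
  | wt => [false, false, false, false, false, false, true]
  | init => [false, false, false, false, false, true, false]
  | eof => [false, false, false, false, false, true, true]
  | blk => [false, false, false, false, true, false, false]
  | ap b => [false, true, false, false, false, false, b]
  | an b => [false, true, false, false, false, true, b]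
  | ot b => [false, true, false, false, true, false, b]
  | tp σ w m => true :: (cellBits σ ++ cellBits w ++
      match m with
      | .zero => [false, false]
      | .pos => [true, true]
      | .neg => [true, false])

/-- The content of a tape cell that is encoded by two bits. -/
def cellOf (a b : Bool) : Option Bool := if a then some b else none

/-- The letter encoded by seven bits. -/
def ofBits : List Bool → Sym
  | [true, a, b, c, d, e, f] =>
      tp (cellOf a b) (cellOf c d) (if e then (if f then 1 else -1) else 0)
  | [false, true, _, _, d, e, b] => if d then ot b else if e then an b else ap b
  | [false, false, _, _, d, e, b] =>
      if d then blk else if e then (if b then eof else init) else (if b then wt else unit)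
  | _ => unit

theorem ofBits_bits (a : Sym) : ofBits a.bits = a := by
  rcases a with _ | _ | _ | _ | _ | b | b | b | ⟨_ | σ, _ | w, _ | _ | _⟩ <;> rfl

theorem length_bits (a : Sym) : a.bits.length = 7 := by
  rcases a with _ | _ | _ | _ | _ | b | b | b | ⟨_ | σ, _ | w, _ | _ | _⟩ <;> rfl

/-- The number with binary digits `l`. -/
def ofDigits : List Bool → ℕ
  | [] => 0
  | b :: l => 2 * ofDigits l + b.toNat

theorem ofDigits_lt (l : List Bool) : ofDigits l < 2 ^ l.length := by
  induction l with
  | nil => simp [ofDigits]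
  | cons b l ih =>
    have := Bool.toNat_lt b
    simp only [ofDigits, List.length_cons, pow_succ]
    omega

theorem ofDigits_injective : ∀ l l' : List Bool, l.length = l'.length →
    ofDigits l = ofDigits l' → l = l'
  | [], [], _, _ => rfl
  | b :: l, b' :: l', hl, h => by
    simp only [ofDigits] at h
    have hb := Bool.toNat_lt b
    have hb' := Bool.toNat_lt b'
    have h1 : b.toNat = b'.toNat := by omega
    have h2 : b = b' := by cases b <;> cases b' <;> simp_all
    rw [ofDigits_injective l l' (by simpa using hl) (by omega), h2]

/-- A number for each letter. -/
def code (a : Sym) : ℕ := ofDigits a.bits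

theorem code_lt (a : Sym) : a.code < 128 := by
  have := ofDigits_lt a.bits
  rwa [length_bits] at this

theorem code_injective : Function.Injective code := fun a b h => by
  rw [← ofBits_bits a, ← ofBits_bits b,
    ofDigits_injective _ _ (by rw [length_bits, length_bits]) h]

instance : Countable Sym := code_injective.countable

end Sym

/-- The bit representation of a list of letters. -/
def flat (v : List Sym) : List Bool := v.flatMap Sym.bits

/-- The list of letters that a word is read as; an incomplete letter at the end is ignored. -/
def parse : List Bool → List Sym
  | a :: b :: c :: d :: e :: f :: g :: l => Sym.ofBits [a, b, c, d, e, f, g] :: parse l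
  | _ => []

theorem flat_cons (a : Sym) (v : List Sym) : flat (a :: v) = a.bits ++ flat v := rfl

theorem parse_flat (v : List Sym) : parse (flat v) = v := by
  induction v with
  | nil => rfl
  | cons a v ih =>
    obtain ⟨b1, b2, b3, b4, b5, b6, b7, hb⟩ : ∃ b1 b2 b3 b4 b5 b6 b7,
        a.bits = [b1, b2, b3, b4, b5, b6, b7] := by
      rcases a with _ | _ | _ | _ | _ | b | b | b | ⟨_ | σ, _ | w, _ | _ | _⟩ <;>
        exact ⟨_, _, _, _, _, _, _, rfl⟩
    have := Sym.ofBits_bits a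
    rw [hb] at this
    rw [flat_cons, hb]
    simp [parse, ih, this]

theorem length_flat (v : List Sym) : (flat v).length = 7 * v.length := by
  induction v with
  | nil => rfl
  | cons a v ih => rw [flat_cons, List.length_append, Sym.length_bits, ih, List.length_cons]; ring

theorem length_parse_le : ∀ l : List Bool, (parse l).length ≤ l.length
  | a :: b :: c :: d :: e :: f :: g :: l => by
    have := length_parse_le l
    simp only [parse, List.length_cons]
    omega
  | [] | [_] | [_, _] | [_, _, _] | [_, _, _, _] | [_, _, _, _, _] | [_, _, _, _, _, _] => by
    simp [parse]

namespace Prog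

variable {X : Set Word}

/-- Pop `n` letters from stack `0`, append them to `acc` and continue with `k`; do nothing more if
the stack has fewer letters. -/
def readBits (k : List Bool → Prog) : ℕ → List Bool → Prog
  | 0, acc => k acc
  | n + 1, acc => .pop 0 .skip (readBits k n (acc ++ [false])) (readBits k n (acc ++ [true]))

theorem runs_readBits {k : List Bool → Prog} {l acc rest : List Bool} {s s' : Store} {T : ℕ}
    (h : Runs X (k (acc ++ l)) (s.set 0 rest) s' T) :
    Runs X (readBits k l.length acc) (s.set 0 (l ++ rest)) s' (l.length + T) := by
  induction l generalizing acc with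
  | nil => simpa [readBits] using h
  | cons b l ih =>
    have h1 : Runs X (cond b (readBits k l.length (acc ++ [true]))
        (readBits k l.length (acc ++ [false]))) (s.set 0 (l ++ rest)) s' (l.length + T) := by
      have := ih (acc := acc ++ [b]) (by simpa using h)
      cases b <;> exact this
    rw [← Store.set_set s 0 (b :: (l ++ rest)) (l ++ rest)] at h1
    exact (Runs.popL (by rw [Store.get_set]; rfl) h1).mono (by rw [List.length_cons]; omega)

theorem runs_readBits_short {k : List Bool → Prog} {n : ℕ} {l acc : List Bool} {s : Store}
    (h : l.length < n) :
    Runs X (readBits k n acc) (s.set 0 l) (s.set 0 []) (l.length + 2) := by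
  induction l generalizing acc n with
  | nil =>
    obtain ⟨n, rfl⟩ := Nat.exists_eq_succ_of_ne_zero (by simp at h; omega : n ≠ 0)
    exact Runs.popE (by rw [Store.get_set]; rfl) (Runs.skip _)
  | cons b l ih =>
    obtain ⟨n, rfl⟩ := Nat.exists_eq_succ_of_ne_zero (by simp at h; omega : n ≠ 0)
    have hl : l.length < n := by rw [List.length_cons] at h; omega
    have h1 : Runs X (cond b (readBits k n (acc ++ [true])) (readBits k n (acc ++ [false])))
        ((s.set 0 (b :: l)).set 0 l) (s.set 0 []) (l.length + 2) := by
      rw [Store.set_set]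
      cases b <;> exact ih hl
    exact (Runs.popL (by rw [Store.get_set]; rfl) h1).mono (by rw [List.length_cons]; omega)

/-- Pop letter after letter of the trace on stack `0` and execute `body` for each of them. -/
def sweep (body : Sym → Prog) : Prog :=
  .loop 0 (readBits (fun l => body (Sym.ofBits l)) 6 [false])
    (readBits (fun l => body (Sym.ofBits l)) 6 [true])

theorem runs_sweep_short (body : Sym → Prog) {l : List Bool} {s : Store} (h : l.length < 7) :
    Runs X (sweep body) (s.set 0 l) (s.set 0 []) 10 := by
  rcases l with _ | ⟨b, l⟩
  · exact (Runs.loopE (by rw [Store.get_set]; rfl)).mono (by omega)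
  · have hl : l.length < 6 := by rw [List.length_cons] at h; omega
    have h1 : Runs X (cond b (readBits (fun l => body (Sym.ofBits l)) 6 [true])
        (readBits (fun l => body (Sym.ofBits l)) 6 [false])) ((s.set 0 (b :: l)).set 0 l)
        (s.set 0 []) (l.length + 2) := by
      rw [Store.set_set]
      cases b <;> exact runs_readBits_short hl
    exact (Runs.loopL (by rw [Store.get_set]; rfl) h1
      (Runs.loopE (by rw [Store.get_set]; rfl))).mono (by omega)

theorem runs_sweep_word {body : Sym → Prog} {b1 b2 b3 b4 b5 b6 b7 : Bool} {l : List Bool}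
    {s s' s'' : Store} {T T' : ℕ}
    (h : Runs X (body (Sym.ofBits [b1, b2, b3, b4, b5, b6, b7])) (s.set 0 l) s' T)
    (h' : Runs X (sweep body) s' s'' T') :
    Runs X (sweep body) (s.set 0 (b1 :: b2 :: b3 :: b4 :: b5 :: b6 :: b7 :: l)) s''
      (7 + T + T') := by
  have h1 : Runs X (readBits (fun l => body (Sym.ofBits l)) 6 [b1])
      (s.set 0 (b2 :: b3 :: b4 :: b5 :: b6 :: b7 :: l)) s' (6 + T) :=
    runs_readBits (l := [b2, b3, b4, b5, b6, b7]) h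
  refine (Runs.loopL (b := b1) (l := b2 :: b3 :: b4 :: b5 :: b6 :: b7 :: l) (a := 6 + T)
    (by rw [Store.get_set]; rfl) ?_ h').mono (by omega)
  rw [Store.set_set]
  cases b1 <;> exact h1

theorem runs_sweep_cons {body : Sym → Prog} {a : Sym} {l : List Bool}
    {s s' s'' : Store} {T T' : ℕ} (h : Runs X (body a) (s.set 0 l) s' T)
    (h' : Runs X (sweep body) s' s'' T') :
    Runs X (sweep body) (s.set 0 (a.bits ++ l)) s'' (7 + T + T') := by
  obtain ⟨b1, b2, b3, b4, b5, b6, b7, hb⟩ : ∃ b1 b2 b3 b4 b5 b6 b7,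
      a.bits = [b1, b2, b3, b4, b5, b6, b7] := by
    rcases a with _ | _ | _ | _ | _ | b | b | b | ⟨_ | σ, _ | w, _ | _ | _⟩ <;>
      exact ⟨_, _, _, _, _, _, _, rfl⟩
  have ha := Sym.ofBits_bits a
  rw [hb] at ha ⊢
  rw [← ha] at h
  exact runs_sweep_word h h'

/-- Put a letter on stack `1`. -/
def keep (a : Sym) : Prog := pushBits 1 a.bits

theorem runs_keep (a : Sym) (r0 r1 r2 r3 r4 r5 r6 r7 : List Bool) (o w : Word) :
    Runs X (keep a) ⟨r0, r1, r2, r3, r4, r5, r6, r7, o, w⟩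
      ⟨r0, a.bits.reverse ++ r1, r2, r3, r4, r5, r6, r7, o, w⟩ 22 := by
  have := runs_pushBits (X := X) 1 a.bits ⟨r0, r1, r2, r3, r4, r5, r6, r7, o, w⟩
  rw [Sym.length_bits] at this
  exact this

theorem runs_sweep_keep (z r1 r2 r3 r4 r5 r6 r7 : List Bool) (o w : Word) :
    Runs X (sweep keep) ⟨z, r1, r2, r3, r4, r5, r6, r7, o, w⟩
      ⟨[], (flat (parse z)).reverse ++ r1, r2, r3, r4, r5, r6, r7, o, w⟩
      (29 * (parse z).length + 10) := by
  induction z using parse.induct generalizing r1 with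
  | case1 a b c d e f g l ih =>
    have := runs_sweep_word (s := ⟨l, r1, r2, r3, r4, r5, r6, r7, o, w⟩)
      (runs_keep (X := X) (Sym.ofBits [a, b, c, d, e, f, g]) l r1 r2 r3 r4 r5 r6 r7 o w) (ih _)
    simp only [parse, flat_cons, List.reverse_append, List.append_assoc]
    exact this.mono (by simp only [List.length_cons]; omega)
  | case2 z hz =>
    have hl : z.length < 7 := by
      rcases z with _ | ⟨a, _ | ⟨b, _ | ⟨c, _ | ⟨d, _ | ⟨e, _ | ⟨f, _ | ⟨g, l⟩⟩⟩⟩⟩⟩⟩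
      all_goals first | exact (hz _ _ _ _ _ _ _ _ rfl).elim | simp
    have hp : parse z = [] := by
      rw [parse]
      exact hz
    rw [hp]
    exact runs_sweep_short keep (s := ⟨z, r1, r2, r3, r4, r5, r6, r7, o, w⟩) hl

end Prog

/-! ### The passes of the trace verifier -/

/-- The word `0 ^ n`. -/
abbrev zeros (n : ℕ) : Word := List.replicate n false

/-- Oracle words for edges of the automaton. -/
def EdgeBit (X : Set Word) (n : ℕ) : Prop := zeros (4 * n + 1) ∈ X

/-- Oracle words for nodes of the automaton. -/
def NodeBit (X : Set Word) (n : ℕ) : Prop := zeros (4 * n + 2) ∈ X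

/-- The automaton accepts the trace `v`, if `p` is the number of the previous node plus the code
of the letter that follows it, and `c` counts the units of the current node that were read. -/
def PathOK (X : Set Word) : ℕ → ℕ → List Sym → Prop
  | p, c, [] => EdgeBit X (p + 2 * c) ∧ NodeBit X c ∧ EdgeBit X (c + Sym.eof.code)
  | p, c, .unit :: v => PathOK X p (c + 1) v
  | p, c, a :: v => EdgeBit X (p + 2 * c) ∧ NodeBit X c ∧ PathOK X (c + a.code) 0 v

/-- The oracle answers in the trace are correct, if `o` is on the oracle tape at the beginning. -/
def AnswersOK (X : Set Word) : Word → List Sym → Prop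
  | _, [] => True
  | o, .ap b :: v => AnswersOK X (o ++ [b]) v
  | o, .an b :: v => (o ∈ X ↔ b = true) ∧ AnswersOK X [] v
  | o, _ :: v => AnswersOK X o v

/-- The number of letters `wt` in a trace. -/
def weight : List Sym → ℕ
  | [] => 0
  | .wt :: v => weight v + 1
  | _ :: v => weight v

/-- The word written on the output tape according to a trace. -/
def outs : List Sym → Word
  | [] => []
  | .ot b :: v => b :: outs v
  | _ :: v => outs v

/-- What happens on one tape in one step: symbol read, symbol written, move. -/
abbrev TapeOp : Type := Option Bool × Option Bool × SignType

/-- The first letter `tp` of every block.  The flag says that the current block already had one. -/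
def firstOps : Bool → List Sym → List TapeOp
  | _, [] => []
  | false, .tp σ w m :: v => (σ, w, m) :: firstOps true v
  | true, .tp _ _ _ :: v => firstOps true v
  | _, .blk :: v => firstOps false v
  | u, _ :: v => firstOps u v

/-- Delete the first letter `tp` of every block. -/
def dropOps : Bool → List Sym → List Sym
  | _, [] => []
  | false, .tp _ _ _ :: v => dropOps true v
  | true, .tp σ w m :: v => .tp σ w m :: dropOps true v
  | _, .blk :: v => .blk :: dropOps false v
  | u, a :: v => a :: dropOps u v

theorem length_dropOps_le (u : Bool) (v : List Sym) : (dropOps u v).length ≤ v.length := by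
  induction v generalizing u with
  | nil => simp [dropOps]
  | cons a v ih =>
    cases a <;> cases u <;> simp only [dropOps, List.length_cons] <;>
      first | exact Nat.succ_le_succ (ih _) | exact (ih _).trans (Nat.le_succ _)

/-- Write `w` and move the head by `m`, on a tape with the cells `L` on the left (nearest first),
whose scanned cell is no longer of interest and which has the cells `R` on the right of it. -/
def zipMove (w : Option Bool) (L R : List (Option Bool)) :
    SignType → List (Option Bool) × List (Option Bool)
  | .zero => (L, w :: R)
  | .pos => (w :: L, R)
  | .neg => (L.tail, L.head?.join :: w :: R)

/-- The operations are possible on a tape with the cells `L` on the left of the head (nearest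
first) and the cells `R` from the head on; all other cells are blank. -/
def OpsOK : List (Option Bool) → List (Option Bool) → List TapeOp → Prop
  | _, _, [] => True
  | L, R, (σ, w, m) :: ops =>
      R.head?.join = σ ∧ OpsOK (zipMove w L R.tail m).1 (zipMove w L R.tail m).2 ops

/-- The bit representation of a list of cells. -/
def cellsBits (L : List (Option Bool)) : List Bool := L.flatMap cellBits

theorem cellsBits_cons (a : Option Bool) (L : List (Option Bool)) :
    cellsBits (a :: L) = cellBits a ++ cellsBits L := rfl

theorem length_cellsBits (L : List (Option Bool)) : (cellsBits L).length = 2 * L.length := by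
  induction L with
  | nil => rfl
  | cons a L ih =>
    rw [cellsBits_cons, List.length_append, ih]
    cases a <;> simp [cellBits] <;> ring

/-- The number of units that the squaring program makes of `n` units. -/
def sq (n : ℕ) : ℕ := n * (n + 1)

namespace Prog

variable {X : Set Word}

/-- Units on a stack. -/
abbrev units (n : ℕ) : List Bool := List.replicate n true

/-- Record a failure on stack `4`. -/
def fail : Prog := .push 4 true

/-- The stack `F'` of failures results from `F` by a check of the condition `P`. -/
def Checks (P : Prop) (F F' : List Bool) : Prop := F' = [] ↔ F = [] ∧ P

theorem Checks.of_true {P : Prop} {F : List Bool} (h : P) : Checks P F F := by simp [Checks, h]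

theorem Checks.of_false {P : Prop} {F : List Bool} {b : Bool} (h : ¬ P) :
    Checks P F (b :: F) := by simp [Checks, h]

theorem Checks.and {P Q : Prop} {F F' F'' : List Bool} (h : Checks P F F') (h' : Checks Q F' F'') :
    Checks (P ∧ Q) F F'' := by
  unfold Checks at *
  tauto

theorem Checks.congr {P Q : Prop} {F F' : List Bool} (h : Checks P F F') (hPQ : P ↔ Q) :
    Checks Q F F' := by
  unfold Checks at *
  tauto

theorem runs_query_check (r0 r1 r2 r3 r4 r5 r6 r7 : List Bool) (o w : Word) :
    ∃ F, Checks (o ∈ X) r4 F ∧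
      Runs X (.query .skip fail) ⟨r0, r1, r2, r3, r4, r5, r6, r7, o, w⟩
        ⟨r0, r1, r2, r3, F, r5, r6, r7, [], w⟩ 3 := by
  by_cases h : o ∈ X
  · exact ⟨r4, .of_true h, (Runs.queryY h (Runs.skip _)).mono (by omega)⟩
  · exact ⟨true :: r4, .of_false h, Runs.queryN h (Runs.push _ _ _)⟩

theorem runs_query_check_not (r0 r1 r2 r3 r4 r5 r6 r7 : List Bool) (o w : Word) :
    ∃ F, Checks (o ∉ X) r4 F ∧
      Runs X (.query fail .skip) ⟨r0, r1, r2, r3, r4, r5, r6, r7, o, w⟩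
        ⟨r0, r1, r2, r3, F, r5, r6, r7, [], w⟩ 3 := by
  by_cases h : o ∈ X
  · exact ⟨true :: r4, .of_false (by simpa using h), Runs.queryY h (Runs.push _ _ _)⟩
  · exact ⟨r4, .of_true h, (Runs.queryN h (Runs.skip _)).mono (by omega)⟩

/-! ### The path of the automaton -/

/-- Ask for an edge. -/
def askEdge : Prog := .seq (appZeros 1) (.query .skip fail)

theorem runs_askEdge (n : ℕ) (r0 r1 r2 r3 r4 r5 r6 r7 : List Bool) (w : Word) :
    ∃ F, Checks (EdgeBit X n) r4 F ∧
      Runs X askEdge ⟨r0, r1, r2, r3, r4, r5, r6, r7, zeros (4 * n), w⟩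
        ⟨r0, r1, r2, r3, F, r5, r6, r7, [], w⟩ 7 := by
  obtain ⟨F, hF, hr⟩ := runs_query_check (X := X) r0 r1 r2 r3 r4 r5 r6 r7
    (zeros (4 * n) ++ zeros 1) w
  refine ⟨F, hF.congr ?_, ((runs_appZeros 1 _).seq hr).mono (by omega)⟩
  rw [EdgeBit, zeros, zeros, ← List.replicate_add]

/-- Move the units on stack `2` to stack `3` and ask for the node with that number. -/
def askNode : Prog :=
  .seq (.loop 2 (.seq (.push 3 true) (appZeros 4)) (.seq (.push 3 true) (appZeros 4)))
    (.seq (appZeros 2) (.query .skip fail))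

theorem runs_askNode (c : ℕ) (r0 r1 r4 r5 r6 r7 : List Bool) (w : Word) :
    ∃ F, Checks (NodeBit X c) r4 F ∧
      Runs X askNode ⟨r0, r1, units c, [], r4, r5, r6, r7, [], w⟩
        ⟨r0, r1, [], units c, F, r5, r6, r7, [], w⟩ (13 * c + 11) := by
  obtain ⟨F, hF, hr⟩ := runs_query_check (X := X) r0 r1 [] (units c) r4 r5 r6 r7
    (zeros (4 * c) ++ zeros 2) w
  have hl := Runs.loop (X := X) (i := 2) (p := .seq (.push 3 true) (appZeros 4)) (T := 12) c
    (fun k => ⟨r0, r1, units (c - k), units k, r4, r5, r6, r7, zeros (4 * k), w⟩)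
    (fun k hk => ⟨true, units (c - (k + 1)), by
      change units (c - k) = _
      rw [show c - k = (c - (k + 1)) + 1 by omega]
      rfl, by
      have := (Runs.push (X := X) 3 true
        ⟨r0, r1, units (c - (k + 1)), units k, r4, r5, r6, r7, zeros (4 * k), w⟩).seq
        (runs_appZeros 4 _)
      rw [show zeros (4 * (k + 1)) = zeros (4 * k) ++ zeros 4 by
        rw [zeros, zeros, ← List.replicate_add]; rfl]
      exact this.mono (by omega)⟩)
    (by change units (c - c) = []; simp)
  simp only [Nat.sub_zero, Nat.sub_self] at hl
  refine ⟨F, hF.congr ?_, (hl.seq ((runs_appZeros 2 _).seq hr)).mono (by omega)⟩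
  rw [NodeBit, zeros, zeros, ← List.replicate_add]

/-- Erase the units on stack `3` and append four zeros for each of them on the oracle tape. -/
def shiftNode : Prog := .loop 3 (appZeros 4) (appZeros 4)

theorem runs_shiftNode (c : ℕ) (r0 r1 r2 r4 r5 r6 r7 : List Bool) (w : Word) :
    Runs X shiftNode ⟨r0, r1, r2, units c, r4, r5, r6, r7, [], w⟩
      ⟨r0, r1, r2, [], r4, r5, r6, r7, zeros (4 * c), w⟩ (10 * c + 1) := by
  have hl := Runs.loop (X := X) (i := 3) (p := appZeros 4) (T := 9) c
    (fun k => ⟨r0, r1, r2, units (c - k), r4, r5, r6, r7, zeros (4 * k), w⟩)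
    (fun k hk => ⟨true, units (c - (k + 1)), by
      change units (c - k) = _
      rw [show c - k = (c - (k + 1)) + 1 by omega]
      rfl, by
      have := runs_appZeros (X := X) 4
        ⟨r0, r1, r2, units (c - (k + 1)), r4, r5, r6, r7, zeros (4 * k), w⟩
      rw [show zeros (4 * (k + 1)) = zeros (4 * k) ++ zeros 4 by
        rw [zeros, zeros, ← List.replicate_add]; rfl]
      exact this⟩)
    (by change units (c - c) = []; simp)
  simp only [Nat.sub_zero, Nat.sub_self] at hl
  exact hl.mono (by omega)

/-- Check the edge to the current node, and proceed from there with the letter `a`. -/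
def checkLetter (a : Sym) : Prog :=
  .seq askEdge (.seq askNode (.seq shiftNode (appZeros (4 * a.code))))

theorem runs_checkLetter (a : Sym) (p c : ℕ) (r0 r1 r4 r5 r6 r7 : List Bool) (w : Word) :
    ∃ F, Checks (EdgeBit X (p + 2 * c) ∧ NodeBit X c) r4 F ∧
      Runs X (checkLetter a)
        ⟨r0, r1, units c, [], r4, r5, r6, r7, zeros (4 * (p + 2 * c)), w⟩
        ⟨r0, r1, [], [], F, r5, r6, r7, zeros (4 * (c + a.code)), w⟩ (23 * c + 1100) := by
  obtain ⟨F1, hF1, hr1⟩ := runs_askEdge (X := X) (p + 2 * c) r0 r1 (units c) [] r4 r5 r6 r7 w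
  obtain ⟨F2, hF2, hr2⟩ := runs_askNode (X := X) c r0 r1 F1 r5 r6 r7 w
  refine ⟨F2, hF1.and hF2, ?_⟩
  have := hr1.seq (hr2.seq ((runs_shiftNode c r0 r1 [] F2 r5 r6 r7 w).seq
    (runs_appZeros (4 * a.code) _)))
  rw [show zeros (4 * (c + a.code)) = zeros (4 * c) ++ zeros (4 * a.code) by
        rw [zeros, zeros, ← List.replicate_add, mul_add]]
  have ha := a.code_lt
  exact this.mono (by omega)

/-- What the path check does with one letter of the trace.  Stack `2` counts the units of the
current node, and four zeros are on the oracle tape for each unit of the number of the edge. -/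
def pathBody (a : Sym) : Prog :=
  .seq (keep a) (match a with
    | .unit => .seq (.push 2 true) (appZeros 8)
    | a => checkLetter a)

/-- The check `PathOK X p' c' []` for the end of the trace is left over. -/
theorem runs_sweep_pathBody (v : List Sym) (p c N : ℕ) (hN : c + v.length ≤ N)
    (r1 r4 r5 r6 r7 : List Bool) (w : Word) :
    ∃ F p' c' P, c' ≤ N ∧ Checks P r4 F ∧ (PathOK X p c v ↔ P ∧ PathOK X p' c' []) ∧
      Runs X (sweep pathBody)
        ⟨flat v, r1, units c, [], r4, r5, r6, r7, zeros (4 * (p + 2 * c)), w⟩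
        ⟨[], (flat v).reverse ++ r1, units c', [], F, r5, r6, r7, zeros (4 * (p' + 2 * c')), w⟩
        (v.length * (23 * N + 1200) + 10) := by
  induction v generalizing p c r1 r4 with
  | nil =>
    refine ⟨r4, p, c, True, by simpa using hN, .of_true trivial, by simp, ?_⟩
    exact (runs_sweep_short (X := X) pathBody (l := [])
      (s := ⟨[], r1, units c, [], r4, r5, r6, r7, zeros (4 * (p + 2 * c)), w⟩)
      (by simp)).mono (by omega)
  | cons a v ih =>
    rw [List.length_cons] at hN
    have hkeep := runs_keep (X := X) a (flat v) r1 (units c) [] r4 r5 r6 r7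
      (zeros (4 * (p + 2 * c))) w
    rw [flat_cons, List.reverse_append, List.append_assoc]
    by_cases ha : a = .unit
    · subst ha
      obtain ⟨F, p', c', P, hc', hF, hP, hr⟩ := ih p (c + 1) (by omega)
        (Sym.unit.bits.reverse ++ r1) r4
      refine ⟨F, p', c', P, hc', hF, hP, ?_⟩
      have h1 : Runs X (pathBody .unit)
          ⟨flat v, r1, units c, [], r4, r5, r6, r7, zeros (4 * (p + 2 * c)), w⟩
          ⟨flat v, Sym.unit.bits.reverse ++ r1, units (c + 1), [], r4, r5, r6, r7,
            zeros (4 * (p + 2 * (c + 1))), w⟩ 43 := by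
        have := hkeep.seq ((Runs.push 2 true _).seq (runs_appZeros 8 _))
        rw [show zeros (4 * (p + 2 * (c + 1))) = zeros (4 * (p + 2 * c)) ++ zeros 8 by
          rw [zeros, zeros, ← List.replicate_add]; rfl]
        exact this.mono (by omega)
      refine (runs_sweep_cons (s := ⟨flat v, r1, units c, [], r4, r5, r6, r7,
        zeros (4 * (p + 2 * c)), w⟩) h1 hr).mono ?_
      rw [List.length_cons]
      nlinarith
    · obtain ⟨F1, hF1, hr1⟩ := runs_checkLetter (X := X) a p c (flat v)
        (a.bits.reverse ++ r1) r4 r5 r6 r7 w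
      obtain ⟨F, p', c', P, hc', hF, hP, hr⟩ := ih (c + a.code) 0 (by omega)
        (a.bits.reverse ++ r1) F1
      refine ⟨F, p', c', _, hc', hF1.and hF, ?_, ?_⟩
      · cases a <;> first | exact absurd rfl ha | (
          change (_ ∧ _ ∧ PathOK X (c + _) 0 v) ↔ _
          rw [hP]
          tauto)
      · have h1 : Runs X (pathBody a)
            ⟨flat v, r1, units c, [], r4, r5, r6, r7, zeros (4 * (p + 2 * c)), w⟩
            ⟨flat v, a.bits.reverse ++ r1, [], [], F1, r5, r6, r7,
              zeros (4 * (c + a.code)), w⟩ (23 * c + 1123) := by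
          refine Runs.mono (T := 1 + 22 + (23 * c + 1100)) ?_ (by omega)
          cases a <;> first | exact absurd rfl ha | exact hkeep.seq hr1
        refine (runs_sweep_cons (s := ⟨flat v, r1, units c, [], r4, r5, r6, r7,
          zeros (4 * (p + 2 * c)), w⟩) h1 hr).mono ?_
        rw [List.length_cons]
        nlinarith

/-- Check the path of the automaton. -/
def pathPass : Prog :=
  .seq (appZeros (4 * Sym.init.code))
    (.seq (sweep pathBody) (.seq (checkLetter .eof) (.seq askEdge rewind)))

theorem runs_pathPass (v : List Sym) (r4 r5 r6 r7 : List Bool) (w : Word) :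
    ∃ F, Checks (PathOK X Sym.init.code 0 v) r4 F ∧
      Runs X pathPass ⟨flat v, [], [], [], r4, r5, r6, r7, [], w⟩
        ⟨flat v, [], [], [], F, r5, r6, r7, [], w⟩ (2500 * (v.length + 1) ^ 2) := by
  obtain ⟨F1, p, c, P, hc, hF1, hP, hr1⟩ := runs_sweep_pathBody (X := X) v Sym.init.code 0
    v.length (by omega) [] r4 r5 r6 r7 w
  obtain ⟨F2, hF2, hr2⟩ := runs_checkLetter (X := X) .eof p c [] ((flat v).reverse ++ []) F1
    r5 r6 r7 w
  obtain ⟨F3, hF3, hr3⟩ := runs_askEdge (X := X) (c + Sym.eof.code) [] ((flat v).reverse ++ [])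
    [] [] F2 r5 r6 r7 w
  refine ⟨F3, ((hF1.and hF2).and hF3).congr ?_, ?_⟩
  · rw [hP, PathOK]
    tauto
  · have h4 := runs_rewind (X := X) ((flat v).reverse ++ []) [] [] [] F3 r5 r6 r7 [] w
    have := (runs_appZeros (X := X) (4 * Sym.init.code)
      ⟨flat v, [], [], [], r4, r5, r6, r7, [], w⟩).seq (hr1.seq (hr2.seq (hr3.seq h4)))
    simp only [List.append_nil, List.reverse_reverse] at this
    refine this.mono ?_
    have ha := Sym.init.code_lt
    simp only [List.length_reverse, length_flat]
    nlinarith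

/-! ### The oracle answers -/

/-- What the check of the oracle answers does with one letter of the trace.  In addition the
letters are counted on stack `5`. -/
def answerBody (a : Sym) : Prog :=
  .seq (keep a) (.seq (.push 5 true) (match a with
    | .ap b => .app b
    | .an true => .query .skip fail
    | .an false => .query fail .skip
    | _ => .skip))

theorem runs_sweep_answerBody (v : List Sym) (n : ℕ) (r1 r2 r3 r4 r6 r7 : List Bool)
    (o w : Word) :
    ∃ F o', Checks (AnswersOK X o v) r4 F ∧
      Runs X (sweep answerBody)
        ⟨flat v, r1, r2, r3, r4, units n, r6, r7, o, w⟩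
        ⟨[], (flat v).reverse ++ r1, r2, r3, F, units (n + v.length), r6, r7, o', w⟩
        (v.length * 40 + 10) := by
  induction v generalizing n r1 r4 o with
  | nil =>
    refine ⟨r4, o, .of_true trivial, ?_⟩
    exact (runs_sweep_short (X := X) answerBody (l := [])
      (s := ⟨[], r1, r2, r3, r4, units n, r6, r7, o, w⟩) (by simp)).mono (by omega)
  | cons a v ih =>
    have hkeep := runs_keep (X := X) a (flat v) r1 r2 r3 r4 (units n) r6 r7 o w
    rw [flat_cons, List.reverse_append, List.append_assoc]
    have key : ∃ F1 o1 P, Checks P r4 F1 ∧ (AnswersOK X o (a :: v) ↔ P ∧ AnswersOK X o1 v) ∧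
        Runs X (answerBody a) ⟨flat v, r1, r2, r3, r4, units n, r6, r7, o, w⟩
          ⟨flat v, a.bits.reverse ++ r1, r2, r3, F1, units (n + 1), r6, r7, o1, w⟩ 29 := by
      rcases a with _ | _ | _ | _ | _ | b | b | b | ⟨σ, w', m⟩
      case ap =>
        exact ⟨r4, o ++ [b], True, .of_true trivial, by simp [AnswersOK],
          (hkeep.seq ((Runs.push 5 true _).seq (Runs.app b _))).mono (by omega)⟩
      case an =>
        cases b
        · obtain ⟨F, hF, hr⟩ := runs_query_check_not (X := X) (flat v)
            ((Sym.an false).bits.reverse ++ r1) r2 r3 r4 (units (n + 1)) r6 r7 o w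
          exact ⟨F, [], _, hF, by simp [AnswersOK], hkeep.seq ((Runs.push 5 true _).seq hr)⟩
        · obtain ⟨F, hF, hr⟩ := runs_query_check (X := X) (flat v)
            ((Sym.an true).bits.reverse ++ r1) r2 r3 r4 (units (n + 1)) r6 r7 o w
          exact ⟨F, [], _, hF, by simp [AnswersOK], hkeep.seq ((Runs.push 5 true _).seq hr)⟩
      all_goals
        exact ⟨r4, o, True, .of_true trivial, by simp [AnswersOK],
          (hkeep.seq ((Runs.push 5 true _).seq (Runs.skip _))).mono (by omega)⟩
    obtain ⟨F1, o1, P, hF1, hP, hr1⟩ := key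
    obtain ⟨F, o', hF, hr⟩ := ih (n + 1) (a.bits.reverse ++ r1) F1 o1
    refine ⟨F, o', (hF1.and hF).congr hP.symm, ?_⟩
    rw [List.length_cons, show n + (v.length + 1) = n + 1 + v.length by ring]
    exact (runs_sweep_cons (s := ⟨flat v, r1, r2, r3, r4, units n, r6, r7, o, w⟩) hr1 hr).mono
      (by omega)

/-- Check the oracle answers.  The last query only serves to erase the oracle tape. -/
def answerPass : Prog := .seq (sweep answerBody) (.seq (.query .skip .skip) rewind)

theorem runs_answerPass (v : List Sym) (r2 r3 r4 r6 r7 : List Bool) (w : Word) :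
    ∃ F, Checks (AnswersOK X [] v) r4 F ∧
      Runs X answerPass ⟨flat v, [], r2, r3, r4, [], r6, r7, [], w⟩
        ⟨flat v, [], r2, r3, F, units v.length, r6, r7, [], w⟩ (100 * (v.length + 1)) := by
  obtain ⟨F, o, hF, hr⟩ := runs_sweep_answerBody (X := X) v 0 [] r2 r3 r4 r6 r7 [] w
  rw [Nat.zero_add] at hr
  refine ⟨F, hF, ?_⟩
  have hq : Runs X (.query .skip .skip)
      ⟨[], (flat v).reverse ++ [], r2, r3, F, units v.length, r6, r7, o, w⟩
      ⟨[], (flat v).reverse ++ [], r2, r3, F, units v.length, r6, r7, [], w⟩ 2 := by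
    by_cases h : o ∈ X
    · exact Runs.queryY h (Runs.skip _)
    · exact Runs.queryN h (Runs.skip _)
  have := hr.seq (hq.seq (runs_rewind _ _ _ _ _ _ _ _ _ _))
  simp only [List.append_nil, List.reverse_reverse] at this
  refine this.mono ?_
  simp only [List.length_reverse, length_flat]
  omega

/-! ### The certificate -/

/-- Replace the `n` units on stack `2` by `sq n` units. -/
def square : Prog :=
  .seq
    (.loop 2
      (.seq (.push 3 true)
        (.seq (.loop 3 (.seq (.push 6 true) (.seq (.push 6 true) (.push 7 true)))
            (.seq (.push 6 true) (.seq (.push 6 true) (.push 7 true))))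
          (.loop 7 (.push 3 true) (.push 3 true))))
      (.seq (.push 3 true)
        (.seq (.loop 3 (.seq (.push 6 true) (.seq (.push 6 true) (.push 7 true)))
            (.seq (.push 6 true) (.seq (.push 6 true) (.push 7 true))))
          (.loop 7 (.push 3 true) (.push 3 true)))))
    (.seq (drain 3) (.loop 6 (.push 2 true) (.push 2 true)))

theorem units_sub (n k : ℕ) (h : k < n) : units (n - k) = true :: units (n - (k + 1)) := by
  rw [show n - k = (n - (k + 1)) + 1 by omega]
  rfl

/-- The outer loop adds `2 k` units for `k = 1, …, n`, which makes `n * (n + 1)`. -/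
theorem runs_square (n : ℕ) (r0 r1 r4 r5 : List Bool) (o w : Word) :
    Runs X square ⟨r0, r1, units n, [], r4, r5, [], [], o, w⟩
      ⟨r0, r1, units (sq n), [], r4, r5, [], [], o, w⟩ (30 * (n + 1) ^ 2) := by
  have hin (m a b : ℕ) (r2 : List Bool) :
      Runs X (.loop 3 (.seq (.push 6 true) (.seq (.push 6 true) (.push 7 true)))
            (.seq (.push 6 true) (.seq (.push 6 true) (.push 7 true))))
        ⟨r0, r1, r2, units m, r4, r5, units a, [], o, w⟩
        ⟨r0, r1, r2, [], r4, r5, units (a + 2 * m), units m, o, w⟩ (m * 9 + 1) := by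
    have hl := Runs.loop (X := X) (i := 3)
      (p := .seq (.push 6 true) (.seq (.push 6 true) (.push 7 true))) (T := 8) m
      (fun k => ⟨r0, r1, r2, units (m - k), r4, r5, units (a + 2 * k), units k, o, w⟩)
      (fun k hk => ⟨true, units (m - (k + 1)), units_sub m k hk,
        (Runs.push 6 true _).seq ((Runs.push 6 true _).seq (Runs.push 7 true _))⟩)
      (by change units (m - m) = []; simp)
    simpa using hl
  have hback (m a : ℕ) (r2 : List Bool) :
      Runs X (.loop 7 (.push 3 true) (.push 3 true))
        ⟨r0, r1, r2, [], r4, r5, units a, units m, o, w⟩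
        ⟨r0, r1, r2, units m, r4, r5, units a, [], o, w⟩ (m * 3 + 1) := by
    have hl := Runs.loop (X := X) (i := 7) (p := .push 3 true) (T := 2) m
      (fun k => ⟨r0, r1, r2, units k, r4, r5, units a, units (m - k), o, w⟩)
      (fun k hk => ⟨true, units (m - (k + 1)), units_sub m k hk, Runs.push 3 true _⟩)
      (by change units (m - m) = []; simp)
    simpa using hl
  have hout := Runs.loop (X := X) (i := 2)
    (p := .seq (.push 3 true)
        (.seq (.loop 3 (.seq (.push 6 true) (.seq (.push 6 true) (.push 7 true)))
            (.seq (.push 6 true) (.seq (.push 6 true) (.push 7 true))))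
          (.loop 7 (.push 3 true) (.push 3 true)))) (T := 12 * n + 6) n
    (fun k => ⟨r0, r1, units (n - k), units k, r4, r5, units (sq k), [], o, w⟩)
    (fun k hk => ⟨true, units (n - (k + 1)), units_sub n k hk, by
      have := (Runs.push (X := X) 3 true ⟨r0, r1, units (n - (k + 1)), units k, r4, r5,
        units (sq k), [], o, w⟩).seq ((hin (k + 1) (sq k) 0 _).seq (hback (k + 1) _ _))
      rw [show sq (k + 1) = sq k + 2 * (k + 1) by unfold sq; ring]
      exact this.mono (by omega)⟩)
    (by change units (n - n) = []; simp)
  have hdrain := runs_drain (X := X) 3 (units n)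
    ⟨r0, r1, [], units n, r4, r5, units (sq n), [], o, w⟩ rfl
  have hlast := Runs.loop (X := X) (i := 6) (p := .push 2 true) (T := 2) (sq n)
      (fun k => ⟨r0, r1, units k, [], r4, r5, units (sq n - k), [], o, w⟩)
      (fun k hk => ⟨true, units (sq n - (k + 1)), units_sub _ k hk, Runs.push 2 true _⟩)
      (by change units (sq n - sq n) = []; simp)
  simp only [Nat.sub_zero, Nat.sub_self] at hlast hout
  refine (hout.seq (hdrain.seq hlast)).mono ?_
  rw [List.length_replicate]
  unfold sq
  nlinarith

/-- Execute `square` `d` times. -/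
def squares : ℕ → Prog
  | 0 => .skip
  | d + 1 => .seq square (squares d)

theorem le_sq (n : ℕ) : n ≤ sq n := by unfold sq; nlinarith

theorem runs_squares (d n : ℕ) (r0 r1 r4 r5 : List Bool) (o w : Word) :
    Runs X (squares d) ⟨r0, r1, units n, [], r4, r5, [], [], o, w⟩
      ⟨r0, r1, units (sq^[d] n), [], r4, r5, [], [], o, w⟩
      (d * (30 * (sq^[d] n + 1) ^ 2 + 1) + 1) := by
  induction d generalizing n with
  | zero => exact (Runs.skip _).mono (by omega)
  | succ d ih =>
    refine ((runs_square n r0 r1 r4 r5 o w).seq (ih (sq n))).mono ?_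
    rw [Function.iterate_succ_apply]
    have h : n ≤ sq^[d] (sq n) := (le_sq n).trans (Function.id_le_iterate_of_id_le le_sq d _)
    have : (n + 1) ^ 2 ≤ (sq^[d] (sq n) + 1) ^ 2 := Nat.pow_le_pow_left (by omega) 2
    nlinarith

/-- Count the letters `wt` on stack `2`. -/
def weightBody (a : Sym) : Prog :=
  .seq (keep a) (match a with
    | .wt => .push 2 true
    | _ => .skip)

theorem runs_sweep_weightBody (v : List Sym) (n : ℕ) (r1 r3 r4 r5 r6 r7 : List Bool)
    (o w : Word) :
    Runs X (sweep weightBody)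
      ⟨flat v, r1, units n, r3, r4, r5, r6, r7, o, w⟩
      ⟨[], (flat v).reverse ++ r1, units (n + weight v), r3, r4, r5, r6, r7, o, w⟩
      (v.length * 40 + 10) := by
  induction v generalizing n r1 with
  | nil =>
    exact (runs_sweep_short (X := X) weightBody (l := [])
      (s := ⟨[], r1, units n, r3, r4, r5, r6, r7, o, w⟩) (by simp)).mono (by omega)
  | cons a v ih =>
    have hkeep := runs_keep (X := X) a (flat v) r1 (units n) r3 r4 r5 r6 r7 o w
    rw [flat_cons, List.reverse_append, List.append_assoc]
    have key : ∃ n', n' + weight v = n + weight (a :: v) ∧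
        Runs X (weightBody a) ⟨flat v, r1, units n, r3, r4, r5, r6, r7, o, w⟩
          ⟨flat v, a.bits.reverse ++ r1, units n', r3, r4, r5, r6, r7, o, w⟩ 25 := by
      rcases a with _ | _ | _ | _ | _ | b | b | b | ⟨σ, w', m⟩
      case wt => exact ⟨n + 1, by simp only [weight]; ring, hkeep.seq (Runs.push 2 true _)⟩
      all_goals exact ⟨n, by simp [weight], (hkeep.seq (Runs.skip _)).mono (by omega)⟩
    obtain ⟨n', hn', hr⟩ := key
    rw [← hn']
    refine (runs_sweep_cons (s := ⟨flat v, r1, units n, r3, r4, r5, r6, r7, o, w⟩) hr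
      (ih n' _)).mono ?_
    rw [List.length_cons]
    omega

/-- The length of the oracle word that is a certificate for `n` units.  Here `i` encodes the
language and `d`, and the iterated squaring makes the certificate longer than `n ^ 2 ^ d`. -/
def certLength (i d n : ℕ) : ℕ := 4 * (2 ^ i * (2 * sq^[d] n + 1)) + 3

/-- Ask for the certificate. -/
def certPass (i d : ℕ) : Prog :=
  .seq (sweep weightBody) (.seq rewind (.seq (squares d)
    (.seq (.loop 2 (appZeros (8 * 2 ^ i)) (appZeros (8 * 2 ^ i)))
      (.seq (appZeros (4 * 2 ^ i + 3)) (.query .skip fail)))))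

theorem sq_mono : Monotone sq := fun a b h => by
  unfold sq
  gcongr

theorem weight_le (v : List Sym) : weight v ≤ v.length := by
  induction v with
  | nil => simp [weight]
  | cons a v ih => cases a <;> simp only [weight, List.length_cons] <;> omega

theorem runs_certPass (i d : ℕ) (v : List Sym) (r4 r5 : List Bool) (w : Word) :
    ∃ F, Checks (zeros (certLength i d (weight v)) ∈ X) r4 F ∧
      Runs X (certPass i d) ⟨flat v, [], [], [], r4, r5, [], [], [], w⟩
        ⟨flat v, [], [], [], F, r5, [], [], [], w⟩
        (100 * (v.length + 1) + (d * (30 * (sq^[d] v.length + 1) ^ 2 + 1)) +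
          (sq^[d] v.length + 1) * (16 * 2 ^ i + 20)) := by
  set N := sq^[d] (weight v) with hN
  have hNle : N ≤ sq^[d] v.length := sq_mono.iterate d (weight_le v)
  obtain ⟨F, hF, hr⟩ := runs_query_check (X := X) (flat v) [] [] [] r4 r5 [] []
    (zeros (8 * 2 ^ i * N) ++ zeros (4 * 2 ^ i + 3)) w
  refine ⟨F, hF.congr ?_, ?_⟩
  · rw [zeros, zeros, ← List.replicate_add, certLength, ← hN]
    ring_nf
  · have h1 := runs_sweep_weightBody (X := X) v 0 [] [] r4 r5 [] [] [] w
    have h2 := runs_rewind (X := X) ((flat v).reverse ++ []) [] (units (0 + weight v)) [] r4 r5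
      [] [] [] w
    have h3 := runs_squares (X := X) d (0 + weight v) (flat v) [] r4 r5 [] w
    have h4 := Runs.loop (X := X) (i := 2) (p := appZeros (8 * 2 ^ i)) (T := 16 * 2 ^ i + 1) N
      (fun k => ⟨flat v, [], units (N - k), [], r4, r5, [], [], zeros (8 * 2 ^ i * k), w⟩)
      (fun k hk => ⟨true, units (N - (k + 1)), units_sub _ k hk, by
        have := runs_appZeros (X := X) (8 * 2 ^ i)
          ⟨flat v, [], units (N - (k + 1)), [], r4, r5, [], [], zeros (8 * 2 ^ i * k), w⟩
        rw [show zeros (8 * 2 ^ i * (k + 1)) = zeros (8 * 2 ^ i * k) ++ zeros (8 * 2 ^ i) by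
          rw [zeros, zeros, ← List.replicate_add]; rfl]
        exact this.mono (by omega)⟩)
      (by change units (N - N) = []; simp)
    simp only [Nat.sub_zero, Nat.sub_self] at h4
    have h5 := runs_appZeros (X := X) (4 * 2 ^ i + 3)
      ⟨flat v, [], [], [], r4, r5, [], [], zeros (8 * 2 ^ i * N), w⟩
    simp only [List.append_nil, List.reverse_reverse, Nat.zero_add, ← hN] at h1 h2 h3
    refine (h1.seq (h2.seq (h3.seq (h4.seq (h5.seq hr))))).mono ?_
    have h8 : 0 < 2 ^ i := by positivity
    have h6 : d * (30 * (N + 1) ^ 2 + 1) ≤ d * (30 * (sq^[d] v.length + 1) ^ 2 + 1) := by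
      gcongr
    have h7 : (N + 1) * (16 * 2 ^ i + 20) ≤ (sq^[d] v.length + 1) * (16 * 2 ^ i + 20) := by
      gcongr
    simp only [List.length_reverse, length_flat]
    nlinarith

end Prog

/-- On each of the first `n` tapes the trace is consistent with a tape that is blank in the
beginning. -/
def TapesOK : ℕ → List Sym → Prop
  | 0, _ => True
  | n + 1, v => OpsOK [] [] (firstOps false v) ∧ TapesOK n (dropOps false v)

theorem outs_dropOps (u : Bool) (v : List Sym) : outs (dropOps u v) = outs v := by
  induction v generalizing u with
  | nil => simp [dropOps]
  | cons a v ih => cases a <;> cases u <;> simp only [dropOps, outs, ih]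

namespace Prog

variable {X : Set Word}

/-! ### The tapes -/

/-- Pop a tape cell from stack `i`; the cells beyond the end of the stack are blank. -/
def popCell (i : Fin 8) (k : Option Bool → Prog) : Prog :=
  .pop i (k none) (.pop i .skip (k none) (k none)) (.pop i .skip (k (some false)) (k (some true)))

theorem runs_popCell {i : Fin 8} {k : Option Bool → Prog} {L : List (Option Bool)} {s s' : Store}
    {T : ℕ} (hs : s.get i = cellsBits L)
    (h : Runs X (k L.head?.join) (s.set i (cellsBits L.tail)) s' T) :
    Runs X (popCell i k) s s' (2 + T) := by
  rcases L with _ | ⟨_ | b, L⟩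
  · refine (Runs.popE hs ?_).mono (by omega : 1 + T ≤ 2 + T)
    have : s.set i (cellsBits ([] : List (Option Bool)).tail) = s := by
      rw [← Store.set_get s i, Store.set_set, hs]
      rfl
    rwa [this] at h
  · refine (Runs.popL (b := false) (l := false :: cellsBits L) (a := 1 + T) hs ?_).mono (by omega)
    refine Runs.popL (b := false) (l := cellsBits L) (by rw [Store.get_set, if_pos rfl]) ?_
    rw [Store.set_set]
    exact h
  · refine (Runs.popL (b := true) (l := b :: cellsBits L) (a := 1 + T) hs ?_).mono (by omega)
    refine Runs.popL (b := b) (l := cellsBits L) (by rw [Store.get_set, if_pos rfl]) ?_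
    rw [Store.set_set]
    cases b <;> exact h

/-- Push a tape cell on stack `i`. -/
def pushCell (i : Fin 8) (c : Option Bool) : Prog := pushBits i (cellBits c).reverse

theorem runs_pushCell (i : Fin 8) (c : Option Bool) (s : Store) :
    Runs X (pushCell i c) s (s.set i (cellBits c ++ s.get i)) 7 := by
  have := runs_pushBits (X := X) i (cellBits c).reverse s
  rw [List.reverse_reverse] at this
  refine this.mono ?_
  cases c <;> simp [cellBits]

/-- Write a symbol and move the head; stack `2` holds the cells on the left of the scanned cell and
stack `3` those on the right of it. -/
def moveHead (w : Option Bool) : SignType → Prog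
  | .zero => pushCell 3 w
  | .pos => pushCell 2 w
  | .neg => .seq (pushCell 3 w) (popCell 2 (pushCell 3))

theorem runs_moveHead (c : Option Bool) (m : SignType) (L R : List (Option Bool))
    (r0 r1 r4 r5 r6 r7 : List Bool) (o w : Word) :
    Runs X (moveHead c m) ⟨r0, r1, cellsBits L, cellsBits R, r4, r5, r6, r7, o, w⟩
      ⟨r0, r1, cellsBits (zipMove c L R m).1, cellsBits (zipMove c L R m).2, r4, r5, r6, r7, o, w⟩
      17 := by
  rcases m with _ | _ | _
  · exact (runs_pushCell 3 c _).mono (by omega)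
  · have h2 := runs_popCell (X := X) (i := 2) (k := pushCell 3) (L := L)
      (s := ⟨r0, r1, cellsBits L, cellBits c ++ cellsBits R, r4, r5, r6, r7, o, w⟩) rfl
      (runs_pushCell 3 _ _)
    exact ((runs_pushCell (X := X) 3 c
      ⟨r0, r1, cellsBits L, cellsBits R, r4, r5, r6, r7, o, w⟩).seq h2).mono (by omega)
  · exact (runs_pushCell 2 c _).mono (by omega)

/-- Check and execute one operation on the tape. -/
def tapeOp (σ w : Option Bool) (m : SignType) : Prog :=
  popCell 3 fun c => .seq (if c = σ then .skip else fail) (moveHead w m)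

theorem runs_tapeOp (σ c : Option Bool) (m : SignType) (L R : List (Option Bool))
    (r0 r1 r4 r5 r6 r7 : List Bool) (o w : Word) :
    ∃ F, Checks (R.head?.join = σ) r4 F ∧
      Runs X (tapeOp σ c m) ⟨r0, r1, cellsBits L, cellsBits R, r4, r5, r6, r7, o, w⟩
        ⟨r0, r1, cellsBits (zipMove c L R.tail m).1, cellsBits (zipMove c L R.tail m).2, F, r5, r6,
          r7, o, w⟩ 22 := by
  by_cases h : R.head?.join = σ
  · refine ⟨r4, .of_true h, runs_popCell (T := 20) rfl ?_⟩
    rw [if_pos h]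
    exact ((Runs.skip _).seq (runs_moveHead c m L R.tail _ _ _ _ _ _ _ _)).mono (by omega)
  · refine ⟨true :: r4, .of_false h, runs_popCell (T := 20) rfl ?_⟩
    rw [if_neg h]
    exact (Runs.push 4 true ⟨r0, r1, cellsBits L, cellsBits R.tail, r4, r5, r6, r7, o, w⟩).seq
      (runs_moveHead c m L R.tail r0 r1 (true :: r4) r5 r6 r7 o w)

/-- What a tape check does with one letter of the trace.  Stack `7` is not empty iff a letter `tp`
of the current block was executed. -/
def tapeBody : Sym → Prog
  | .tp σ w m => .pop 7 (.seq (.push 7 true) (tapeOp σ w m))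
      (.seq (.push 7 true) (keep (.tp σ w m))) (.seq (.push 7 true) (keep (.tp σ w m)))
  | .blk => .seq (keep .blk) (.pop 7 .skip .skip .skip)
  | a => keep a

/-- The stack that represents a flag. -/
def flag (u : Bool) : List Bool := if u then [true] else []

theorem length_zipMove (c : Option Bool) (L R : List (Option Bool)) (m : SignType) :
    (zipMove c L R.tail m).1.length + (zipMove c L R.tail m).2.length ≤
      L.length + R.length + 2 := by
  rcases m with _ | _ | _ <;> simp only [zipMove, List.length_cons, List.length_tail] <;> omega

theorem runs_sweep_tapeBody (v : List Sym) (u : Bool) (L R : List (Option Bool))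
    (r1 r4 r5 r6 : List Bool) (o w : Word) :
    ∃ F u' L' R', Checks (OpsOK L R (firstOps u v)) r4 F ∧
      L'.length + R'.length ≤ L.length + R.length + 2 * v.length ∧
      Runs X (sweep tapeBody)
        ⟨flat v, r1, cellsBits L, cellsBits R, r4, r5, r6, flag u, o, w⟩
        ⟨[], (flat (dropOps u v)).reverse ++ r1, cellsBits L', cellsBits R', F, r5, r6, flag u',
          o, w⟩ (v.length * 40 + 10) := by
  induction v generalizing u L R r1 r4 with
  | nil =>
    refine ⟨r4, u, L, R, .of_true (by simp [firstOps, OpsOK]), by simp, ?_⟩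
    have := runs_sweep_short (X := X) tapeBody (l := [])
      (s := ⟨[], r1, cellsBits L, cellsBits R, r4, r5, r6, flag u, o, w⟩) (by simp)
    cases u <;> exact this.mono (by omega)
  | cons a v ih =>
    have hkeep := runs_keep (X := X) a (flat v) r1 (cellsBits L) (cellsBits R) r4 r5 r6 (flag u) o w
    -- letters that are kept and do not end a block
    have easy (h1 : firstOps u (a :: v) = firstOps u v) (h2 : dropOps u (a :: v) = a :: dropOps u v)
        (hr : Runs X (tapeBody a) ⟨flat v, r1, cellsBits L, cellsBits R, r4, r5, r6, flag u, o, w⟩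
          ⟨flat v, a.bits.reverse ++ r1, cellsBits L, cellsBits R, r4, r5, r6, flag u, o, w⟩ 30) :
        ∃ F u' L' R', Checks (OpsOK L R (firstOps u (a :: v))) r4 F ∧
          L'.length + R'.length ≤ L.length + R.length + 2 * (a :: v).length ∧
          Runs X (sweep tapeBody)
            ⟨flat (a :: v), r1, cellsBits L, cellsBits R, r4, r5, r6, flag u, o, w⟩
            ⟨[], (flat (dropOps u (a :: v))).reverse ++ r1, cellsBits L', cellsBits R', F, r5, r6,
              flag u', o, w⟩ ((a :: v).length * 40 + 10) := by
      obtain ⟨F, u', L', R', hF, hlen, hr'⟩ := ih u L R (a.bits.reverse ++ r1) r4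
      refine ⟨F, u', L', R', h1 ▸ hF, by rw [List.length_cons]; omega, ?_⟩
      rw [h2, flat_cons, flat_cons, List.reverse_append, List.append_assoc, List.length_cons]
      exact (runs_sweep_cons (s := ⟨flat v, r1, cellsBits L, cellsBits R, r4, r5, r6, flag u, o, w⟩)
        hr hr').mono (by omega)
    rcases a with _ | _ | _ | _ | _ | b | b | b | ⟨σ, c, m⟩
    case blk =>
      obtain ⟨F, u', L', R', hF, hlen, hr'⟩ := ih false L R (Sym.blk.bits.reverse ++ r1) r4
      have hr : Runs X (tapeBody .blk)
          ⟨flat v, r1, cellsBits L, cellsBits R, r4, r5, r6, flag u, o, w⟩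
          ⟨flat v, Sym.blk.bits.reverse ++ r1, cellsBits L, cellsBits R, r4, r5, r6, flag false,
            o, w⟩ 30 := by
        cases u
        · exact (hkeep.seq (Runs.popE rfl (Runs.skip _))).mono (by omega)
        · exact (hkeep.seq (Runs.popL (b := true) (l := []) rfl (Runs.skip _))).mono (by omega)
      have h1 : firstOps u (.blk :: v) = firstOps false v := by cases u <;> rfl
      have h2 : dropOps u (.blk :: v) = .blk :: dropOps false v := by cases u <;> rfl
      refine ⟨F, u', L', R', h1 ▸ hF, by rw [List.length_cons]; omega, ?_⟩
      rw [h2, flat_cons, flat_cons, List.reverse_append, List.append_assoc, List.length_cons]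
      exact (runs_sweep_cons (s := ⟨flat v, r1, cellsBits L, cellsBits R, r4, r5, r6, flag u, o, w⟩)
        hr hr').mono (by omega)
    case tp =>
      cases u
      · obtain ⟨F1, hF1, hr1⟩ := runs_tapeOp (X := X) σ c m L R (flat v) r1 r4 r5 r6 (flag true) o w
        obtain ⟨F, u', L', R', hF, hlen, hr'⟩ := ih true (zipMove c L R.tail m).1
          (zipMove c L R.tail m).2 r1 F1
        have hr : Runs X (tapeBody (.tp σ c m))
            ⟨flat v, r1, cellsBits L, cellsBits R, r4, r5, r6, flag false, o, w⟩ _ 30 :=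
          (Runs.popE rfl ((Runs.push 7 true _).seq hr1)).mono (by omega)
        have := length_zipMove c L R m
        refine ⟨F, u', L', R', hF1.and hF, by rw [List.length_cons]; omega, ?_⟩
        rw [flat_cons, List.length_cons]
        exact (runs_sweep_cons
          (s := ⟨flat v, r1, cellsBits L, cellsBits R, r4, r5, r6, flag false, o, w⟩)
          hr hr').mono (by omega)
      · refine easy rfl rfl ?_
        exact (Runs.popL (b := true) (l := []) rfl ((Runs.push 7 true _).seq
          (runs_keep _ _ _ _ _ _ _ _ _ _ _))).mono (by omega)
    all_goals exact easy (by cases u <;> rfl) (by cases u <;> rfl) (hkeep.mono (by omega))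

/-- Check the first tape that was not yet checked. -/
def tapePass : Prog :=
  .seq (sweep tapeBody) (.seq (drain 2) (.seq (drain 3) (.seq (drain 7) rewind)))

theorem runs_tapePass (v : List Sym) (r4 r5 r6 : List Bool) (o w : Word) :
    ∃ F, Checks (OpsOK [] [] (firstOps false v)) r4 F ∧
      Runs X tapePass ⟨flat v, [], [], [], r4, r5, r6, [], o, w⟩
        ⟨flat (dropOps false v), [], [], [], F, r5, r6, [], o, w⟩ (100 * (v.length + 1)) := by
  obtain ⟨F, u, L, R, hF, hlen, hr⟩ := runs_sweep_tapeBody (X := X) v false [] [] [] r4 r5 r6 o w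
  refine ⟨F, hF, ?_⟩
  have h1 := runs_drain (X := X) 2 (cellsBits L) ⟨[], (flat (dropOps false v)).reverse ++ [],
    cellsBits L, cellsBits R, F, r5, r6, flag u, o, w⟩ rfl
  have h2 := runs_drain (X := X) 3 (cellsBits R) ⟨[], (flat (dropOps false v)).reverse ++ [],
    [], cellsBits R, F, r5, r6, flag u, o, w⟩ rfl
  have h3 := runs_drain (X := X) 7 (flag u) ⟨[], (flat (dropOps false v)).reverse ++ [],
    [], [], F, r5, r6, flag u, o, w⟩ rfl
  have h4 := runs_rewind (X := X) ((flat (dropOps false v)).reverse ++ [])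
    [] [] [] F r5 r6 [] o w
  have := hr.seq (h1.seq (h2.seq (h3.seq h4)))
  simp only [List.append_nil, List.reverse_reverse] at this
  refine this.mono ?_
  have hd := length_dropOps_le false v
  have hu : (flag u).length ≤ 1 := by cases u <;> simp [flag]
  simp only [List.length_reverse, length_flat, length_cellsBits]
  simp only [List.length_nil] at hlen
  omega

/-- Check as many tapes as stack `5` has units. -/
def tapesPass : Prog := .loop 5 tapePass tapePass

theorem runs_tapesPass (n : ℕ) (v : List Sym) (r4 r6 : List Bool) (o w : Word) :
    ∃ F v', Checks (TapesOK n v) r4 F ∧ outs v' = outs v ∧ v'.length ≤ v.length ∧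
      Runs X tapesPass ⟨flat v, [], [], [], r4, units n, r6, [], o, w⟩
        ⟨flat v', [], [], [], F, [], r6, [], o, w⟩ (n * (100 * v.length + 101) + 1) := by
  induction n generalizing v r4 with
  | zero =>
    exact ⟨r4, v, .of_true trivial, rfl, le_rfl, (Runs.loopE rfl).mono (by omega)⟩
  | succ n ih =>
    obtain ⟨F1, hF1, hr1⟩ := runs_tapePass (X := X) v r4 (units n) r6 o w
    obtain ⟨F, v', hF, hv', hlen, hr⟩ := ih (dropOps false v) F1
    have hd := length_dropOps_le false v
    refine ⟨F, v', hF1.and hF, by rw [hv', outs_dropOps], hlen.trans hd, ?_⟩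
    refine (Runs.loopL (b := true) (l := units n) rfl hr1 hr).mono ?_
    have : n * (100 * (dropOps false v).length + 101) ≤ n * (100 * v.length + 101) := by gcongr
    nlinarith

/-! ### The output -/

/-- Write the letter `b` for each `ot b`. -/
def outBody : Sym → Prog
  | .ot b => .out b
  | _ => .skip

theorem runs_sweep_outBody (v : List Sym) (r1 r2 r3 r4 r5 r6 r7 : List Bool) (o w : Word) :
    Runs X (sweep outBody) ⟨flat v, r1, r2, r3, r4, r5, r6, r7, o, w⟩
      ⟨[], r1, r2, r3, r4, r5, r6, r7, o, w ++ outs v⟩ (v.length * 10 + 10) := by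
  induction v generalizing w with
  | nil =>
    rw [outs, List.append_nil]
    exact (runs_sweep_short (X := X) outBody (l := [])
      (s := ⟨[], r1, r2, r3, r4, r5, r6, r7, o, w⟩) (by simp)).mono (by omega)
  | cons a v ih =>
    have key : ∃ w', w' ++ outs v = w ++ outs (a :: v) ∧
        Runs X (outBody a) ⟨flat v, r1, r2, r3, r4, r5, r6, r7, o, w⟩
          ⟨flat v, r1, r2, r3, r4, r5, r6, r7, o, w'⟩ 1 := by
      rcases a with _ | _ | _ | _ | _ | b | b | b | ⟨σ, c, m⟩
      case ot => exact ⟨w ++ [b], by simp [outs], Runs.out b _⟩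
      all_goals exact ⟨w, rfl, Runs.skip _⟩
    obtain ⟨w', hw', hr⟩ := key
    rw [← hw', flat_cons, List.length_cons]
    exact (runs_sweep_cons (s := ⟨flat v, r1, r2, r3, r4, r5, r6, r7, o, w⟩) hr (ih w')).mono
      (by omega)

/-- Output `w₀` if there was a failure, and otherwise the output described by the trace. -/
def outPass (w₀ : Word) : Prog := .pop 4 (sweep outBody) (outWord w₀) (outWord w₀)

theorem runs_outPass (w₀ : Word) (v : List Sym) (F : List Bool) :
    ∃ s, Runs X (outPass w₀) ⟨flat v, [], [], [], F, [], [], [], [], []⟩ s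
        (v.length * 10 + 2 * w₀.length + 12) ∧
      (F = [] → s.out = outs v) ∧ (F ≠ [] → s.out = w₀) := by
  rcases F with _ | ⟨b, F⟩
  · exact ⟨_, (Runs.popE rfl (runs_sweep_outBody v [] [] [] [] [] [] [] [] [])).mono (by omega),
      fun _ => rfl, fun h => absurd rfl h⟩
  · have h1 := runs_outWord (X := X) w₀ ⟨flat v, [], [], [], F, [], [], [], [], []⟩
    rw [← Bool.cond_self b (outWord w₀)] at h1
    exact ⟨_, (Runs.popL rfl h1).mono (by omega), fun h => absurd h (by simp), fun _ => rfl⟩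

end Prog

/-! ### The trace verifier -/

/-- The conditions on a trace that the verifier checks. -/
def TraceOK (X : Set Word) (i d : ℕ) (v : List Sym) : Prop :=
  PathOK X Sym.init.code 0 v ∧ AnswersOK X [] v ∧ zeros (Prog.certLength i d (weight v)) ∈ X ∧
    TapesOK v.length v

open scoped Classical in
/-- The proof system computed by the verifier: a correct trace of a machine that has a certificate
proves the word it outputs, all other words prove the fixed word `w₀`. -/
noncomputable def verify (X : Set Word) (i d : ℕ) (w₀ z : Word) : Word :=
  if TraceOK X i d (parse z) then outs (parse z) else w₀

namespace Prog

variable {X : Set Word}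

/-- The program of the verifier. -/
def verifier (i d : ℕ) (w₀ : Word) : Prog :=
  .seq (sweep keep) (.seq rewind (.seq pathPass (.seq answerPass (.seq (certPass i d)
    (.seq tapesPass (outPass w₀))))))

theorem runs_verifier (i d : ℕ) (w₀ z : Word) (n : ℕ) (hn : n = z.length) :
    ∃ s, Runs X (verifier i d w₀) (Store.input z) s
        (4000 * (n + 1) ^ 2 + d * (30 * (sq^[d] n + 1) ^ 2 + 1) +
          (sq^[d] n + 1) * (16 * 2 ^ i + 20) + 2 * w₀.length) ∧
      s.out = verify X i d w₀ z := by
  set v := parse z with hv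
  have hlen : v.length ≤ n := hn ▸ length_parse_le z
  have h1 := runs_sweep_keep (X := X) z [] [] [] [] [] [] [] [] []
  have h2 := runs_rewind (X := X) ((flat v).reverse ++ []) [] [] [] [] [] [] [] [] []
  simp only [List.append_nil, List.reverse_reverse, ← hv] at h1 h2
  obtain ⟨F3, hF3, h3⟩ := runs_pathPass (X := X) v [] [] [] [] []
  obtain ⟨F4, hF4, h4⟩ := runs_answerPass (X := X) v [] [] F3 [] [] []
  obtain ⟨F5, hF5, h5⟩ := runs_certPass (X := X) i d v F4 (units v.length) []
  obtain ⟨F6, v', hF6, hv', hlen', h6⟩ := runs_tapesPass (X := X) v.length v F5 [] [] []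
  obtain ⟨s, h7, hs1, hs2⟩ := runs_outPass (X := X) w₀ v' F6
  refine ⟨s, (h1.seq (h2.seq (h3.seq (h4.seq (h5.seq (h6.seq h7)))))).mono ?_, ?_⟩
  · have hsq : sq^[d] v.length ≤ sq^[d] n := sq_mono.iterate d hlen
    have a1 : d * (30 * (sq^[d] v.length + 1) ^ 2 + 1) ≤ d * (30 * (sq^[d] n + 1) ^ 2 + 1) := by
      gcongr
    have a2 : (sq^[d] v.length + 1) * (16 * 2 ^ i + 20) ≤ (sq^[d] n + 1) * (16 * 2 ^ i + 20) := by
      gcongr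
    have a3 : (v.length + 1) ^ 2 ≤ (n + 1) ^ 2 := Nat.pow_le_pow_left (by omega) 2
    simp only [List.length_reverse, length_flat]
    nlinarith
  · have hF : F6 = [] ↔ TraceOK X i d v := by
      have := ((hF3.and hF4).and hF5).and hF6
      unfold Checks at this
      rw [this, TraceOK]
      tauto
    rw [verify]
    by_cases h : TraceOK X i d (parse z)
    · rw [if_pos h, hs1 (hF.2 h), hv']
    · rw [if_neg h, hs2 fun hF6 => h (hF.1 hF6)]

/-- The polynomial `sq^[d]`. -/
noncomputable def sqPoly : ℕ → Polynomial ℕ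
  | 0 => Polynomial.X
  | d + 1 => sqPoly d * (sqPoly d + 1)

theorem eval_sqPoly (d n : ℕ) : (sqPoly d).eval n = sq^[d] n := by
  induction d with
  | zero => simp [sqPoly]
  | succ d ih => simp [sqPoly, ih, Function.iterate_succ_apply', sq]

end Prog

theorem verify_mem_FP (X : Set Word) (i d : ℕ) (w₀ : Word) : verify X i d w₀ ∈ FP X := by
  refine Prog.mem_FP_of_runs (Prog.verifier i d w₀)
    (4000 * (Polynomial.X + 1) ^ 2 +
      (d : Polynomial ℕ) * (30 * (Prog.sqPoly d + 1) ^ 2 + 1) +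
        (Prog.sqPoly d + 1) * (16 * 2 ^ i + 20) + 2 * (w₀.length : Polynomial ℕ)) _ fun z => ?_
  obtain ⟨s, hs, ho⟩ := Prog.runs_verifier (X := X) i d w₀ z z.length rfl
  refine ⟨s, hs.mono (le_of_eq ?_), ho⟩
  simp [Prog.eval_sqPoly]

/-! ### Traces of machines -/

/-- The control states of a trace of `M`: while the input is written on tape `0`, while `M` is
running, and at the end. -/
inductive TState (M : OracleTM) : Type
  | load
  | run (q : M.State)
  | done

instance (M : OracleTM) : Countable (TState M) := by
  have := M.finite_state
  let φ : TState M → Option (Option M.State)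
    | .load => none
    | .done => some none
    | .run q => some (some q)
  refine Function.Injective.countable (f := φ) ?_
  intro a b h
  cases a <;> cases b <;> simp_all [φ]

/-- The description of one step in a trace: the operations on the tapes and further letters. -/
abbrev Block (k : ℕ) : Type := (Fin (k + 1) → TapeOp) × List Sym

/-- The letter for an operation on a tape. -/
def opSym (o : TapeOp) : Sym := .tp o.1 o.2.1 o.2.2

/-- The letters of a block. -/
def Block.word {k : ℕ} (b : Block k) : List Sym :=
  .blk :: ((List.ofFn b.1).map opSym ++ b.2)

/-- The letters of a sequence of blocks. -/
def blocksWord {k : ℕ} (B : List (Block k)) : List Sym := B.flatMap Block.word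

theorem blocksWord_cons {k : ℕ} (b : Block k) (B : List (Block k)) :
    blocksWord (b :: B) = b.word ++ blocksWord B := rfl

/-- `c` letters `wt`. -/
abbrev wts (c : ℕ) : List Sym := List.replicate c .wt

/-- A block of a trace that writes the letter `b` of the input on tape `0`; the input is written
from right to left. -/
def loadBlock (k j : ℕ) (b : Bool) : Block k :=
  (fun i => if i = 0 then (none, some b, -1) else (none, none, 0), wts (2 ^ (j + 1)))

/-- The block that moves the head to the beginning of the input. -/
def startBlock (k j : ℕ) : Block k :=
  (fun i => if i = 0 then (none, none, 1) else (none, none, 0), wts (2 ^ (j + 1)))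

/-- The block for an ordinary step. -/
def stepBlock {k : ℕ} (j : ℕ) (σ w : Fin (k + 1) → Option Bool) (mv : Fin (k + 1) → SignType)
    (o r : Option Bool) : Block k :=
  (fun i => (σ i, w i, mv i), o.toList.map .ap ++ (r.toList.map .ot ++ wts (2 ^ (j + 1))))

/-- The block for a query with answer `a`. -/
def queryBlock {k : ℕ} (j : ℕ) (σ : Fin (k + 1) → Option Bool) (a : Bool) : Block k :=
  (fun i => (σ i, σ i, 0), .an a :: wts (2 ^ (j + 1)))

/-- The block for a halting configuration. -/
def haltBlock {k : ℕ} (j : ℕ) (σ : Fin (k + 1) → Option Bool) : Block k :=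
  (fun i => (σ i, σ i, 0), wts (2 ^ j))

/-- The blocks that are possible in a trace of `M`; the number `j` determines the number of letters
`wt` of each block. -/
inductive BlockStep (M : OracleTM) (j : ℕ) : TState M → Block M.k → TState M → Prop
  | load (b) : BlockStep M j .load (loadBlock M.k j b) .load
  | start : BlockStep M j .load (startBlock M.k j) (.run M.start)
  | step {q σ q' w mv o r} : M.δ q σ = .step q' w mv o r →
      BlockStep M j (.run q) (stepBlock j σ w mv o r) (.run q')
  | query {q σ y n} (a : Bool) : M.δ q σ = .query y n →
      BlockStep M j (.run q) (queryBlock j σ a) (.run (cond a y n))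
  | halt {q σ b} : M.δ q σ = .halt b → BlockStep M j (.run q) (haltBlock j σ) .done

/-- Sequences of blocks that lead to the end of a trace. -/
inductive BlockPath (M : OracleTM) (j : ℕ) : TState M → List (Block M.k) → Prop
  | done : BlockPath M j .done []
  | cons {s b s' B} : BlockStep M j s b s' → BlockPath M j s' B → BlockPath M j s (b :: B)

/-- Letters that neither begin a block nor belong to a tape, and are no units. -/
def Sym.Plain : Sym → Prop
  | .blk | .tp _ _ _ | .unit => False
  | _ => True

theorem BlockStep.plain {M : OracleTM} {j : ℕ} {s s' : TState M} {b : Block M.k}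
    (h : BlockStep M j s b s') : ∀ a ∈ b.2, a.Plain := by
  cases h <;> intro a ha <;>
    simp only [loadBlock, startBlock, stepBlock, queryBlock, haltBlock, wts, List.mem_append,
      List.mem_map, List.mem_cons, List.mem_replicate, Option.mem_toList] at ha
  · rw [ha.2]; trivial
  · rw [ha.2]; trivial
  · rcases ha with ⟨b, _, rfl⟩ | ⟨b, _, rfl⟩ | ⟨_, rfl⟩ <;> trivial
  · rcases ha with rfl | ⟨_, rfl⟩ <;> trivial
  · rw [ha.2]; trivial

theorem BlockStep.ne_unit {M : OracleTM} {j : ℕ} {s s' : TState M} {b : Block M.k}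
    (h : BlockStep M j s b s') : ∀ a ∈ b.word, a ≠ .unit := by
  intro a ha hu
  subst hu
  simp only [Block.word, List.mem_cons, List.mem_append, List.mem_map, opSym] at ha
  rcases ha with ha | ⟨_, _, ha⟩ | ha
  · cases ha
  · cases ha
  · exact h.plain _ ha

/-! ### Weight and output of a sequence of blocks -/

theorem weight_append (u v : List Sym) : weight (u ++ v) = weight u + weight v := by
  induction u with
  | nil => simp [weight]
  | cons a u ih =>
    cases a <;> simp only [List.cons_append, weight, ih]
    omega

theorem outs_append (u v : List Sym) : outs (u ++ v) = outs u ++ outs v := by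
  induction u with
  | nil => simp [outs]
  | cons a u ih => cases a <;> simp only [List.cons_append, outs, ih]

theorem weight_wts (c : ℕ) : weight (wts c) = c := by
  induction c with
  | zero => rfl
  | succ c ih => rw [wts, List.replicate_succ, weight, ih]

theorem outs_wts (c : ℕ) : outs (wts c) = [] := by
  induction c with
  | zero => rfl
  | succ c ih => rw [wts, List.replicate_succ, outs, ih]; simp

theorem weight_map_opSym (l : List TapeOp) : weight (l.map opSym) = 0 := by
  induction l with
  | nil => rfl
  | cons o l ih => rw [List.map_cons, opSym, weight, ih]; simp

theorem outs_map_opSym (l : List TapeOp) : outs (l.map opSym) = [] := by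
  induction l with
  | nil => rfl
  | cons o l ih => rw [List.map_cons, opSym, outs, ih]; simp

theorem weight_word {k : ℕ} (b : Block k) : weight b.word = weight b.2 := by
  rw [Block.word, weight, weight_append, weight_map_opSym, zero_add]
  simp

theorem outs_word {k : ℕ} (b : Block k) : outs b.word = outs b.2 := by
  rw [Block.word, outs, outs_append, outs_map_opSym, List.nil_append]
  simp

theorem BlockStep.weight {M : OracleTM} {j : ℕ} {s s' : TState M} {b : Block M.k}
    (h : BlockStep M j s b s') :
    (s' = .done → weight b.word = 2 ^ j) ∧ (s' ≠ .done → weight b.word = 2 ^ (j + 1)) := by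
  rw [weight_word]
  cases h with
  | load b => exact ⟨fun h => (by cases h), fun _ => weight_wts _⟩
  | start => exact ⟨fun h => (by cases h), fun _ => weight_wts _⟩
  | step h =>
    rename_i o r
    refine ⟨fun h => (by cases h), fun _ => ?_⟩
    rw [stepBlock]
    cases o <;> cases r <;> exact weight_wts _
  | query a h => exact ⟨fun h => (by cases h), fun _ => weight_wts _⟩
  | halt h => exact ⟨fun _ => weight_wts _, fun h => absurd rfl h⟩

theorem BlockPath.weight {M : OracleTM} {j : ℕ} {s : TState M} {B : List (Block M.k)}
    (h : BlockPath M j s B) :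
    (s = .done → B = []) ∧
      (s ≠ .done → ∃ T, B.length = T + 1 ∧ weight (blocksWord B) = 2 ^ j * (2 * T + 1)) := by
  induction h with
  | done => exact ⟨fun _ => rfl, fun h => absurd rfl h⟩
  | @cons s b s' B hb hB ih =>
    refine ⟨fun hs => (by subst hs; cases hb), fun _ => ?_⟩
    rw [blocksWord_cons, weight_append]
    by_cases hs' : s' = .done
    · rw [ih.1 hs', hb.weight.1 hs']
      exact ⟨0, rfl, by simp [blocksWord, OracleComplexity.weight]⟩
    · obtain ⟨T, hT, hw⟩ := ih.2 hs'
      rw [hb.weight.2 hs', hw]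
      exact ⟨T + 1, by rw [List.length_cons, hT], by ring⟩

/-! ### The tapes of a sequence of blocks -/

theorem firstOps_plain (u : Bool) {l : List Sym} (hl : ∀ a ∈ l, a.Plain) (v : List Sym) :
    firstOps u (l ++ v) = firstOps u v := by
  induction l with
  | nil => rfl
  | cons a l ih =>
    have ha := hl a List.mem_cons_self
    have ih := ih fun b hb => hl b (List.mem_cons_of_mem _ hb)
    rw [List.cons_append, ← ih]
    cases a <;> cases u <;> first | exact ha.elim | rfl

theorem dropOps_plain (u : Bool) {l : List Sym} (hl : ∀ a ∈ l, a.Plain) (v : List Sym) :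
    dropOps u (l ++ v) = l ++ dropOps u v := by
  induction l with
  | nil => rfl
  | cons a l ih =>
    have ha := hl a List.mem_cons_self
    have ih := ih fun b hb => hl b (List.mem_cons_of_mem _ hb)
    rw [List.cons_append, List.cons_append, ← ih]
    cases a <;> cases u <;> first | exact ha.elim | rfl

theorem firstOps_used (ops : List TapeOp) (v : List Sym) :
    firstOps true (ops.map opSym ++ v) = firstOps true v := by
  induction ops with
  | nil => rfl
  | cons o ops ih => rw [← ih]; rfl

theorem dropOps_used (ops : List TapeOp) (v : List Sym) :
    dropOps true (ops.map opSym ++ v) = ops.map opSym ++ dropOps true v := by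
  induction ops with
  | nil => rfl
  | cons o ops ih => rw [List.map_cons, List.cons_append, List.cons_append, ← ih]; rfl

/-- Blocks from which some operations may have been deleted. -/
def listWord (B : List (List TapeOp × List Sym)) : List Sym :=
  B.flatMap fun b => .blk :: (b.1.map opSym ++ b.2)

theorem listWord_cons (b : List TapeOp × List Sym) (B : List (List TapeOp × List Sym)) :
    listWord (b :: B) = .blk :: (b.1.map opSym ++ (b.2 ++ listWord B)) := by
  simp [listWord]

theorem firstOps_listWord (u : Bool) {B : List (List TapeOp × List Sym)}
    (hB : ∀ b ∈ B, ∀ a ∈ b.2, a.Plain) :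
    firstOps u (listWord B) = B.filterMap fun b => b.1.head? := by
  induction B generalizing u with
  | nil => cases u <;> rfl
  | cons b B ih =>
    have hb := hB b List.mem_cons_self
    have ih := fun u => ih u fun b hb => hB b (List.mem_cons_of_mem _ hb)
    obtain ⟨ops, r⟩ := b
    have h1 : firstOps u (listWord ((ops, r) :: B)) =
        firstOps false (ops.map opSym ++ (r ++ listWord B)) := by
      rw [listWord_cons]
      cases u <;> rfl
    rw [h1]
    rcases ops with _ | ⟨o, ops⟩
    · rw [List.map_nil, List.nil_append, firstOps_plain _ hb, ih]
      rfl
    · have h2 : firstOps false ((o :: ops).map opSym ++ (r ++ listWord B)) =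
          o :: firstOps true (ops.map opSym ++ (r ++ listWord B)) := rfl
      rw [h2, firstOps_used, firstOps_plain _ hb, ih]
      rfl

theorem dropOps_listWord (u : Bool) {B : List (List TapeOp × List Sym)}
    (hB : ∀ b ∈ B, ∀ a ∈ b.2, a.Plain) :
    dropOps u (listWord B) = listWord (B.map fun b => (b.1.tail, b.2)) := by
  induction B generalizing u with
  | nil => cases u <;> rfl
  | cons b B ih =>
    have hb := hB b List.mem_cons_self
    have ih := fun u => ih u fun b hb => hB b (List.mem_cons_of_mem _ hb)
    obtain ⟨ops, r⟩ := b
    have h1 : dropOps u (listWord ((ops, r) :: B)) =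
        .blk :: dropOps false (ops.map opSym ++ (r ++ listWord B)) := by
      rw [listWord_cons]
      cases u <;> rfl
    rw [h1, List.map_cons, listWord_cons]
    rcases ops with _ | ⟨o, ops⟩
    · rw [List.map_nil, List.nil_append, dropOps_plain _ hb, ih]
      rfl
    · have h2 : dropOps false ((o :: ops).map opSym ++ (r ++ listWord B)) =
          dropOps true (ops.map opSym ++ (r ++ listWord B)) := rfl
      rw [h2, dropOps_used, dropOps_plain _ hb, ih]
      rfl

theorem tapesOK_listWord (n : ℕ) {B : List (List TapeOp × List Sym)}
    (hB : ∀ b ∈ B, ∀ a ∈ b.2, a.Plain) :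
    TapesOK n (listWord B) ↔ ∀ i < n, OpsOK [] [] (B.filterMap fun b => b.1[i]?) := by
  induction n generalizing B with
  | zero => simp [TapesOK]
  | succ n ih =>
    have hB' : ∀ b ∈ B.map (fun b => (b.1.tail, b.2)), ∀ a ∈ b.2, a.Plain := by
      intro b hb
      obtain ⟨b', hb', rfl⟩ := List.mem_map.1 hb
      exact hB b' hb'
    rw [TapesOK, firstOps_listWord _ hB, dropOps_listWord _ hB, ih hB']
    have h0 : (B.filterMap fun b => b.1.head?) = B.filterMap fun b => b.1[0]? := by
      simp only [List.head?_eq_getElem?]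
    have h1 : ∀ i, ((B.map fun b => (b.1.tail, b.2)).filterMap fun b => b.1[i]?) =
        B.filterMap fun b => b.1[i + 1]? := by
      intro i
      rw [List.filterMap_map]
      simp only [Function.comp_def, List.getElem?_tail]
    simp only [h0, h1]
    refine ⟨fun h i hi => ?_, fun h => ⟨h 0 n.succ_pos, fun i hi => h (i + 1) (by omega)⟩⟩
    rcases i with _ | i
    · exact h.1
    · exact h.2 i (by omega)

theorem BlockPath.plain {M : OracleTM} {j : ℕ} {s : TState M} {B : List (Block M.k)}
    (h : BlockPath M j s B) : ∀ b ∈ B, ∀ a ∈ b.2, a.Plain := by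
  induction h with
  | done => simp
  | cons hb _ ih =>
    intro b hB
    rcases List.mem_cons.1 hB with rfl | hB
    · exact hb.plain
    · exact ih b hB

/-- The operations are possible on a tape whose cells relative to the head have the content `D`. -/
def RelOK : (ℤ → Option Bool) → List TapeOp → Prop
  | _, [] => True
  | D, (σ, w, m) :: ops => D 0 = σ ∧ RelOK (fun z => Function.update D 0 w (z + (m : ℤ))) ops

/-- The content of the cells relative to the head. -/
def zipFun (L R : List (Option Bool)) (z : ℤ) : Option Bool :=
  if 0 ≤ z then R[z.toNat]?.join else L[(-1 - z).toNat]?.join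

theorem zipFun_zipMove (L R : List (Option Bool)) (w : Option Bool) (m : SignType) :
    zipFun (zipMove w L R.tail m).1 (zipMove w L R.tail m).2 =
      fun z => Function.update (zipFun L R) 0 w (z + (m : ℤ)) := by
  funext z
  rcases m with _ | _ | _
  · change zipFun L (w :: R.tail) z = Function.update (zipFun L R) 0 w (z + 0)
    rw [add_zero]
    rcases lt_trichotomy z 0 with hz | rfl | hz
    · rw [Function.update_of_ne hz.ne, zipFun, zipFun, if_neg (by omega), if_neg (by omega)]
    · rw [Function.update_self]
      rfl
    · rw [Function.update_of_ne hz.ne', zipFun, zipFun, if_pos hz.le, if_pos hz.le]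
      obtain ⟨n, rfl⟩ : ∃ n : ℕ, z = n + 1 := ⟨(z - 1).toNat, by omega⟩
      rw [show ((n : ℤ) + 1).toNat = n + 1 by omega, List.getElem?_cons_succ, List.getElem?_tail]
  · change zipFun L.tail (L.head?.join :: w :: R.tail) z =
      Function.update (zipFun L R) 0 w (z + -1)
    rcases lt_trichotomy z 0 with hz | rfl | hz
    · rw [Function.update_of_ne (by omega), zipFun, zipFun, if_neg (by omega), if_neg (by omega),
        List.getElem?_tail]
      congr 2
      omega
    · rw [Function.update_of_ne (by omega)]
      change L.head?.join = L[0]?.join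
      rw [List.head?_eq_getElem?]
    · rcases lt_trichotomy z 1 with hz' | rfl | hz'
      · omega
      · change w = Function.update (zipFun L R) 0 w 0
        rw [Function.update_self]
      · rw [Function.update_of_ne (by omega), zipFun, zipFun, if_pos (by omega), if_pos (by omega)]
        obtain ⟨n, rfl⟩ : ∃ n : ℕ, z = n + 2 := ⟨(z - 2).toNat, by omega⟩
        rw [show ((n : ℤ) + 2).toNat = n + 2 by omega,
          show ((n : ℤ) + 2 + -1).toNat = n + 1 by omega, List.getElem?_cons_succ,
          List.getElem?_cons_succ, List.getElem?_tail]
  · change zipFun (w :: L) R.tail z = Function.update (zipFun L R) 0 w (z + 1)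
    rcases lt_trichotomy z (-1) with hz | rfl | hz
    · rw [Function.update_of_ne (by omega), zipFun, zipFun, if_neg (by omega), if_neg (by omega)]
      obtain ⟨n, rfl⟩ : ∃ n : ℕ, z = -2 - n := ⟨(-2 - z).toNat, by omega⟩
      rw [show (-1 - (-2 - (n : ℤ))).toNat = n + 1 by omega,
        show (-1 - (-2 - (n : ℤ) + 1)).toNat = n by omega, List.getElem?_cons_succ]
    · change w = Function.update (zipFun L R) 0 w 0
      rw [Function.update_self]
    · rw [Function.update_of_ne (by omega), zipFun, zipFun, if_pos (by omega), if_pos (by omega),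
        List.getElem?_tail]
      congr 2
      omega

theorem opsOK_iff_relOK (L R : List (Option Bool)) (ops : List TapeOp) :
    OpsOK L R ops ↔ RelOK (zipFun L R) ops := by
  induction ops generalizing L R with
  | nil => exact Iff.rfl
  | cons o ops ih =>
    obtain ⟨σ, w, m⟩ := o
    rw [OpsOK, RelOK, ih, zipFun_zipMove]
    have : zipFun L R 0 = R.head?.join := by
      rw [List.head?_eq_getElem?]
      rfl
    rw [this]

theorem zipFun_nil : zipFun [] [] = fun _ => none := by
  funext z
  unfold zipFun
  split_ifs <;> rfl

/-- The conditions on the tapes for a sequence of blocks. -/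
theorem BlockPath.tapesOK_iff {M : OracleTM} {j : ℕ} {s : TState M} {B : List (Block M.k)}
    (h : BlockPath M j s B) {n : ℕ} (hn : M.k + 1 ≤ n) :
    TapesOK n (blocksWord B) ↔ ∀ i, RelOK (fun _ => none) (B.map fun b => b.1 i) := by
  have hw : blocksWord B = listWord (B.map fun b => (List.ofFn b.1, b.2)) := by
    simp only [blocksWord, listWord, List.flatMap_map]
    rfl
  have hp : ∀ b ∈ B.map (fun b => (List.ofFn b.1, b.2)), ∀ a ∈ b.2, a.Plain := by
    intro b hb
    obtain ⟨b', hb', rfl⟩ := List.mem_map.1 hb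
    exact h.plain b' hb'
  rw [hw, tapesOK_listWord n hp]
  simp only [opsOK_iff_relOK, zipFun_nil, List.filterMap_map, Function.comp_def]
  have hget : ∀ i : Fin (M.k + 1), (B.filterMap fun b => (List.ofFn b.1)[(i : ℕ)]?) =
      B.map fun b => b.1 i := by
    intro i
    simp only [List.getElem?_ofFn, i.2, dif_pos, Fin.eta, List.filterMap_eq_map']
  constructor
  · intro hi i
    rw [← hget]
    exact hi i (i.2.trans_le hn)
  · intro hi i _
    by_cases hik : i < M.k + 1
    · rw [hget ⟨i, hik⟩]
      exact hi _
    · have : (B.filterMap fun b => (List.ofFn b.1)[i]?) = [] := by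
        simp [hik]
      rw [this]
      trivial

/-! ### The automaton that reads traces -/

/-- The machine with index `j`.  Each machine has infinitely many indices. -/
noncomputable def machOf (j : ℕ) : OracleTM := mach (Nat.unpair j).1

/-- The nodes of the automaton: the index of a machine, the letters that remain of the current
block, and the control state after this block. -/
abbrev Node : Type := Σ j : ℕ, List Sym × TState (machOf j)

/-- The edges of the automaton. -/
inductive NStep : Node → Sym → Node → Prop
  | enter {j s b s' a u} : BlockStep (machOf j) j s b s' → b.word = a :: u →
      NStep ⟨j, [], s⟩ a ⟨j, u, s'⟩
  | next {j a u s} : NStep ⟨j, a :: u, s⟩ a ⟨j, u, s⟩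

/-- The words that lead from a node to the end of a trace. -/
inductive NPath : Node → List Sym → Prop
  | done (j) : NPath ⟨j, [], .done⟩ []
  | cons {N a N' w} : NStep N a N' → NPath N' w → NPath N (a :: w)

theorem exists_injective_node : ∃ f : Node → ℕ, Function.Injective f :=
  Countable.exists_injective_nat Node

/-- An exponent for each node. -/
noncomputable def nodeExp : Node → ℕ := exists_injective_node.choose

/-- The number of a node.  As these numbers are multiples of powers of four, two nodes and a letter
are determined by the number of the first node plus twice the number of the second node plus the
code of the letter. -/
noncomputable def nodeNum (N : Node) : ℕ := 128 * 4 ^ nodeExp N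

/-- The numbers that stand for edges of the automaton, and for its initial and final nodes. -/
def EdgeCode (n : ℕ) : Prop :=
  (∃ N a N', NStep N a N' ∧ n = nodeNum N + a.code + 2 * nodeNum N') ∨
    (∃ j, n = Sym.init.code + 2 * nodeNum ⟨j, [], .load⟩) ∨
    ∃ j, n = nodeNum ⟨j, [], .done⟩ + Sym.eof.code

theorem four_pow_inj {a b : ℕ} (h : 4 ^ a = 4 ^ b) : a = b :=
  Nat.pow_right_injective (le_refl 2 |>.trans (by norm_num)) h

theorem four_pow_add_inj : ∀ {a b c d : ℕ}, 4 ^ a + 2 * 4 ^ b = 4 ^ c + 2 * 4 ^ d → a = c ∧ b = d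
  | 0, b, 0, d, h => ⟨rfl, four_pow_inj (by omega)⟩
  | 0, b, c + 1, d, h => by rw [pow_succ 4 c] at h; omega
  | a + 1, b, 0, d, h => by rw [pow_succ 4 a] at h; omega
  | a + 1, 0, c + 1, 0, h => by
    refine ⟨?_, rfl⟩
    exact four_pow_inj (by omega)
  | a + 1, 0, c + 1, d + 1, h => by
    rw [pow_succ 4 a, pow_succ 4 c, pow_succ 4 d] at h; omega
  | a + 1, b + 1, c + 1, 0, h => by
    rw [pow_succ 4 a, pow_succ 4 c, pow_succ 4 b] at h; omega
  | a + 1, b + 1, c + 1, d + 1, h => by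
    have := four_pow_add_inj (a := a) (b := b) (c := c) (d := d)
      (by rw [pow_succ 4 a, pow_succ 4 c, pow_succ 4 b, pow_succ 4 d] at h; omega)
    omega

theorem four_pow_mod (a : ℕ) : 4 ^ a % 3 = 1 := by
  rw [Nat.pow_mod]
  simp

theorem nodeExp_injective : Function.Injective nodeExp := exists_injective_node.choose_spec

theorem nodeNum_injective : Function.Injective nodeNum := fun N N' h =>
  nodeExp_injective (four_pow_inj (by unfold nodeNum at h; omega))

/-- An edge number determines its nodes and its letter: the code of the letter is the residue modulo
`128`, and the powers of four are determined by the digits to the base `4`. -/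
theorem nStep_of_edgeCode {N N' : Node} {a : Sym}
    (h : EdgeCode (nodeNum N + a.code + 2 * nodeNum N')) : NStep N a N' := by
  have ha := a.code_lt
  have m1 := four_pow_mod (nodeExp N)
  have m2 := four_pow_mod (nodeExp N')
  rcases h with ⟨M, b, M', hs, h⟩ | ⟨j, h⟩ | ⟨j, h⟩
  · have hb := b.code_lt
    unfold nodeNum at h
    have hab : a = b := Sym.code_injective (by omega)
    obtain ⟨h1, h2⟩ := four_pow_add_inj (a := nodeExp N) (b := nodeExp N') (c := nodeExp M)
      (d := nodeExp M') (by omega)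
    rw [hab, nodeExp_injective h1, nodeExp_injective h2]
    exact hs
  · have hb := Sym.init.code_lt
    have m3 := four_pow_mod (nodeExp ⟨j, [], .load⟩)
    unfold nodeNum at h
    omega
  · have hb := Sym.eof.code_lt
    have m3 := four_pow_mod (nodeExp ⟨j, [], .done⟩)
    unfold nodeNum at h
    omega

theorem exists_of_edgeCode_init {N : Node} (h : EdgeCode (Sym.init.code + 2 * nodeNum N)) :
    ∃ j, N = ⟨j, [], .load⟩ := by
  have ha := Sym.init.code_lt
  have m1 := four_pow_mod (nodeExp N)
  rcases h with ⟨M, b, M', hs, h⟩ | ⟨j, h⟩ | ⟨j, h⟩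
  · have hb := b.code_lt
    have m2 := four_pow_mod (nodeExp M)
    have m3 := four_pow_mod (nodeExp M')
    unfold nodeNum at h
    omega
  · exact ⟨j, nodeNum_injective (by omega)⟩
  · have hb := Sym.eof.code_lt
    have m3 := four_pow_mod (nodeExp ⟨j, [], .done⟩)
    unfold nodeNum at h
    omega

theorem exists_of_edgeCode_eof {N : Node} (h : EdgeCode (nodeNum N + Sym.eof.code)) :
    ∃ j, N = ⟨j, [], .done⟩ := by
  have ha := Sym.eof.code_lt
  have m1 := four_pow_mod (nodeExp N)
  rcases h with ⟨M, b, M', hs, h⟩ | ⟨j, h⟩ | ⟨j, h⟩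
  · have hb := b.code_lt
    have m2 := four_pow_mod (nodeExp M)
    have m3 := four_pow_mod (nodeExp M')
    unfold nodeNum at h
    omega
  · have hb := Sym.init.code_lt
    have m3 := four_pow_mod (nodeExp ⟨j, [], .load⟩)
    unfold nodeNum at h
    omega
  · exact ⟨j, nodeNum_injective (by omega)⟩

/-- The trace without the letters `unit`. -/
def core : List Sym → List Sym
  | [] => []
  | .unit :: v => core v
  | a :: v => a :: core v

/-- The oracle describes the automaton. -/
structure KnowsAutomaton (X : Set Word) : Prop where
  edge : ∀ n, EdgeBit X n ↔ EdgeCode n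
  node : ∀ n, NodeBit X n ↔ ∃ N, n = nodeNum N

theorem core_cons {a : Sym} (ha : a ≠ .unit) (v : List Sym) : core (a :: v) = a :: core v := by
  cases a <;> first | exact absurd rfl ha | rfl

theorem pathOK_cons {X : Set Word} {a : Sym} (ha : a ≠ .unit) (p c : ℕ) (v : List Sym) :
    PathOK X p c (a :: v) ↔
      EdgeBit X (p + 2 * c) ∧ NodeBit X c ∧ PathOK X (c + a.code) 0 v := by
  cases a <;> first | exact absurd rfl ha | exact Iff.rfl

theorem PathOK.exists_nPath {X : Set Word} (hX : KnowsAutomaton X) {v : List Sym} {p c : ℕ}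
    (h : PathOK X p c v) : ∃ N, EdgeBit X (p + 2 * nodeNum N) ∧ NPath N (core v) := by
  induction v generalizing p c with
  | nil =>
    obtain ⟨h1, h2, h3⟩ := h
    obtain ⟨N, rfl⟩ := (hX.node _).1 h2
    obtain ⟨j, rfl⟩ := exists_of_edgeCode_eof ((hX.edge _).1 h3)
    exact ⟨_, h1, .done j⟩
  | cons a v ih =>
    by_cases ha : a = .unit
    · subst ha
      exact ih (c := c + 1) h
    · obtain ⟨h1, h2, h3⟩ := (pathOK_cons ha _ _ _).1 h
      obtain ⟨N, rfl⟩ := (hX.node _).1 h2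
      obtain ⟨N', h4, h5⟩ := ih h3
      rw [core_cons ha]
      exact ⟨N, h1, .cons (nStep_of_edgeCode ((hX.edge _).1 h4)) h5⟩

theorem NPath.exists_blockPath {N : Node} {w : List Sym} (h : NPath N w) :
    ∃ B, BlockPath (machOf N.1) N.1 N.2.2 B ∧ w = N.2.1 ++ blocksWord B := by
  induction h with
  | done j => exact ⟨[], .done, rfl⟩
  | cons hs _ ih =>
    obtain ⟨B, hB, rfl⟩ := ih
    cases hs with
    | enter hb hw => exact ⟨_, .cons hb hB, by rw [blocksWord_cons, hw]; rfl⟩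
    | next => exact ⟨B, hB, rfl⟩

theorem PathOK.exists_blockPath {X : Set Word} (hX : KnowsAutomaton X) {v : List Sym}
    (h : PathOK X Sym.init.code 0 v) :
    ∃ j B, BlockPath (machOf j) j .load B ∧ core v = blocksWord B := by
  obtain ⟨N, h1, h2⟩ := h.exists_nPath hX
  obtain ⟨j, rfl⟩ := exists_of_edgeCode_init ((hX.edge _).1 h1)
  obtain ⟨B, hB, hw⟩ := h2.exists_blockPath
  exact ⟨j, B, hB, hw⟩

/-! ### Units do not matter for the other checks -/

theorem answersOK_core (X : Set Word) (o : Word) (v : List Sym) :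
    AnswersOK X o (core v) ↔ AnswersOK X o v := by
  induction v generalizing o with
  | nil => exact Iff.rfl
  | cons a v ih => cases a <;> simp only [core, AnswersOK, ih]

theorem weight_core (v : List Sym) : weight (core v) = weight v := by
  induction v with
  | nil => rfl
  | cons a v ih => cases a <;> simp only [core, weight, ih]

theorem outs_core (v : List Sym) : outs (core v) = outs v := by
  induction v with
  | nil => rfl
  | cons a v ih => cases a <;> simp only [core, outs, ih]

theorem firstOps_core (u : Bool) (v : List Sym) : firstOps u (core v) = firstOps u v := by
  induction v generalizing u with
  | nil => rfl
  | cons a v ih => cases a <;> cases u <;> simp only [core, firstOps, ih]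

theorem dropOps_core (u : Bool) (v : List Sym) : dropOps u (core v) = core (dropOps u v) := by
  induction v generalizing u with
  | nil => cases u <;> rfl
  | cons a v ih => cases a <;> cases u <;> simp only [core, dropOps, ih]

theorem tapesOK_core (n : ℕ) (v : List Sym) : TapesOK n (core v) ↔ TapesOK n v := by
  induction n generalizing v with
  | zero => exact Iff.rfl
  | succ n ih => rw [TapesOK, TapesOK, firstOps_core, dropOps_core, ih]

theorem length_core_le (v : List Sym) : (core v).length ≤ v.length := by
  induction v with
  | nil => rfl
  | cons a v ih => cases a <;> simp only [core, List.length_cons] <;> omega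

/-! ### Correct traces describe runs -/

theorem answersOK_wts (X : Set Word) (o : Word) (c : ℕ) (v : List Sym) :
    AnswersOK X o (wts c ++ v) ↔ AnswersOK X o v := by
  induction c with
  | zero => exact Iff.rfl
  | succ c ih => rw [wts, List.replicate_succ, List.cons_append, AnswersOK, ih] <;> simp

theorem answersOK_word {X : Set Word} {o : Word} {k : ℕ} (b : Block k) (v : List Sym) :
    AnswersOK X o (b.word ++ v) ↔ AnswersOK X o (b.2 ++ v) := by
  have h : ∀ l : List TapeOp, AnswersOK X o (l.map opSym ++ (b.2 ++ v)) ↔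
      AnswersOK X o (b.2 ++ v) := by
    intro l
    induction l with
    | nil => exact Iff.rfl
    | cons a l ih => rw [← ih]; exact Iff.rfl
  rw [← h (List.ofFn b.1), Block.word, List.cons_append, List.append_assoc]
  exact Iff.rfl

theorem answersOK_stepBlock {X : Set Word} {t : Word} {k j : ℕ}
    {σ w : Fin (k + 1) → Option Bool} {mv : Fin (k + 1) → SignType} {o r : Option Bool}
    (v : List Sym) :
    AnswersOK X t ((stepBlock j σ w mv o r).word ++ v) ↔ AnswersOK X (t ++ o.toList) v := by
  rw [answersOK_word, stepBlock]
  cases o <;> cases r <;>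
    simp [AnswersOK, answersOK_wts]

theorem outs_stepBlock {k j : ℕ} {σ w : Fin (k + 1) → Option Bool}
    {mv : Fin (k + 1) → SignType} {o r : Option Bool} :
    outs (stepBlock j σ w mv o r).word = r.toList := by
  rw [outs_word, stepBlock]
  cases o <;> cases r <;> simp [outs, outs_wts]

theorem answersOK_queryBlock {X : Set Word} {t : Word} {k j : ℕ} {σ : Fin (k + 1) → Option Bool}
    {a : Bool} (v : List Sym) :
    AnswersOK X t ((queryBlock j σ a).word ++ v) ↔ (t ∈ X ↔ a = true) ∧ AnswersOK X [] v := by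
  rw [answersOK_word, queryBlock, List.cons_append, AnswersOK, answersOK_wts]

theorem outs_queryBlock {k j : ℕ} {σ : Fin (k + 1) → Option Bool} {a : Bool} :
    outs (queryBlock j σ a).word = [] := by
  rw [outs_word, queryBlock]
  simp [outs, outs_wts]

namespace OracleTM

variable {M : OracleTM}

/-- The cells of tape `i` relative to the head. -/
def Cfg.cells (c : M.Cfg) (i : Fin (M.k + 1)) (z : ℤ) : Option Bool := c.tape i (c.head i + z)

/-- The scanned symbols. -/
def Cfg.scan (c : M.Cfg) (i : Fin (M.k + 1)) : Option Bool := c.tape i (c.head i)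

theorem Cfg.cells_zero (c : M.Cfg) (i : Fin (M.k + 1)) : c.cells i 0 = c.scan i := by
  simp [cells, scan]

theorem cells_next_of_step {X : Set Word} {c : M.Cfg} {q : M.State}
    {w : Fin (M.k + 1) → Option Bool} {mv : Fin (M.k + 1) → SignType} {o r : Option Bool}
    (h : instr c = Instr.step q w mv o r) (i : Fin (M.k + 1)) :
    (next X c).cells i = fun z => Function.update (c.cells i) 0 (w i) (z + (mv i : ℤ)) := by
  rw [next_of_step h]
  funext z
  simp only [Cfg.cells]
  by_cases hz : z + (mv i : ℤ) = 0
  · rw [hz, Function.update_self, show c.head i + (mv i : ℤ) + z = c.head i by linarith,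
      Function.update_self]
  · rw [Function.update_of_ne hz, Function.update_of_ne (by intro h'; apply hz; linarith)]
    congr 1
    ring

end OracleTM

open OracleTM

/-- The operation that does not change a tape. -/
theorem relOK_stay {D : ℤ → Option Bool} {σ : Option Bool} {ops : List TapeOp} (hσ : D 0 = σ) :
    RelOK D ((σ, σ, 0) :: ops) ↔ RelOK D ops := by
  rw [RelOK]
  have : (fun z => Function.update D 0 σ (z + ((0 : SignType) : ℤ))) = D := by
    funext z
    rw [← hσ, Function.update_eq_self]
    simp
  rw [this]
  simp [hσ]

/-- A correct sequence of blocks that begins at the configuration `c` describes the run from there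
on. -/
theorem BlockPath.run_sound {M : OracleTM} {X : Set Word} {j : ℕ} {B : List (Block M.k)} :
    ∀ {q : M.State}, BlockPath M j (.run q) B → ∀ c : M.Cfg, c.state = q →
    (∀ i, RelOK (c.cells i) (B.map fun b => b.1 i)) → AnswersOK X c.oracleTape (blocksWord B) →
    ∃ m b, m + 1 = B.length ∧ instr ((next X)^[m] c) = .halt b ∧
      ((next X)^[m] c).output = c.output ++ outs (blocksWord B) := by
  induction B with
  | nil => intro q h; cases h
  | cons b B ih =>
    intro q h c hc htape hans
    cases h with | cons hb hB => ?_
    rw [blocksWord_cons] at hans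
    -- the block is about the symbols scanned in `c`
    have hscan : ∀ {σ : Fin (M.k + 1) → Option Bool}, (∀ i, (b.1 i).1 = σ i) → c.scan = σ := by
      intro σ hσ
      funext i
      have := (htape i).1
      rw [Cfg.cells_zero] at this
      rw [this, ← hσ i]
    have hinstr : instr c = M.δ q c.scan := by rw [← hc]; rfl
    cases hb with
    | step hδ =>
      rename_i σ q' w mv o r
      rw [← hscan (σ := σ) (fun i => rfl), ← hinstr] at hδ
      obtain ⟨m, b', hm, h1, h2⟩ := ih hB (next X c) (by rw [next_of_step hδ]) (fun i => by
        rw [cells_next_of_step hδ]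
        exact (htape i).2) (by
        rw [next_of_step hδ]
        exact (answersOK_stepBlock _).1 hans)
      refine ⟨m + 1, b', by rw [List.length_cons, hm], by rwa [Function.iterate_succ_apply], ?_⟩
      rw [Function.iterate_succ_apply, h2, blocksWord_cons, outs_append, outs_stepBlock,
        next_of_step hδ, List.append_assoc]
    | query a hδ =>
      rename_i σ y n
      rw [← hscan (σ := σ) (fun i => rfl), ← hinstr] at hδ
      obtain ⟨ha, hans⟩ := (answersOK_queryBlock _).1 hans
      have hnext : next X c = { c with state := cond a y n, oracleTape := [] } := by
        cases a
        · exact next_of_query_notMem hδ (by simpa using ha)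
        · exact next_of_query_mem hδ (by simpa using ha)
      obtain ⟨m, b', hm, h1, h2⟩ := ih hB (next X c) (by rw [hnext]) (fun i => by
        rw [hnext]
        exact (relOK_stay (htape i).1).1 (htape i)) (by
        rw [hnext]
        exact hans)
      refine ⟨m + 1, b', by rw [List.length_cons, hm], by rwa [Function.iterate_succ_apply], ?_⟩
      rw [Function.iterate_succ_apply, h2, blocksWord_cons, outs_append, outs_queryBlock, hnext,
        List.nil_append]
    | halt hδ =>
      rename_i σ b'
      rw [← hscan (σ := σ) (fun i => rfl), ← hinstr] at hδ
      have hB' : B = [] := hB.weight.1 rfl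
      subst hB'
      refine ⟨0, b', rfl, hδ, ?_⟩
      rw [blocksWord_cons, outs_append, outs_word]
      simp [haltBlock, outs_wts, blocksWord, outs]

/-- The cells of a tape with the word `y` on the right of the head. -/
def wordCells (y : Word) (z : ℤ) : Option Bool := if 0 < z then y[(z - 1).toNat]? else none

theorem relOK_loadBlock {k j : ℕ} (a : Bool) (y : Word) (i : Fin (k + 1)) (ops : List TapeOp) :
    RelOK (if i = 0 then wordCells y else fun _ => none) ((loadBlock k j a).1 i :: ops) ↔
      RelOK (if i = 0 then wordCells (a :: y) else fun _ => none) ops := by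
  by_cases h0 : i = 0
  · subst h0
    have h1 : (fun z => Function.update (wordCells y) 0 (some a) (z + -1)) =
        wordCells (a :: y) := by
      funext z
      rcases lt_trichotomy z 1 with hz | rfl | hz
      · rw [Function.update_of_ne (by omega), wordCells, wordCells, if_neg (by omega),
          if_neg (by omega)]
      · rfl
      · rw [Function.update_of_ne (by omega), wordCells, wordCells, if_pos (by omega),
          if_pos (by omega), show (z - 1).toNat = (z + -1 - 1).toNat + 1 by omega,
          List.getElem?_cons_succ]
    change wordCells y 0 = none ∧
      RelOK (fun z => Function.update (wordCells y) 0 (some a) (z + -1)) ops ↔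
        RelOK (wordCells (a :: y)) ops
    rw [h1]
    exact and_iff_right rfl
  · have hb : (loadBlock k j a).1 i = (none, none, 0) := by simp [loadBlock, h0]
    rw [hb, if_neg h0, if_neg h0]
    exact relOK_stay rfl

theorem relOK_startBlock (M : OracleTM) (j : ℕ) (y : Word) (i : Fin (M.k + 1))
    (ops : List TapeOp) :
    RelOK (if i = 0 then wordCells y else fun _ => none) ((startBlock M.k j).1 i :: ops) ↔
      RelOK ((M.init y).cells i) ops := by
  by_cases h0 : i = 0
  · subst h0
    have h1 : (fun z => Function.update (wordCells y) 0 none (z + 1)) = (M.init y).cells 0 := by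
      funext z
      change _ = if (0 : Fin (M.k + 1)) = 0 ∧ 0 ≤ 0 + z then y[(0 + z).toNat]? else none
      rcases lt_trichotomy z (-1) with hz | rfl | hz
      · rw [Function.update_of_ne (by omega), wordCells, if_neg (by omega), if_neg (by omega)]
      · rfl
      · rw [Function.update_of_ne (by omega), wordCells, if_pos (by omega),
          if_pos ⟨rfl, by omega⟩]
        congr 2
        omega
    change wordCells y 0 = none ∧
      RelOK (fun z => Function.update (wordCells y) 0 none (z + 1)) ops ↔ _
    rw [h1]
    exact and_iff_right rfl
  · have hb : (startBlock M.k j).1 i = (none, none, 0) := by simp [startBlock, h0]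
    have h1 : (M.init y).cells i = fun _ => none := by
      funext z
      exact if_neg fun h => h0 h.1
    rw [hb, if_neg h0, h1]
    exact relOK_stay rfl

/-- A correct sequence of blocks from the beginning on describes the run on some input. -/
theorem BlockPath.sound {M : OracleTM} {X : Set Word} {j : ℕ} {B : List (Block M.k)}
    (h : BlockPath M j .load B) (y : Word)
    (htape : ∀ i, RelOK (if i = 0 then wordCells y else fun _ => none) (B.map fun b => b.1 i))
    (hans : AnswersOK X [] (blocksWord B)) :
    ∃ x m b, x.length + m + 2 = y.length + B.length ∧ M.HaltsWithin X x m b ∧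
      (M.cfgAt X x m).output = outs (blocksWord B) := by
  induction B generalizing y with
  | nil => cases h
  | cons b B ih =>
    cases h with | cons hb hB => ?_
    rw [blocksWord_cons] at hans ⊢
    cases hb with
    | load a =>
      have hans' : AnswersOK X [] (blocksWord B) := by
        rw [answersOK_word, loadBlock, answersOK_wts] at hans
        exact hans
      obtain ⟨x, m, b, h1, h2, h3⟩ :=
        ih hB (a :: y) (fun i => (relOK_loadBlock a y i _).1 (htape i)) hans'
      refine ⟨x, m, b, by simp only [List.length_cons] at h1 ⊢; omega, h2, ?_⟩
      rw [h3, outs_append, outs_word, loadBlock, outs_wts, List.nil_append]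
    | start =>
      have hans' : AnswersOK X [] (blocksWord B) := by
        rw [answersOK_word, startBlock, answersOK_wts] at hans
        exact hans
      obtain ⟨m, b, hm, h1, h2⟩ := hB.run_sound (X := X) (M.init y) rfl
        (fun i => (relOK_startBlock M j y i _).1 (htape i)) hans'
      refine ⟨y, m, b, by rw [List.length_cons]; omega, h1, ?_⟩
      rw [outs_append, outs_word, startBlock, outs_wts]
      exact h2

/-- A block has at least as many letters as the machine has tapes. -/
theorem le_length_blocksWord {k : ℕ} {B : List (Block k)} (h : B ≠ []) :
    k + 1 ≤ (blocksWord B).length := by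
  rcases B with _ | ⟨b, B⟩
  · exact absurd rfl h
  · rw [blocksWord_cons, Block.word]
    simp
    omega

/-- A trace that passes all checks but the last one describes a run of some machine; its weight
determines the index of the machine and the number of steps. -/
theorem exists_run_of_checks {X : Set Word} (hX : KnowsAutomaton X) {v : List Sym}
    (h1 : PathOK X Sym.init.code 0 v) (h2 : AnswersOK X [] v) (h3 : TapesOK v.length v) :
    ∃ j T y m b, weight v = 2 ^ j * (2 * T + 1) ∧ y.length + m + 1 = T ∧
      (machOf j).HaltsWithin X y m b ∧ ((machOf j).cfgAt X y m).output = outs v := by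
  obtain ⟨j, B, hB, hv⟩ := h1.exists_blockPath hX
  obtain ⟨T, hT, hw⟩ := hB.weight.2 (by simp)
  rw [← answersOK_core, hv] at h2
  rw [← tapesOK_core, hv] at h3
  have hlen : (machOf j).k + 1 ≤ v.length := by
    refine le_trans ?_ (length_core_le v)
    rw [hv]
    exact le_length_blocksWord fun h => by simp [h] at hT
  obtain ⟨y, m, b, h4, h5, h6⟩ := hB.sound [] (fun i => by
    have := (hB.tapesOK_iff hlen).1 h3 i
    convert this using 1
    split_ifs
    · funext z
      simp [wordCells]
    · rfl) h2
  refine ⟨j, T, y, m, b, by rw [← hw, ← hv, weight_core], ?_, h5, ?_⟩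
  · simp only [List.length_nil] at h4
    omega
  · rw [h6, ← hv, outs_core]

/-! ### Runs have correct traces -/

/-- The blocks of the trace that begins at the configuration `c`, each with the control state after
it. -/
inductive Traced {M : OracleTM} (X : Set Word) (j : ℕ) :
    M.Cfg → List (Block M.k × TState M) → Prop
  | halt {c b} : OracleTM.instr c = .halt b → Traced X j c [(haltBlock j c.scan, .done)]
  | step {c q w mv o r B} : OracleTM.instr c = .step q w mv o r →
      Traced X j (OracleTM.next X c) B → Traced X j c ((stepBlock j c.scan w mv o r, .run q) :: B)
  | query {c y n B} (a : Bool) : OracleTM.instr c = .query y n → (c.oracleTape ∈ X ↔ a = true) →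
      Traced X j (OracleTM.next X c) B →
      Traced X j c ((queryBlock j c.scan a, .run (cond a y n)) :: B)

/-- Like `BlockPath`, with the control state after each block in the list. -/
inductive BlockChain (M : OracleTM) (j : ℕ) :
    TState M → List (Block M.k × TState M) → Prop
  | done : BlockChain M j .done []
  | cons {s b s' B} : BlockStep M j s b s' → BlockChain M j s' B → BlockChain M j s ((b, s') :: B)

namespace Traced

variable {M : OracleTM} {X : Set Word} {j : ℕ} {c : M.Cfg} {B : List (Block M.k × TState M)}

theorem next_of_answer {c : M.Cfg} {y n : M.State} {a : Bool}
    (hc : OracleTM.instr c = .query y n) (ha : c.oracleTape ∈ X ↔ a = true) :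
    OracleTM.next X c = { c with state := cond a y n, oracleTape := [] } := by
  cases a
  · exact OracleTM.next_of_query_notMem hc (by simpa using ha)
  · exact OracleTM.next_of_query_mem hc (by simpa using ha)

/-- Every halting run has a trace. -/
theorem exists_of_halts (j : ℕ) (n : ℕ) : ∀ (c : M.Cfg) (b : Bool),
    OracleTM.instr ((OracleTM.next X)^[n] c) = .halt b →
    ∃ m ≤ n, ∃ b B, OracleTM.instr ((OracleTM.next X)^[m] c) = .halt b ∧ B.length = m + 1 ∧
      Traced X j c B := by
  induction n with
  | zero => exact fun c b h => ⟨0, le_rfl, b, _, h, rfl, .halt h⟩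
  | succ n ih =>
    intro c b h
    rw [Function.iterate_succ_apply] at h
    obtain ⟨m, hm, b', B, h1, h2, h3⟩ := ih _ _ h
    rcases hc : OracleTM.instr c with b'' | ⟨y, z⟩ | ⟨q, w, mv, o, r⟩
    · exact ⟨0, by omega, b'', _, hc, rfl, .halt hc⟩
    · by_cases ho : c.oracleTape ∈ X
      · exact ⟨m + 1, by omega, b', _, h1, by rw [List.length_cons, h2],
          .query true hc (by simp [ho]) h3⟩
      · exact ⟨m + 1, by omega, b', _, h1, by rw [List.length_cons, h2],
          .query false hc (by simp [ho]) h3⟩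
    · exact ⟨m + 1, by omega, b', _, h1, by rw [List.length_cons, h2], .step hc h3⟩

theorem relOK (h : Traced X j c B) (i : Fin (M.k + 1)) :
    RelOK (c.cells i) (B.map fun b => b.1.1 i) := by
  induction h with
  | halt hc => exact ⟨OracleTM.Cfg.cells_zero _ _, trivial⟩
  | step hc _ ih =>
    rw [OracleTM.cells_next_of_step hc] at ih
    exact ⟨OracleTM.Cfg.cells_zero _ _, ih⟩
  | query a hc ha _ ih =>
    rw [next_of_answer hc ha] at ih
    exact (relOK_stay (OracleTM.Cfg.cells_zero _ _)).2 ih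

theorem answersOK (h : Traced X j c B) :
    AnswersOK X c.oracleTape (blocksWord (B.map Prod.fst)) := by
  induction h with
  | halt hc =>
    rw [List.map_cons, blocksWord_cons, answersOK_word, haltBlock, answersOK_wts]
    trivial
  | step hc _ ih =>
    rw [OracleTM.next_of_step hc] at ih
    exact (answersOK_stepBlock _).2 ih
  | query a hc ha _ ih =>
    rw [next_of_answer hc ha] at ih
    exact (answersOK_queryBlock _).2 ⟨ha, ih⟩

theorem blockChain (h : Traced X j c B) : BlockChain M j (.run c.state) B := by
  induction h with
  | halt hc => exact .cons (.halt hc) .done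
  | step hc _ ih =>
    rw [OracleTM.next_of_step hc] at ih
    exact .cons (.step hc) ih
  | query a hc ha _ ih =>
    rw [next_of_answer hc ha] at ih
    exact .cons (.query a hc) ih

end Traced

theorem BlockChain.blockPath {M : OracleTM} {j : ℕ} {s : TState M}
    {B : List (Block M.k × TState M)} (h : BlockChain M j s B) :
    BlockPath M j s (B.map Prod.fst) := by
  induction h with
  | done => exact .done
  | cons hb _ ih => exact .cons hb ih

/-- The blocks of the trace of a run on the input `y`, if `B` are the blocks from the start
configuration on. -/
def inputBlocks (M : OracleTM) (j : ℕ) (y : Word) (B : List (Block M.k × TState M)) :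
    List (Block M.k × TState M) :=
  (y.reverse.map fun b => (loadBlock M.k j b, .load)) ++ (startBlock M.k j, .run M.start) :: B

theorem blockChain_inputBlocks {M : OracleTM} {j : ℕ} (y : Word)
    {B : List (Block M.k × TState M)} (h : BlockChain M j (.run M.start) B) :
    BlockChain M j .load (inputBlocks M j y B) := by
  unfold inputBlocks
  induction y.reverse with
  | nil => exact .cons .start h
  | cons b l ih => exact .cons (.load b) ih

theorem relOK_inputBlocks {M : OracleTM} {j : ℕ} (i : Fin (M.k + 1)) (y s : Word)
    {B : List (Block M.k × TState M)}
    (h : RelOK ((M.init (y ++ s)).cells i) (B.map fun b => b.1.1 i)) :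
    RelOK (if i = 0 then wordCells s else fun _ => none)
      ((inputBlocks M j y B).map fun b => b.1.1 i) := by
  induction y using List.reverseRecOn generalizing s with
  | nil => exact (relOK_startBlock M j s i _).2 h
  | append_singleton y a ih =>
    rw [List.append_assoc] at h
    have := (relOK_loadBlock (j := j) a s i _).2 (ih _ h)
    rw [inputBlocks, List.reverse_append]
    exact this

theorem answersOK_inputBlocks {M : OracleTM} {X : Set Word} {j : ℕ} (y : Word)
    {B : List (Block M.k × TState M)} (h : AnswersOK X [] (blocksWord (B.map Prod.fst))) :
    AnswersOK X [] (blocksWord ((inputBlocks M j y B).map Prod.fst)) := by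
  unfold inputBlocks
  induction y.reverse with
  | nil =>
    rw [List.map_nil, List.nil_append, List.map_cons, blocksWord_cons, answersOK_word, startBlock,
      answersOK_wts]
    exact h
  | cons b l ih =>
    rw [List.map_cons, List.cons_append, List.map_cons, blocksWord_cons, answersOK_word, loadBlock,
      answersOK_wts]
    exact ih

theorem outs_inputBlocks {M : OracleTM} {j : ℕ} (y : Word) (B : List (Block M.k × TState M)) :
    outs (blocksWord ((inputBlocks M j y B).map Prod.fst)) =
      outs (blocksWord (B.map Prod.fst)) := by
  unfold inputBlocks
  induction y.reverse with
  | nil =>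
    rw [List.map_nil, List.nil_append, List.map_cons, blocksWord_cons, outs_append, outs_word,
      startBlock, outs_wts, List.nil_append]
  | cons b l ih =>
    rw [List.map_cons, List.cons_append, List.map_cons, blocksWord_cons, outs_append, outs_word,
      loadBlock, outs_wts, List.nil_append, ih]

/-! ### Units are inserted -/

/-- The letters of a word, each with the number of the node that follows it. -/
noncomputable def withUnits {j : ℕ} (s : TState (machOf j)) : List Sym → List Sym
  | [] => []
  | a :: u => a :: (List.replicate (nodeNum ⟨j, u, s⟩) .unit ++ withUnits s u)

/-- The letters of a sequence of blocks, with units. -/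
noncomputable def blocksUnits {j : ℕ} (B : List (Block (machOf j).k × TState (machOf j))) :
    List Sym :=
  B.flatMap fun b => withUnits b.2 b.1.word

/-- Like `NPath`, for words with units. -/
inductive UPath : Node → List Sym → Prop
  | done (j) : UPath ⟨j, [], .done⟩ []
  | cons {N a N' v} : NStep N a N' → a ≠ .unit → UPath N' v →
      UPath N (a :: (List.replicate (nodeNum N') .unit ++ v))

theorem UPath.word {j : ℕ} {s : TState (machOf j)} {v : List Sym} (h : UPath ⟨j, [], s⟩ v)
    {u : List Sym} (hu : ∀ a ∈ u, a ≠ .unit) : UPath ⟨j, u, s⟩ (withUnits s u ++ v) := by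
  induction u with
  | nil => exact h
  | cons a u ih =>
    have := UPath.cons (.next (j := j) (s := s)) (hu a List.mem_cons_self)
      (ih fun b hb => hu b (List.mem_cons_of_mem _ hb))
    rwa [← List.append_assoc] at this

theorem UPath.block {j : ℕ} {s s' : TState (machOf j)} {b : Block (machOf j).k} {v : List Sym}
    (hb : BlockStep (machOf j) j s b s') (h : UPath ⟨j, [], s'⟩ v) :
    UPath ⟨j, [], s⟩ (withUnits s' b.word ++ v) := by
  obtain ⟨u, hu⟩ : ∃ u, b.word = .blk :: u := ⟨_, rfl⟩
  have hne := hb.ne_unit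
  rw [hu] at hne ⊢
  have := UPath.cons (.enter hb hu) (hne _ List.mem_cons_self)
    (h.word fun a ha => hne a (List.mem_cons_of_mem _ ha))
  rwa [← List.append_assoc] at this

theorem BlockChain.uPath {j : ℕ} {s : TState (machOf j)}
    {B : List (Block (machOf j).k × TState (machOf j))} (h : BlockChain (machOf j) j s B) :
    UPath ⟨j, [], s⟩ (blocksUnits B) := by
  induction h with
  | done => exact .done j
  | cons hb _ ih => exact .block hb ih

theorem pathOK_units (X : Set Word) (p c n : ℕ) (v : List Sym) :
    PathOK X p c (List.replicate n .unit ++ v) ↔ PathOK X p (c + n) v := by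
  induction n generalizing c with
  | zero => exact Iff.rfl
  | succ n ih =>
    rw [show c + (n + 1) = c + 1 + n by omega, ← ih]
    exact Iff.rfl

theorem UPath.pathOK {X : Set Word} (hX : KnowsAutomaton X) {N : Node} {v : List Sym}
    (h : UPath N v) {p : ℕ} (hp : EdgeBit X (p + 2 * nodeNum N)) :
    PathOK X p 0 (List.replicate (nodeNum N) .unit ++ v) := by
  induction h generalizing p with
  | done j =>
    rw [pathOK_units, zero_add]
    exact ⟨hp, (hX.node _).2 ⟨_, rfl⟩, (hX.edge _).2 (.inr (.inr ⟨j, rfl⟩))⟩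
  | @cons N a N' v hs ha _ ih =>
    rw [pathOK_units, zero_add, pathOK_cons ha]
    exact ⟨hp, (hX.node _).2 ⟨_, rfl⟩, ih ((hX.edge _).2 (.inl ⟨N, a, N', hs, rfl⟩))⟩

theorem core_units (n : ℕ) (v : List Sym) : core (List.replicate n .unit ++ v) = core v := by
  induction n with
  | zero => rfl
  | succ n ih => rw [← ih]; rfl

theorem core_withUnits {j : ℕ} (s : TState (machOf j)) {u : List Sym} (hu : ∀ a ∈ u, a ≠ .unit)
    (v : List Sym) : core (withUnits s u ++ v) = u ++ core v := by
  induction u with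
  | nil => rfl
  | cons a u ih =>
    rw [withUnits, List.cons_append, core_cons (hu a List.mem_cons_self), List.append_assoc,
      core_units, ih fun b hb => hu b (List.mem_cons_of_mem _ hb), List.cons_append]

theorem BlockChain.core_blocksUnits {j : ℕ} {s : TState (machOf j)}
    {B : List (Block (machOf j).k × TState (machOf j))} (h : BlockChain (machOf j) j s B) :
    core (blocksUnits B) = blocksWord (B.map Prod.fst) := by
  induction h with
  | done => rfl
  | cons hb _ ih =>
    rw [List.map_cons, blocksWord_cons, ← ih, ← core_withUnits _ hb.ne_unit]
    rfl

/-- The trace with units; before the first block there is the number of the initial node. -/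
noncomputable def fullTrace {j : ℕ} (B : List (Block (machOf j).k × TState (machOf j))) :
    List Sym :=
  List.replicate (nodeNum ⟨j, [], .load⟩) .unit ++ blocksUnits B

/-- The trace of a halting run passes the checks and proves the output of the run. -/
theorem verify_fullTrace {X : Set Word} (hX : KnowsAutomaton X) {j i d : ℕ}
    (hcert : ∀ T, zeros (Prog.certLength i d (2 ^ j * (2 * T + 1))) ∈ X) (w₀ y : Word)
    {B : List (Block (machOf j).k × TState (machOf j))}
    (hB : Traced X j ((machOf j).init y) B) {m : ℕ} {b : Bool}
    (hm : (machOf j).HaltsWithin X y m b) :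
    verify X i d w₀ (flat (fullTrace (inputBlocks (machOf j) j y B))) =
      ((machOf j).cfgAt X y m).output := by
  set C := inputBlocks (machOf j) j y B with hC
  have hchain : BlockChain (machOf j) j .load C := blockChain_inputBlocks y hB.blockChain
  have hpath : PathOK X Sym.init.code 0 (fullTrace C) :=
    hchain.uPath.pathOK hX ((hX.edge _).2 (.inr (.inl ⟨j, rfl⟩)))
  have hcore : core (fullTrace C) = blocksWord (C.map Prod.fst) := by
    rw [fullTrace, core_units, hchain.core_blocksUnits]
  have hne : C.map Prod.fst ≠ [] := by simp [hC, inputBlocks]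
  have hans : AnswersOK X [] (fullTrace C) := by
    rw [← answersOK_core, hcore]
    exact answersOK_inputBlocks y hB.answersOK
  have hlen : (machOf j).k + 1 ≤ (fullTrace C).length :=
    (le_length_blocksWord hne).trans (hcore ▸ length_core_le _)
  have htapes : TapesOK (fullTrace C).length (fullTrace C) := by
    rw [← tapesOK_core, hcore, hchain.blockPath.tapesOK_iff hlen]
    intro i
    have := relOK_inputBlocks (j := j) i y [] (B := B) (by simpa using hB.relOK i)
    have h0 : (fun _ => none) = if i = 0 then wordCells [] else fun _ => none := by
      split_ifs
      · funext z
        simp [wordCells]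
      · rfl
    rw [List.map_map, h0]
    exact this
  obtain ⟨T, -, hw⟩ := hchain.blockPath.weight.2 (by simp)
  rw [← hcore, weight_core] at hw
  rw [verify, parse_flat, if_pos ⟨hpath, hans, by rw [hw]; exact hcert T, htapes⟩]
  obtain ⟨m', b', -, h5, h6⟩ := hB.blockChain.blockPath.run_sound _ rfl
    (fun i => by rw [List.map_map]; exact hB.relOK i) hB.answersOK
  have h5 : (machOf j).HaltsWithin X y m' b' := h5
  rw [← outs_core, hcore, outs_inputBlocks, hm.cfgAt_eq_cfgAt h5]
  exact h6.symm

/-! ### A machine that writes the trace of another machine -/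

/-- What the trace writer does: move right over the input, move left over the input while writing
it into the trace, run the machine, end. -/
inductive Phase (M : OracleTM) : Type
  | right
  | left
  | run (q : M.State)
  | finished

instance (M : OracleTM) : Finite (Phase M) := by
  have := M.finite_state
  let φ : Phase M → Option (Option (Option M.State))
    | .right => none
    | .left => some none
    | .finished => some (some none)
    | .run q => some (some (some q))
  refine Finite.of_injective φ ?_
  intro a b h
  cases a <;> cases b <;> simp_all [φ]

/-- The bits of a block with units. -/
noncomputable def blockBits {j : ℕ} (b : Block (machOf j).k × TState (machOf j)) : List Bool :=
  flat (withUnits b.2 b.1.word)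

/-- The bits that are written for a move of the trace writer; `a` is the answer of the oracle if
there is a query. -/
noncomputable def emission (j : ℕ) :
    Phase (machOf j) → (Fin ((machOf j).k + 1) → Option Bool) → Bool → List Bool
  | .left, σ, _ =>
      match σ 0 with
      | some b => blockBits (loadBlock (machOf j).k j b, .load)
      | none => blockBits (startBlock (machOf j).k j, .run (machOf j).start)
  | .run q, σ, a =>
      match (machOf j).δ q σ with
      | .halt _ => blockBits (haltBlock j σ, .done)
      | .query y n => blockBits (queryBlock j σ a, .run (cond a y n))
      | .step q' w mv o r => blockBits (stepBlock j σ w mv o r, .run q')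
  | _, _, _ => []

/-- The bits at the beginning of a trace. -/
noncomputable def prelude (j : ℕ) : List Bool :=
  flat (List.replicate (nodeNum ⟨j, [], .load⟩) .unit)

theorem exists_emission_bound (j : ℕ) : ∃ N, (prelude j).length ≤ N ∧
    ∀ p σ a, (emission j p σ a).length ≤ N := by
  obtain ⟨N, hN⟩ := (Set.finite_range fun x : Phase (machOf j) ×
    (Fin ((machOf j).k + 1) → Option Bool) × Bool => (emission j x.1 x.2.1 x.2.2).length).bddAbove
  refine ⟨max N (prelude j).length, le_max_right _ _, fun p σ a => ?_⟩
  exact le_max_of_le_left (hN ⟨(p, σ, a), rfl⟩)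

/-- A bound for the number of bits that are written for one move. -/
noncomputable def emissionBound (j : ℕ) : ℕ := (exists_emission_bound j).choose

theorem length_prelude_le (j : ℕ) : (prelude j).length ≤ emissionBound j :=
  (exists_emission_bound j).choose_spec.1

theorem length_emission_le (j : ℕ) (p : Phase (machOf j))
    (σ : Fin ((machOf j).k + 1) → Option Bool) (a : Bool) :
    (emission j p σ a).length ≤ emissionBound j :=
  (exists_emission_bound j).choose_spec.2 p σ a

/-- Bits that are still to be written. -/
abbrev Pending (j : ℕ) : Type := {l : List Bool // l.length ≤ emissionBound j}

instance (j : ℕ) : Finite (Pending j) := (List.finite_length_le Bool (emissionBound j)).to_subtype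

/-- Move the head on tape `0`. -/
def moveZero {k : ℕ} (m : SignType) (i : Fin (k + 1)) : SignType := if i = 0 then m else 0

/-- The trace writer for the machine with index `j`. -/
noncomputable def traceWriter (j : ℕ) : OracleTM where
  State := Phase (machOf j) × Pending j
  finite_state := inferInstance
  k := (machOf j).k
  start := (.right, ⟨prelude j, length_prelude_le j⟩)
  δ := fun s σ =>
    let e : Bool → Pending j := fun a => ⟨emission j s.1 σ a, length_emission_le j s.1 σ a⟩
    match s.2 with
    | ⟨b :: l, h⟩ => .step (s.1, ⟨l, (Nat.le_succ _).trans h⟩) σ 0 none (some b)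
    | ⟨[], _⟩ =>
      match s.1 with
      | .right =>
        match σ 0 with
        | some _ => .step (.right, e false) σ (moveZero 1) none none
        | none => .step (.left, e false) σ (moveZero (-1)) none none
      | .left =>
        match σ 0 with
        | some _ => .step (.left, e false) σ (moveZero (-1)) none none
        | none => .step (.run (machOf j).start, e false) σ (moveZero 1) none none
      | .run q =>
        match (machOf j).δ q σ with
        | .halt _ => .step (.finished, e false) σ 0 none none
        | .query y n => .query (.run y, e true) (.run n, e false)
        | .step q' w mv o _ => .step (.run q', e false) w mv o none
      | .finished => .halt true

/-- A configuration of the trace writer. -/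
def writerCfg {j : ℕ} (p : Phase (machOf j)) (l : Pending j)
    (h : Fin ((machOf j).k + 1) → ℤ) (t : Fin ((machOf j).k + 1) → ℤ → Option Bool) (o w : Word) :
    (traceWriter j).Cfg :=
  ⟨(p, l), h, t, o, w⟩

/-- The configuration `c'` is reached from `c` in at most `T` steps. -/
def Reaches {M : OracleTM} (X : Set Word) (c c' : M.Cfg) (T : ℕ) : Prop :=
  ∃ n ≤ T, (OracleTM.next X)^[n] c = c'

theorem Reaches.trans {M : OracleTM} {X : Set Word} {c c' c'' : M.Cfg} {T T' : ℕ}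
    (h : Reaches X c c' T) (h' : Reaches X c' c'' T') : Reaches X c c'' (T + T') := by
  obtain ⟨n, hn, rfl⟩ := h
  obtain ⟨n', hn', rfl⟩ := h'
  exact ⟨n' + n, by omega, Function.iterate_add_apply _ _ _ _⟩

theorem Reaches.refl {M : OracleTM} {X : Set Word} (c : M.Cfg) : Reaches X c c 0 :=
  ⟨0, le_rfl, rfl⟩

theorem Reaches.mono {M : OracleTM} {X : Set Word} {c c' : M.Cfg} {T T' : ℕ}
    (h : Reaches X c c' T) (hT : T ≤ T') : Reaches X c c' T' := by
  obtain ⟨n, hn, h⟩ := h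
  exact ⟨n, hn.trans hT, h⟩

section

variable {X : Set Word} {j : ℕ} {h : Fin ((machOf j).k + 1) → ℤ}
  {t : Fin ((machOf j).k + 1) → ℤ → Option Bool} {o w : Word}

theorem next_writerCfg {p p' : Phase (machOf j)} {l l' : Pending j}
    {w' : Fin ((machOf j).k + 1) → Option Bool} {mv : Fin ((machOf j).k + 1) → SignType}
    {o' r : Option Bool}
    (hi : (OracleTM.instr (writerCfg p l h t o w) : Instr (Phase (machOf j) × Pending j) _) =
      .step (p', l') w' mv o' r) :
    OracleTM.next X (writerCfg p l h t o w) =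
      writerCfg p' l' (fun i => h i + (mv i : ℤ)) (fun i => Function.update (t i) (h i) (w' i))
        (o ++ o'.toList) (w ++ r.toList) :=
  OracleTM.next_of_step (M := traceWriter j) hi

theorem update_scan (h : Fin ((machOf j).k + 1) → ℤ)
    (t : Fin ((machOf j).k + 1) → ℤ → Option Bool) :
    (fun i => Function.update (t i) (h i) (t i (h i))) = t := by
  funext i
  exact Function.update_eq_self _ _

theorem reaches_pending (p : Phase (machOf j)) (l : List Bool) :
    ∀ (hl : l.length ≤ emissionBound j) (w : Word),
    Reaches X (writerCfg p ⟨l, hl⟩ h t o w) (writerCfg p ⟨[], Nat.zero_le _⟩ h t o (w ++ l))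
      l.length := by
  induction l with
  | nil => intro hl w; rw [List.append_nil]; exact .refl _
  | cons b l ih =>
    intro hl w
    have h1 : Reaches X (writerCfg p ⟨b :: l, hl⟩ h t o w)
        (writerCfg p ⟨l, (Nat.le_succ _).trans hl⟩ h t o (w ++ [b])) 1 := by
      refine ⟨1, le_rfl, ?_⟩
      rw [Function.iterate_one, next_writerCfg (p' := p) (l' := ⟨l, (Nat.le_succ _).trans hl⟩)
        (w' := fun i => t i (h i)) (mv := 0) (o' := none) (r := some b) rfl, update_scan]
      simp
    have h2 := h1.trans (ih ((Nat.le_succ _).trans hl) (w ++ [b]))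
    rw [List.append_assoc] at h2
    exact h2.mono (by simp; omega)

/-- A move with the bits that are written for it. -/
theorem reaches_of_next {p p' : Phase (machOf j)} {a : Bool}
    {h' : Fin ((machOf j).k + 1) → ℤ} {t' : Fin ((machOf j).k + 1) → ℤ → Option Bool} {o' : Word}
    {l : List Bool} (hl : emission j p (fun i => t i (h i)) a = l)
    (hn : OracleTM.next X (writerCfg p ⟨[], Nat.zero_le _⟩ h t o w) =
      writerCfg p' ⟨emission j p (fun i => t i (h i)) a, length_emission_le _ _ _ _⟩ h' t' o' w) :
    Reaches X (writerCfg p ⟨[], Nat.zero_le _⟩ h t o w)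
      (writerCfg p' ⟨[], Nat.zero_le _⟩ h' t' o' (w ++ l)) (emissionBound j + 1) := by
  subst hl
  have h1 : Reaches X (writerCfg p ⟨[], Nat.zero_le _⟩ h t o w) _ 1 := ⟨1, le_rfl, hn⟩
  refine (h1.trans (reaches_pending p' _ (length_emission_le _ _ _ _) w)).mono ?_
  have := length_emission_le j p (fun i => t i (h i)) a
  omega

/-- A move that neither writes on the tapes nor asks a query. -/
theorem reaches_of_move {p p' : Phase (machOf j)} {mv : Fin ((machOf j).k + 1) → SignType}
    {l : List Bool} (hl : emission j p (fun i => t i (h i)) false = l)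
    (hi : (OracleTM.instr (writerCfg p ⟨[], Nat.zero_le _⟩ h t o w) :
        Instr (Phase (machOf j) × Pending j) _) =
      .step (p', ⟨emission j p (fun i => t i (h i)) false, length_emission_le _ _ _ _⟩)
        (fun i => t i (h i)) mv none none) :
    Reaches X (writerCfg p ⟨[], Nat.zero_le _⟩ h t o w)
      (writerCfg p' ⟨[], Nat.zero_le _⟩ (fun i => h i + (mv i : ℤ)) t o (w ++ l))
      (emissionBound j + 1) := by
  refine reaches_of_next hl ?_
  rw [next_writerCfg hi, update_scan]
  simp

end

/-- The trace writer writes the trace of a run. -/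
theorem Traced.reaches {X : Set Word} {j : ℕ} {c : (machOf j).Cfg}
    {B : List (Block (machOf j).k × TState (machOf j))} (hB : Traced X j c B) (w : Word) :
    ∃ h t o, Reaches X (writerCfg (.run c.state) ⟨[], Nat.zero_le _⟩ c.head c.tape c.oracleTape w)
      (writerCfg .finished ⟨[], Nat.zero_le _⟩ h t o (w ++ flat (blocksUnits B)))
      ((emissionBound j + 1) * B.length) := by
  have hflat : ∀ (b : Block (machOf j).k × TState (machOf j)) B,
      flat (blocksUnits (b :: B)) = blockBits b ++ flat (blocksUnits B) := by
    intro b B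
    simp [blocksUnits, flat, blockBits]
  induction hB generalizing w with
  | @halt c b hc =>
    have hδ : (machOf j).δ c.state (fun i => c.tape i (c.head i)) = .halt b := hc
    refine ⟨_, _, _, (reaches_of_move (mv := 0) ?_ ?_).mono (by simp)⟩
    · simp only [emission, hδ]
      rw [hflat]
      simp [blocksUnits, flat]
      rfl
    · simp only [OracleTM.instr, writerCfg, traceWriter, hδ]
  | @step c q w' mv o r B hc _ ih =>
    have hδ : (machOf j).δ c.state (fun i => c.tape i (c.head i)) = .step q w' mv o r := hc
    rw [OracleTM.next_of_step hc] at ih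
    obtain ⟨h, t, o', hr⟩ := ih (w ++ blockBits (stepBlock j c.scan w' mv o r, .run q))
    refine ⟨h, t, o', ?_⟩
    rw [hflat, ← List.append_assoc, List.length_cons, mul_add, mul_one, add_comm]
    refine Reaches.trans (reaches_of_next (a := false) ?_ ?_) hr
    · simp only [emission, hδ]
      rfl
    · rw [next_writerCfg (p' := .run q) (l' := ⟨emission j (.run c.state)
        (fun i => c.tape i (c.head i)) false, length_emission_le _ _ _ _⟩) (w' := w') (mv := mv)
        (o' := o) (r := none) (by simp only [OracleTM.instr, writerCfg, traceWriter, hδ])]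
      simp
  | @query c y n B a hc ha _ ih =>
    have hδ : (machOf j).δ c.state (fun i => c.tape i (c.head i)) = .query y n := hc
    rw [Traced.next_of_answer hc ha] at ih
    obtain ⟨h, t, o', hr⟩ := ih (w ++ blockBits (queryBlock j c.scan a, .run (cond a y n)))
    refine ⟨h, t, o', ?_⟩
    rw [hflat, ← List.append_assoc, List.length_cons, mul_add, mul_one, add_comm]
    refine Reaches.trans (reaches_of_next (a := a) ?_ ?_) hr
    · simp only [emission, hδ]
      rfl
    · have hi : OracleTM.instr (writerCfg (.run c.state) ⟨[], Nat.zero_le _⟩ c.head c.tape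
          c.oracleTape w) = .query
            (.run y, ⟨emission j (.run c.state) (fun i => c.tape i (c.head i)) true,
              length_emission_le _ _ _ _⟩)
            (.run n, ⟨emission j (.run c.state) (fun i => c.tape i (c.head i)) false,
              length_emission_le _ _ _ _⟩) := by
        simp only [OracleTM.instr, writerCfg, traceWriter, hδ]
      rw [Traced.next_of_answer hi ha]
      cases a <;> rfl

/-- The head positions when the head on tape `0` is on the cell `z` and all others are on `0`. -/
def headZero {k : ℕ} (z : ℤ) (i : Fin (k + 1)) : ℤ := if i = 0 then z else 0

theorem headZero_add {k : ℕ} (z : ℤ) (m : SignType) :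
    (fun i : Fin (k + 1) => headZero z i + ((moveZero m i : SignType) : ℤ)) = headZero (z + m) := by
  funext i
  by_cases h : i = 0 <;> simp [headZero, moveZero, h]

theorem reaches_right {X : Set Word} {j : ℕ} (y w : Word) (n : ℕ) (hn : n ≤ y.length) :
    Reaches X (writerCfg (j := j) .right ⟨[], Nat.zero_le _⟩ (headZero 0)
        ((machOf j).init y).tape [] w)
      (writerCfg .right ⟨[], Nat.zero_le _⟩ (headZero n) ((machOf j).init y).tape [] w)
      ((emissionBound j + 1) * n) := by
  induction n with
  | zero => exact .refl _
  | succ n ih =>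
    refine (ih (by omega)).trans ?_
    have hs : ((machOf j).init y).tape 0 (headZero (k := (machOf j).k) (n : ℤ) 0) = some y[n] := by
      simp [OracleTM.init, headZero]
    have := reaches_of_move (X := X) (j := j) (p := .right) (p' := .right)
      (h := headZero (n : ℤ)) (t := ((machOf j).init y).tape) (o := []) (w := w)
      (mv := moveZero 1) (l := []) rfl (by
        simp only [OracleTM.instr, writerCfg, traceWriter, hs])
    rw [headZero_add, List.append_nil] at this
    simpa using this

theorem reaches_left {X : Set Word} {j : ℕ} (y w : Word) (n : ℕ) (hn : n ≤ y.length) :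
    Reaches X (writerCfg (j := j) .left ⟨[], Nat.zero_le _⟩ (headZero ((n : ℤ) - 1))
        ((machOf j).init y).tape [] w)
      (writerCfg (.run (machOf j).start) ⟨[], Nat.zero_le _⟩ (fun _ => 0)
        ((machOf j).init y).tape []
        (w ++ flat (blocksUnits (inputBlocks (machOf j) j (y.take n) []))))
      ((emissionBound j + 1) * (n + 1)) := by
  induction n generalizing w with
  | zero =>
    have hs : ((machOf j).init y).tape 0
        (headZero (k := (machOf j).k) (((0 : ℕ) : ℤ) - 1) 0) = none := by
      simp [OracleTM.init, headZero]
    have := reaches_of_move (X := X) (j := j) (p := .left) (p' := .run (machOf j).start)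
      (h := headZero (((0 : ℕ) : ℤ) - 1)) (t := ((machOf j).init y).tape) (o := []) (w := w)
      (mv := moveZero 1)
      (l := blockBits (startBlock (machOf j).k j, .run (machOf j).start))
      (by simp only [emission, hs]) (by
        simp only [OracleTM.instr, writerCfg, traceWriter, hs])
    rw [headZero_add] at this
    have h0 : headZero (k := (machOf j).k) (((0 : ℕ) : ℤ) - 1 + ((1 : SignType) : ℤ)) =
        fun _ => 0 := by
      funext i
      simp [headZero]
    rw [h0] at this
    simpa [inputBlocks, blocksUnits, blockBits] using this
  | succ n ih =>
    have hs : ((machOf j).init y).tape 0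
        (headZero (k := (machOf j).k) (((n + 1 : ℕ) : ℤ) - 1) 0) = some y[n] := by
      simp [OracleTM.init, headZero]
    have := reaches_of_move (X := X) (j := j) (p := .left) (p' := .left)
      (h := headZero (((n + 1 : ℕ) : ℤ) - 1)) (t := ((machOf j).init y).tape) (o := []) (w := w)
      (mv := moveZero (-1))
      (l := blockBits (loadBlock (machOf j).k j y[n], .load))
      (by simp only [emission, hs]) (by
        simp only [OracleTM.instr, writerCfg, traceWriter, hs])
    rw [headZero_add] at this
    have h0 : (((n + 1 : ℕ) : ℤ) - 1 + ((-1 : SignType) : ℤ)) = (n : ℤ) - 1 := by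
      simp
      ring
    rw [h0] at this
    have h2 := this.trans (ih (w ++ blockBits (loadBlock (machOf j).k j y[n], .load)) (by omega))
    rw [List.append_assoc] at h2
    have h3 : inputBlocks (machOf j) j (y.take (n + 1)) [] =
        (loadBlock (machOf j).k j y[n], .load) :: inputBlocks (machOf j) j (y.take n) [] := by
      rw [inputBlocks, ← List.take_append_getElem (by omega), List.reverse_append]
      rfl
    have h4 : flat (blocksUnits (inputBlocks (machOf j) j (y.take (n + 1)) [])) =
        blockBits (loadBlock (machOf j).k j y[n], .load) ++
          flat (blocksUnits (inputBlocks (machOf j) j (y.take n) [])) := by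
      rw [h3]
      simp [blocksUnits, flat, blockBits]
    rw [h4]
    exact h2.mono (by ring_nf; omega)

/-- The trace of a run can be computed in polynomial time. -/
theorem exists_traceWriter_run {X : Set Word} {j : ℕ} (y : Word)
    {B : List (Block (machOf j).k × TState (machOf j))} (hB : Traced X j ((machOf j).init y) B) :
    ∃ T ≤ (emissionBound j + 1) * (2 * y.length + B.length + 3),
      (traceWriter j).HaltsWithin X y T true ∧ ((traceWriter j).cfgAt X y T).output =
        flat (fullTrace (inputBlocks (machOf j) j y B)) := by
  have h1 := reaches_pending (X := X) (j := j) (h := headZero 0) (t := ((machOf j).init y).tape)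
    (o := []) .right (prelude j) (length_prelude_le j) []
  have h2 := reaches_right (X := X) (j := j) y ([] ++ prelude j) y.length le_rfl
  have h3 : Reaches X (writerCfg (j := j) .right ⟨[], Nat.zero_le _⟩ (headZero (y.length : ℤ))
      ((machOf j).init y).tape [] ([] ++ prelude j)) (writerCfg (j := j) .left ⟨[], Nat.zero_le _⟩
      (headZero ((y.length : ℤ) - 1)) ((machOf j).init y).tape [] ([] ++ prelude j))
      (emissionBound j + 1) := by
    have hs : ((machOf j).init y).tape 0
        (headZero (k := (machOf j).k) (y.length : ℤ) 0) = none := by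
      simp [OracleTM.init, headZero]
    have := reaches_of_move (X := X) (j := j) (p := .right) (p' := .left)
      (h := headZero (y.length : ℤ)) (t := ((machOf j).init y).tape) (o := [])
      (w := [] ++ prelude j) (mv := moveZero (-1)) (l := []) rfl (by
        simp only [OracleTM.instr, writerCfg, traceWriter, hs])
    rw [headZero_add, List.append_nil] at this
    exact this
  have h4 := reaches_left (X := X) (j := j) y ([] ++ prelude j) y.length le_rfl
  obtain ⟨h, t, o, h5⟩ := hB.reaches
    (([] ++ prelude j) ++ flat (blocksUnits (inputBlocks (machOf j) j (y.take y.length) [])))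
  obtain ⟨T, hT, h6⟩ := h1.trans (h2.trans (h3.trans (h4.trans h5)))
  have h0 : (traceWriter j).init y = writerCfg .right ⟨prelude j, length_prelude_le j⟩
      (headZero 0) ((machOf j).init y).tape [] [] := by
    have : (headZero 0 : Fin ((machOf j).k + 1) → ℤ) = fun _ => 0 := by
      funext i
      simp [headZero]
    rw [this]
    rfl
  rw [← h0] at h6
  have h7 : (traceWriter j).cfgAt X y T = _ := h6
  refine ⟨T, hT.trans ?_, ?_, ?_⟩
  · have := length_prelude_le j
    nlinarith
  · unfold OracleTM.HaltsWithin
    rw [h7]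
    rfl
  · rw [h7]
    have : flat (fullTrace (inputBlocks (machOf j) j y B)) = prelude j ++
        flat (blocksUnits (inputBlocks (machOf j) j y [])) ++ flat (blocksUnits B) := by
      simp [fullTrace, inputBlocks, blocksUnits, flat, prelude]
    rw [this, List.take_length]
    rfl

/-- A function that is computed by a machine with certificates is p-simulated by the verifier. -/
theorem pSimulatedBy_verify {X : Set Word} (hX : KnowsAutomaton X) {j i d : ℕ}
    (hcert : ∀ T, zeros (Prog.certLength i d (2 ^ j * (2 * T + 1))) ∈ X) (w₀ : Word)
    {g : Word → Word} {p : Polynomial ℕ}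
    (hg : (machOf j).ComputesInTime X g fun n => p.eval n) :
    PSimulatedBy X g (verify X i d w₀) := by
  have key : ∀ y, ∃ m ≤ p.eval y.length, ∃ B, B.length = m + 1 ∧
      Traced X j ((machOf j).init y) B := by
    intro y
    obtain ⟨b, hb⟩ := (hg y).1
    obtain ⟨m, hm, -, B, -, h2, h3⟩ := Traced.exists_of_halts j _ _ b hb
    exact ⟨m, hm, B, h2, h3⟩
  choose m hm B hlen hB using key
  let q : Polynomial ℕ := ((emissionBound j + 1 : ℕ) : Polynomial ℕ) * (2 * Polynomial.X + p + 4)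
  have hq : ∀ y : Word, (emissionBound j + 1) * (2 * y.length + (B y).length + 3) ≤
      q.eval y.length := by
    intro y
    simp only [q, Polynomial.eval_mul, Polynomial.eval_natCast, Polynomial.eval_add,
      Polynomial.eval_ofNat, Polynomial.eval_X]
    refine Nat.mul_le_mul_left _ ?_
    have := hm y
    rw [hlen]
    omega
  have hrun := fun y => exists_traceWriter_run y (hB y)
  choose T hT hT1 hT2 using hrun
  have hout : ∀ y, ((traceWriter j).cfgAt X y (q.eval y.length)).output =
      flat (fullTrace (inputBlocks (machOf j) j y (B y))) := by
    intro y
    rw [(hT1 y).cfgAt_eq ((hT y).trans (hq y)), hT2]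
  refine ⟨fun y => flat (fullTrace (inputBlocks (machOf j) j y (B y))),
    ⟨traceWriter j, q, fun y => ⟨⟨true, (hT1 y).mono ((hT y).trans (hq y))⟩, hout y⟩⟩, q,
    fun y => ⟨?_, ?_⟩⟩
  · change (flat (fullTrace (inputBlocks (machOf j) j y (B y)))).length ≤ _
    rw [← hout]
    exact OracleTM.length_output_cfgAt _
  · obtain ⟨b, hb⟩ := (hg y).1
    change verify X i d w₀ (flat (fullTrace (inputBlocks (machOf j) j y (B y)))) = _
    rw [verify_fullTrace hX hcert w₀ y (hB y) hb]
    exact (hg y).2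

/-! ### Certificates make the verifier p-optimal -/

/-- On all inputs `y`, the machine with index `j` only outputs words of `𝓛 l X`, as far as it halts
within `τ` steps where `|y| + τ ≤ T`. -/
def CertOK (𝓛 : ℕ → Set Word → Set Word) (l : ℕ) (X : Set Word) (j T : ℕ) : Prop :=
  ∀ y τ b, y.length + τ ≤ T → (machOf j).HaltsWithin X y τ b →
    ((machOf j).cfgAt X y τ).output ∈ 𝓛 l X

/-- The oracle contains the certificates for all properties `CertOK 𝓛 l X j T` that cannot be
destroyed by changing the oracle at words at least as long as the certificate. -/
def HasCertificates (𝓛 : ℕ → Set Word → Set Word) (X : Set Word) : Prop :=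
  ∀ l d j T, zeros (Prog.certLength (Nat.pair l d) d (2 ^ j * (2 * T + 1))) ∈ X ↔
    ∀ X', AgreeBelow (Prog.certLength (Nat.pair l d) d (2 ^ j * (2 * T + 1))) X X' →
      CertOK 𝓛 l X' j T

theorem range_verify_subset {𝓛 : ℕ → Set Word → Set Word} {X : Set Word} (hX : KnowsAutomaton X)
    (hC : HasCertificates 𝓛 X) {l : ℕ} (d : ℕ) {w₀ : Word} (hw₀ : w₀ ∈ 𝓛 l X) (z : Word) :
    verify X (Nat.pair l d) d w₀ z ∈ 𝓛 l X := by
  unfold verify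
  split_ifs with h
  · obtain ⟨h1, h2, h3, h4⟩ := h
    obtain ⟨j, T, y, m, b, hw, hT, hm, ho⟩ := exists_run_of_checks hX h1 h2 h4
    rw [hw] at h3
    rw [← ho]
    exact (hC l d j T).1 h3 X (.refl _ X) y m b (by omega) hm
  · exact hw₀

theorem pow_le_iterate_sq (d n : ℕ) : n ^ 2 ^ d ≤ sq^[d] n := by
  induction d with
  | zero => simp
  | succ d ih =>
    rw [Function.iterate_succ_apply', pow_succ 2 d, pow_mul]
    unfold sq at ih ⊢
    nlinarith [Nat.pow_le_pow_left ih 2]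

theorem iterate_sq_le_certLength (i d n : ℕ) : sq^[d] n ≤ Prog.certLength i d n := by
  have : 1 ≤ 2 ^ i := Nat.one_le_two_pow
  unfold Prog.certLength
  nlinarith

theorem le_iterate_sq (d n : ℕ) : n ≤ sq^[d] n :=
  Function.id_le_iterate_of_id_le Prog.le_sq d n

theorem const_mem_FP (X : Set Word) (w : Word) : (fun _ => w) ∈ FP X := by
  refine Prog.mem_FP_of_runs (Prog.outWord w) ((2 * w.length + 1 : ℕ) : Polynomial ℕ) _ fun x => ?_
  exact ⟨_, by simpa using Prog.runs_outWord w (Store.input x), by simp [Store.input]⟩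

/-- The verifier is p-optimal if the certificates for machines with range in `𝓛 l X` exist.  This
is ensured by `hR`: membership of the outputs of such a machine in `𝓛 l X` depends only on words in
the oracle that are shorter than the certificate. -/
theorem hasPOptimalProofSystem_of_robust {𝓛 : ℕ → Set Word → Set Word} {X : Set Word}
    (hX : KnowsAutomaton X) (hC : HasCertificates 𝓛 X) {l : ℕ} (hne : (𝓛 l X).Nonempty) (d : ℕ)
    (hR : ∀ k (g : Word → Word),
      (∀ y, ∃ τ b, (mach k).HaltsWithin X y τ b ∧ ((mach k).cfgAt X y τ).output = g y) →
      (∀ y, g y ∈ 𝓛 l X) →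
      ∃ C, ∀ y τ m b X', C ≤ m → (y.length + τ + 2) ^ 2 ^ d ≤ m → (mach k).HaltsWithin X y τ b →
        AgreeBelow m X X' → g y ∈ 𝓛 l X') :
    HasPOptimalProofSystem X (𝓛 l X) := by
  obtain ⟨w₀, hw₀⟩ := hne
  have hsim : ∀ g ∈ FP X, (∀ y, g y ∈ 𝓛 l X) →
      PSimulatedBy X g (verify X (Nat.pair l d) d w₀) := by
    rintro g ⟨M, p, hM⟩ hg
    obtain ⟨k, hk⟩ := exists_mach_sameBehaviour M
    have hk' : (mach k).ComputesInTime X g fun n => p.eval n := by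
      intro y
      obtain ⟨⟨b, hb⟩, ho⟩ := hM y
      exact ⟨⟨b, ((hk X y _).1 b).2 hb⟩, (hk X y _).2.trans ho⟩
    obtain ⟨C, hC'⟩ := hR k g (fun y => by
      obtain ⟨⟨b, hb⟩, ho⟩ := hk' y
      exact ⟨_, b, hb, ho⟩) hg
    -- an index of the machine that is so large that the certificates have length at least `C`
    set j := Nat.pair k (C + 1) with hj
    have hjC : C + 1 ≤ j := Nat.right_le_pair k (C + 1)
    have hmach : machOf j = mach k := by rw [machOf, hj, Nat.unpair_pair]
    refine pSimulatedBy_verify (j := j) (p := p) hX (fun T => ?_) w₀ (by rwa [hmach])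
    refine (hC l d j T).2 fun X' hX' y τ b hyτ hτ => ?_
    rw [hmach] at hτ ⊢
    have h1 : 2 ^ j * (2 * T + 1) ≤ Prog.certLength (Nat.pair l d) d (2 ^ j * (2 * T + 1)) :=
      (le_iterate_sq _ _).trans (iterate_sq_le_certLength _ _ _)
    have h2 : j < 2 ^ j := Nat.lt_two_pow_self
    have h3 : T + 2 + C ≤ 2 ^ j * (2 * T + 1) := by nlinarith
    have h4 : (y.length + τ + 2) ^ 2 ^ d ≤
        Prog.certLength (Nat.pair l d) d (2 ^ j * (2 * T + 1)) :=
      ((Nat.pow_le_pow_left (by omega) _).trans (pow_le_iterate_sq _ _)).trans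
        (iterate_sq_le_certLength _ _ _)
    have hagree : AgreeBelow τ X X' := hX'.mono (by omega)
    have hτX : (mach k).HaltsWithin X y τ b := (OracleTM.haltsWithin_congr hagree).2 hτ
    rw [← OracleTM.cfgAt_congr hagree]
    obtain ⟨⟨b', hb'⟩, ho⟩ := hk' y
    rw [hτX.cfgAt_eq_cfgAt hb', ho]
    exact hC' y τ _ b X' (by omega) h4 hτX hX'
  refine ⟨verify X (Nat.pair l d) d w₀, ⟨verify_mem_FP X _ d w₀, ?_⟩, ?_⟩
  · refine Set.Subset.antisymm ?_ fun w hw => ?_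
    · rintro _ ⟨z, rfl⟩
      exact range_verify_subset hX hC d hw₀ z
    -- the constant functions are p-simulated
    · obtain ⟨π, -, _, hπ⟩ := hsim (fun _ => w) (const_mem_FP X w) fun _ => hw
      exact ⟨π [], (hπ []).2⟩
  · rintro g ⟨hg, hr⟩
    exact hsim g hg fun y => hr ▸ Set.mem_range_self y

/-! ### Oracles defined by recursion on the length -/

theorem enc_zeros (m : ℕ) : enc (zeros m) = 2 ^ m - 1 := by
  unfold enc
  have h : ∀ i : Fin (zeros m).length, (1 + ((zeros m).get i).toNat) *
      2 ^ ((zeros m).length - 1 - (i : ℕ)) = 2 ^ ((zeros m).length - 1 - (i : ℕ)) := by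
    intro i
    simp
  rw [Finset.sum_congr rfl fun i _ => h i,
    Fin.sum_univ_eq_sum_range (fun i => 2 ^ ((zeros m).length - 1 - i)),
    Finset.sum_range_reflect fun i => 2 ^ i, List.length_replicate, Nat.geomSum_eq le_rfl]
  simp

theorem odd_enc_zeros {m : ℕ} (hm : 1 ≤ m) : Odd (enc (zeros m)) := by
  rw [enc_zeros]
  obtain ⟨n, rfl⟩ := Nat.exists_eq_add_of_le' hm
  have : 1 ≤ 2 ^ n := Nat.one_le_two_pow
  exact ⟨2 ^ n - 1, by rw [pow_succ]; omega⟩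

theorem zeros_injective : Function.Injective zeros := fun m n h => by
  simpa using congrArg List.length h

/-- Does the word `0 ^ m` belong to the oracle?  It does if the property `P` at `m` holds for all
oracles that coincide below length `m` with what is already determined. -/
def OracleBit (A : Set Word) (P : Set Word → ℕ → Prop) (m : ℕ) : Prop :=
  ∀ X', AgreeBelow m ({w | ∃ n : Fin m, 1 ≤ (n : ℕ) ∧ w = zeros n ∧ OracleBit A P n} ∪ A) X' →
    P X' m
termination_by m
decreasing_by exact n.2

/-- There are tally oracles that answer prescribed questions about themselves. -/
theorem exists_oracle (A : Set Word) (hA : ∀ w ∈ A, Even (enc w)) (P : Set Word → ℕ → Prop) :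
    ∃ O : Set Word, IsTally O ∧ (∀ w ∈ O, Odd (enc w)) ∧
      ∀ m, 1 ≤ m → (zeros m ∈ O ∪ A ↔ ∀ X', AgreeBelow m (O ∪ A) X' → P X' m) := by
  refine ⟨{w | ∃ n, 1 ≤ n ∧ w = zeros n ∧ OracleBit A P n}, ?_, ?_, fun m hm => ?_⟩
  · rintro w ⟨n, -, rfl, -⟩
    exact ⟨n, rfl⟩
  · rintro w ⟨n, hn, rfl, -⟩
    exact odd_enc_zeros hn
  · have h1 : zeros m ∈ {w | ∃ n, 1 ≤ n ∧ w = zeros n ∧ OracleBit A P n} ∪ A ↔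
        OracleBit A P m := by
      constructor
      · rintro (⟨n, -, hn, h⟩ | h)
        · rwa [zeros_injective hn]
        · exact absurd (hA _ h) (Nat.not_even_iff_odd.2 (odd_enc_zeros hm))
      · exact fun h => .inl ⟨m, hm, rfl, h⟩
    have h2 : AgreeBelow m ({w | ∃ n : Fin m, 1 ≤ (n : ℕ) ∧ w = zeros n ∧ OracleBit A P n} ∪ A)
        ({w | ∃ n, 1 ≤ n ∧ w = zeros n ∧ OracleBit A P n} ∪ A) := by
      intro w hw
      refine or_congr ⟨?_, ?_⟩ Iff.rfl
      · rintro ⟨n, hn, hw', h⟩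
        exact ⟨n, hn, hw', h⟩
      · rintro ⟨n, hn, rfl, h⟩
        exact ⟨⟨n, by simpa using hw⟩, hn, rfl, h⟩
    rw [h1, OracleBit]
    refine forall_congr' fun X' => imp_congr_left ⟨fun h w hw => ?_, fun h w hw => ?_⟩
    · exact (h2 w hw).symm.trans (h w hw)
    · exact (h2 w hw).trans (h w hw)

/-! ### Sets in polynomial space -/

theorem exists_eval_lt_pow (p : Polynomial ℕ) : ∃ e, ∀ n, p.eval n < (n + 2) ^ e := by
  induction p using Polynomial.induction_on' with
  | add p q hp hq =>
    obtain ⟨a, ha⟩ := hp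
    obtain ⟨b, hb⟩ := hq
    refine ⟨a + b + 1, fun n => ?_⟩
    have h1 := (ha n).trans_le (Nat.pow_le_pow_right (by omega) (Nat.le_add_right a b))
    have h2 := (hb n).trans_le (Nat.pow_le_pow_right (by omega) (Nat.le_add_left b a))
    rw [Polynomial.eval_add, pow_succ]
    nlinarith [Nat.zero_le ((n + 2) ^ (a + b) * n)]
  | monomial k a =>
    refine ⟨a + k, fun n => ?_⟩
    rw [Polynomial.eval_monomial, pow_add]
    have h1 : a < (n + 2) ^ a := Nat.lt_pow_self (by omega)
    have h2 : n ^ k ≤ (n + 2) ^ k := Nat.pow_le_pow_left (by omega) k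
    have h3 : 0 < (n + 2) ^ k := by positivity
    nlinarith

/-- The words that the machine `k` accepts. -/
def Accepted (k : ℕ) (X : Set Word) : Set Word := {w | ∃ n, (mach k).HaltsWithin X w n true}

/-- All sets in `PSPACE^X` have p-optimal proof systems: whether a word belongs to such a set only
depends on oracle words that fit on the oracle tape. -/
theorem hasPOptimalProofSystem_of_mem_PSPACE {𝓛 : ℕ → Set Word → Set Word} {X : Set Word}
    (hX : KnowsAutomaton X) (hC : HasCertificates 𝓛 X) (h𝓛 : ∀ k, ∃ l, 𝓛 l = Accepted k)
    {L : Set Word} (hL : L ∈ PSPACE X) (hne : L.Nonempty) : HasPOptimalProofSystem X L := by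
  obtain ⟨M, p, hM, hs⟩ := hL
  obtain ⟨k, hk⟩ := exists_mach_sameBehaviour M
  obtain ⟨l, hl⟩ := h𝓛 k
  have hLX : 𝓛 l X = L := by
    rw [hl]
    ext w
    refine ⟨fun ⟨n, hn⟩ => hM.mem_of_haltsWithin (((hk X w n).1 true).1 hn), fun hw => ?_⟩
    obtain ⟨n, hn⟩ := (hM w).1 hw
    exact ⟨n, ((hk X w n).1 true).2 hn⟩
  obtain ⟨e, he⟩ := exists_eval_lt_pow p
  rw [← hLX] at hne ⊢
  refine hasPOptimalProofSystem_of_robust hX hC hne e fun k' g hk' hg =>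
    ⟨0, fun y τ m b X' _ hm hτ hX' => ?_⟩
  obtain ⟨τ', b', hτ', ho⟩ := hk' y
  -- the output of the machine is not longer than its running time
  have hlen : (g y).length ≤ τ := by
    rw [← ho, ← hτ.cfgAt_eq_cfgAt hτ']
    exact OracleTM.length_output_cfgAt _
  have hspace : p.eval (g y).length < m := by
    refine (he _).trans_le (le_trans ?_ hm)
    exact (Nat.pow_le_pow_left (by omega) _).trans
      (Nat.pow_le_pow_right (by omega) Nat.lt_two_pow_self.le)
  have hgy := hg y
  rw [hLX] at hgy
  obtain ⟨n, hn⟩ := (hM _).1 hgy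
  rw [hl]
  refine ⟨n, ((hk X' _ n).1 true).2 ?_⟩
  unfold OracleTM.HaltsWithin
  rw [← OracleTM.cfgAt_congr_of_usesSpace hs hX' hspace]
  exact hn

/-! ### Diagonal tally sets -/

/-- A budget that is monotone and eventually exceeds all multiples of `t`. -/
def budget (t : ℕ → ℕ) (n : ℕ) : ℕ := ∑ i ∈ Finset.range (n + 1), i * (t i + 1)

theorem budget_mono (t : ℕ → ℕ) : Monotone (budget t) := fun a b h =>
  Finset.sum_le_sum_of_subset (Finset.range_mono (by omega))

theorem le_budget (t : ℕ → ℕ) {c n : ℕ} (h : c ≤ n) : c * (t n + 1) ≤ budget t n :=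
  (Nat.mul_le_mul_right _ h).trans
    (Finset.single_le_sum (f := fun i => i * (t i + 1)) (fun _ _ => Nat.zero_le _)
      (Finset.self_mem_range_succ n))

/-- Requirement `2 k` claims `n` if the machine `k` outputs `0 ^ n` on some input within the budget
for `n`; requirement `2 k + 1` claims `n` if the machine `k` accepts `0 ^ n` within this budget. -/
def Claims (t : ℕ → ℕ) (X : Set Word) (κ n : ℕ) : Prop :=
  (∃ k, κ = 2 * k ∧ ∃ y b, (mach k).HaltsWithin X y (budget t n) b ∧
    ((mach k).cfgAt X y (budget t n)).output = zeros n) ∨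
  ∃ k, κ = 2 * k + 1 ∧ (mach k).HaltsWithin X (zeros n) (budget t n) true

/-- The number `n` is the first number from `2 κ` on that the requirement `κ` claims. -/
def FirstClaim (t : ℕ → ℕ) (X : Set Word) (κ n : ℕ) : Prop :=
  2 * κ ≤ n ∧ Claims t X κ n ∧ ∀ n' < n, 2 * κ ≤ n' → ¬ Claims t X κ n'

/-- The diagonal set: every requirement deletes the first number that it claims. -/
def Diag (t : ℕ → ℕ) (X : Set Word) : Set ℕ := {n | ∀ κ, ¬ FirstClaim t X κ n}

/-- The diagonal set as a tally set of words. -/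
def diagWords (t : ℕ → ℕ) (X : Set Word) : Set Word := zeros '' Diag t X

theorem zeros_mem_diagWords {t : ℕ → ℕ} {X : Set Word} {n : ℕ} :
    zeros n ∈ diagWords t X ↔ n ∈ Diag t X :=
  zeros_injective.mem_set_image

theorem claims_congr {t : ℕ → ℕ} {X Y : Set Word} {κ n : ℕ} (h : AgreeBelow (budget t n) X Y) :
    Claims t X κ n ↔ Claims t Y κ n := by
  unfold Claims
  simp only [OracleTM.haltsWithin_congr h, OracleTM.cfgAt_congr h]

/-- Membership of `n` in the diagonal set only depends on oracle words that are shorter than the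
budget for `n`. -/
theorem mem_diag_congr {t : ℕ → ℕ} {X Y : Set Word} {n : ℕ} (h : AgreeBelow (budget t n) X Y) :
    n ∈ Diag t X ↔ n ∈ Diag t Y := by
  refine forall_congr' fun κ => not_congr (and_congr_right fun _ =>
    and_congr (claims_congr h) (forall₂_congr fun n' hn' => ?_))
  rw [claims_congr (h.mono (budget_mono t hn'.le))]

/-- A requirement that only claims members of the diagonal set claims no number from its threshold
`2 κ` on, since the first of them would be deleted. -/
theorem lt_of_claims {t : ℕ → ℕ} {X : Set Word} {κ n : ℕ} (h : Claims t X κ n)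
    (hκ : ∀ n', Claims t X κ n' → n' ∈ Diag t X) : n < 2 * κ := by
  classical
  by_contra hn
  have hex : ∃ n', 2 * κ ≤ n' ∧ Claims t X κ n' := ⟨n, by omega, h⟩
  obtain ⟨h1, h2⟩ := Nat.find_spec hex
  exact hκ _ h2 κ ⟨h1, h2, fun n' hn' h3 h4 => Nat.find_min hex hn' ⟨h3, h4⟩⟩

/-- The diagonal set is infinite: of the numbers below `2 m` only the requirements below `m` can
delete one. -/
theorem exists_mem_diag (t : ℕ → ℕ) (X : Set Word) (b : ℕ) : ∃ n ∈ Diag t X, b ≤ n := by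
  by_contra! hD
  have hκ : ∀ n, b ≤ n → ∃ κ, FirstClaim t X κ n := by
    intro n hn
    by_contra! h
    exact absurd (hD n h) (by omega)
  choose! κ hκ using hκ
  have hmaps : Set.MapsTo κ (Finset.Ico b (2 * b + 2) : Finset ℕ) (Finset.range (b + 1)) := by
    intro n hn
    simp only [Finset.coe_Ico, Set.mem_Ico] at hn
    have := (hκ n hn.1).1
    simp only [Finset.coe_range, Set.mem_Iio]
    omega
  obtain ⟨m, hm, n, hn, hmn, he⟩ := Finset.exists_ne_map_eq_of_card_lt_of_maps_to
    (by simp; omega) hmaps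
  simp only [Finset.mem_Ico] at hm hn
  obtain ⟨h1, h2, h3⟩ := hκ m hm.1
  obtain ⟨h4, h5, h6⟩ := hκ n hn.1
  rw [he] at h1 h2 h3
  rcases lt_or_gt_of_ne hmn with h | h
  · exact h6 m h h1 h2
  · exact h3 n h h4 h5

theorem diagWords_notMem_DTIME (t : ℕ → ℕ) (X : Set Word) : diagWords t X ∉ DTIME X t := by
  rintro ⟨M, c, hM⟩
  obtain ⟨k, hk⟩ := exists_mach_sameBehaviour M
  obtain ⟨n, hn, hle⟩ := exists_mem_diag t X (max c (2 * (2 * k + 1)))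
  have hdec : M.Decides X (diagWords t X) := fun x =>
    ⟨fun hx => ⟨_, (hM x).1 hx⟩, fun hx => ⟨_, (hM x).2 hx⟩⟩
  have hc : Claims t X (2 * k + 1) n := by
    refine .inr ⟨k, rfl, ((hk X _ _).1 true).2 ?_⟩
    refine ((hM (zeros n)).1 (zeros_mem_diagWords.2 hn)).mono ?_
    simpa using le_budget t ((le_max_left _ _).trans hle)
  have := lt_of_claims hc (by
    rintro n' (⟨k', hk', -⟩ | ⟨k', hk', h⟩)
    · omega
    · obtain rfl : k = k' := by omega
      exact zeros_mem_diagWords.1 (hdec.mem_of_haltsWithin (((hk X _ _).1 true).1 h)))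
  have := (le_max_right _ _).trans hle
  omega

/-- Outputs in the diagonal set of machines whose range is a subset of it depend only on short
oracle words. -/
theorem robust_diagWords {t : ℕ → ℕ} {X : Set Word} {k : ℕ} {g : Word → Word}
    (hk : ∀ y, ∃ τ b, (mach k).HaltsWithin X y τ b ∧ ((mach k).cfgAt X y τ).output = g y)
    (hg : ∀ y, g y ∈ diagWords t X) {y : Word} {τ m : ℕ} {b : Bool} {X' : Set Word}
    (hC : budget t (4 * k) ≤ m) (hτm : τ ≤ m) (hτ : (mach k).HaltsWithin X y τ b)
    (hX' : AgreeBelow m X X') : g y ∈ diagWords t X' := by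
  obtain ⟨n, hn, hgy⟩ := hg y
  rw [← hgy, zeros_mem_diagWords]
  refine (mem_diag_congr (hX'.mono ?_)).1 hn
  by_contra hm
  -- otherwise the machine outputs `0 ^ n` within the budget for `n`
  have hτ' : (mach k).HaltsWithin X y (budget t n) b := hτ.mono (by omega)
  have hout : ((mach k).cfgAt X y (budget t n)).output = zeros n := by
    obtain ⟨τ', b', hb', ho⟩ := hk y
    rw [hτ'.cfgAt_eq_cfgAt hb', ho, hgy]
  have hclaim : Claims t X (2 * k) n := .inl ⟨k, rfl, y, b, hτ', hout⟩
  have hlt := lt_of_claims hclaim (by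
    rintro n' (⟨k', hk', y', b', hb', ho⟩ | ⟨k', hk', h⟩)
    · obtain rfl : k = k' := by omega
      obtain ⟨τ'', b'', hb'', ho''⟩ := hk y'
      rw [← zeros_mem_diagWords, ← ho, hb'.cfgAt_eq_cfgAt hb'', ho'']
      exact hg y'
    · omega)
  have := budget_mono t (show n ≤ 4 * k by omega)
  omega

/-! ### A program that decides the diagonal set -/

/-- The length of an oracle word for number `N` in the stream `a`; there are two kinds of words,
distinguished by `b`. -/
def streamLength (a b N : ℕ) : ℕ := 4 * (2 ^ a * (2 * (2 * N + b) + 1)) + 4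

/-- The oracle tells in the stream `a` which numbers have the form `n + budget t n`, and which of
these belong to numbers `n` in the diagonal set. -/
structure KnowsDiag (t : ℕ → ℕ) (X : Set Word) (a : ℕ) : Prop where
  pos : ∀ N, zeros (streamLength a 0 N) ∈ X ↔ ∃ n, N = n + budget t n
  val : ∀ n, zeros (streamLength a 1 (n + budget t n)) ∈ X ↔ n ∈ Diag t X

namespace Prog

variable {X : Set Word}

/-- Write the oracle word of kind `b` for the number on stack `5` on the oracle tape. -/
def askStream (a b : ℕ) : Prog :=
  .seq (.loop 5 (.seq (appZeros (2 ^ (a + 4))) (.push 6 true))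
      (.seq (appZeros (2 ^ (a + 4))) (.push 6 true)))
    (.seq (appZeros (streamLength a b 0)) (.loop 6 (.push 5 true) (.push 5 true)))

theorem runs_askStream (a b N : ℕ) (r0 r1 r2 r3 r4 r7 : List Bool) (w : Word) :
    ∃ T, Runs X (askStream a b) ⟨r0, r1, r2, r3, r4, units N, [], r7, [], w⟩
      ⟨r0, r1, r2, r3, r4, units N, [], r7, zeros (streamLength a b N), w⟩ T := by
  have h1 : ∀ N M o, ∃ T, Runs X (.loop 5 (.seq (appZeros (2 ^ (a + 4))) (.push 6 true))
      (.seq (appZeros (2 ^ (a + 4))) (.push 6 true)))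
      ⟨r0, r1, r2, r3, r4, units N, units M, r7, zeros o, w⟩
      ⟨r0, r1, r2, r3, r4, [], units (M + N), r7, zeros (o + N * 2 ^ (a + 4)), w⟩ T := by
    intro N
    induction N with
    | zero => intro M o; exact ⟨_, by simpa using Runs.loopE rfl⟩
    | succ N ih =>
      intro M o
      obtain ⟨T, hT⟩ := ih (M + 1) (o + 2 ^ (a + 4))
      refine ⟨_, Runs.loopL (c := T) (b := true) (l := units N) rfl
        ((runs_appZeros _ _).seq (Runs.push _ _ _)) ?_⟩
      rw [show M + (N + 1) = M + 1 + N by omega,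
        show o + (N + 1) * 2 ^ (a + 4) = o + 2 ^ (a + 4) + N * 2 ^ (a + 4) by ring]
      have h : zeros o ++ zeros (2 ^ (a + 4)) = zeros (o + 2 ^ (a + 4)) :=
        List.replicate_append_replicate
      rw [← h] at hT
      exact hT
  have h2 : ∀ N M o, ∃ T, Runs X (.loop 6 (.push 5 true) (.push 5 true))
      ⟨r0, r1, r2, r3, r4, units M, units N, r7, o, w⟩
      ⟨r0, r1, r2, r3, r4, units (M + N), [], r7, o, w⟩ T := by
    intro N
    induction N with
    | zero => intro M o; exact ⟨_, Runs.loopE rfl⟩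
    | succ N ih =>
      intro M o
      obtain ⟨T, hT⟩ := ih (M + 1) o
      refine ⟨_, Runs.loopL (c := T) (b := true) (l := units N) rfl (Runs.push _ _ _) ?_⟩
      rw [show M + (N + 1) = M + 1 + N by omega]
      exact hT
  obtain ⟨T1, hT1⟩ := h1 N 0 0
  obtain ⟨T2, hT2⟩ := h2 N 0 (zeros (streamLength a b N))
  rw [zero_add] at hT1 hT2
  refine ⟨_, hT1.seq ((runs_appZeros _ _).seq (b := T2) ?_)⟩
  have h : zeros (0 + N * 2 ^ (a + 4)) ++ zeros (streamLength a b 0) =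
      zeros (streamLength a b N) := by
    rw [List.replicate_append_replicate]
    congr 1
    unfold streamLength
    ring
  change Runs X _ ⟨r0, r1, r2, r3, r4, [], units N, r7,
    zeros (0 + N * 2 ^ (a + 4)) ++ zeros (streamLength a b 0), w⟩ _ _
  rw [h]
  exact hT2

/-- If the number on stack `5` has the form `i + budget t i`, remove a letter from the input on
stack `2`, or ask for the answer if there is none left; go on with the next number in all other
cases.  A letter on stack `4` keeps the loop going. -/
def searchBody (a : ℕ) : Prog :=
  .seq (askStream a 0) (.query
    (.pop 2 (.seq (askStream a 1) (.query (.push 1 true) .skip))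
      (.seq (.push 4 true) (.push 5 true)) (.seq (.push 4 true) (.push 5 true)))
    (.seq (.push 4 true) (.push 5 true)))

/-- The search passes through the numbers `N`; here `i` counts the numbers of the form
`i + budget t i` that were passed.  The answer comes when `N = n + budget t n`. -/
theorem runs_search {t : ℕ → ℕ} {a : ℕ} (hX : KnowsDiag t X a) (n k : ℕ) :
    ∀ i N, i ≤ n → N ≤ i + budget t i → (∀ i' < i, i' + budget t i' < N) →
      n + budget t n < N + k →
    ∃ s T, Runs X (.loop 4 (searchBody a) (searchBody a))
      ⟨[], [], zeros (n - i), [], [true], units N, [], [], [], []⟩ s T ∧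
      (s.r1.head?.isSome = true ↔ n ∈ Diag t X) := by
  induction k with
  | zero =>
    intro i N hi hN _ hk
    have := budget_mono t hi
    omega
  | succ k ih =>
    intro i N hi hN hlt hk
    obtain ⟨T1, h1⟩ := runs_askStream (X := X) a 0 N [] [] (zeros (n - i)) [] [] [] []
    by_cases hNi : N = i + budget t i
    · have hy : zeros (streamLength a 0 N) ∈ X := (hX.pos N).2 ⟨i, hNi⟩
      rcases hi.eq_or_lt with rfl | hi'
      · rw [Nat.sub_self] at h1 ⊢
        obtain ⟨T2, h2⟩ := runs_askStream (X := X) a 1 N [] [] [] [] [] [] []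
        by_cases hv : i ∈ Diag t X
        · have hq : zeros (streamLength a 1 N) ∈ X := hNi ▸ (hX.val i).2 hv
          refine ⟨_, _, Runs.loopL (b := true) (l := []) rfl (h1.seq (Runs.queryY hy
            (Runs.popE rfl (h2.seq (Runs.queryY hq (Runs.push _ _ _)))))) (Runs.loopE rfl), ?_⟩
          simpa [Store.set, Store.get] using hv
        · have hq : zeros (streamLength a 1 N) ∉ X := fun h => hv ((hX.val i).1 (hNi ▸ h))
          refine ⟨_, _, Runs.loopL (b := true) (l := []) rfl (h1.seq (Runs.queryY hy
            (Runs.popE rfl (h2.seq (Runs.queryN hq (Runs.skip _)))))) (Runs.loopE rfl), ?_⟩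
          simpa using hv
      · have hm : budget t i ≤ budget t (i + 1) := budget_mono t (Nat.le_succ i)
        obtain ⟨s, T, h2, hs⟩ := ih (i + 1) (N + 1) hi' (by omega) (fun i' hi' => by
          have := budget_mono t (Nat.le_of_lt_succ hi')
          omega) (by omega)
        have hz : zeros (n - i) = false :: zeros (n - (i + 1)) := by
          rw [show n - i = n - (i + 1) + 1 by omega]
          rfl
        rw [hz] at h1 ⊢
        exact ⟨s, _, Runs.loopL (b := true) (l := []) rfl (h1.seq (Runs.queryY hy
          (Runs.popL (b := false) (l := zeros (n - (i + 1))) rfl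
            ((Runs.push 4 true _).seq (Runs.push 5 true _))))) h2, hs⟩
    · have hn : zeros (streamLength a 0 N) ∉ X := by
        rw [hX.pos N]
        rintro ⟨i', rfl⟩
        rcases lt_or_ge i' i with h | h
        · exact absurd (hlt i' h) (lt_irrefl _)
        · have := budget_mono t h
          have : i' = i := by omega
          exact hNi (by rw [this])
      obtain ⟨s, T, h2, hs⟩ := ih i (N + 1) hi (by omega) (fun i' hi' => by
        have := hlt i' hi'
        omega) (by omega)
      exact ⟨s, _, Runs.loopL (b := true) (l := []) rfl (h1.seq (Runs.queryN hn
        ((Runs.push 4 true _).seq (Runs.push 5 true _)))) h2, hs⟩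

/-- Decide the diagonal set.  The letters `0` of the input go to stack `2`, and an input with a
letter `1` is rejected. -/
def decider (a : ℕ) : Prog :=
  .seq (.loop 0 (.push 2 false) (.push 3 true))
    (.pop 3 (.seq (.push 4 true) (.loop 4 (searchBody a) (searchBody a))) .skip .skip)

theorem runs_readInput (x : Word) (m k : ℕ) : ∃ T, Runs X (.loop 0 (.push 2 false) (.push 3 true))
    ⟨x, [], zeros m, units k, [], [], [], [], [], []⟩
    ⟨[], [], zeros (m + x.count false), units (k + x.count true), [], [], [], [], [], []⟩ T := by
  induction x generalizing m k with
  | nil => exact ⟨_, Runs.loopE rfl⟩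
  | cons b x ih =>
    cases b
    · obtain ⟨T, hT⟩ := ih (m + 1) k
      refine ⟨_, Runs.loopL (c := T) (b := false) (l := x) rfl (Runs.push _ _ _) ?_⟩
      rw [show m + (false :: x).count false = m + 1 + x.count false by simp; omega,
        show k + (false :: x).count true = k + x.count true by simp]
      exact hT
    · obtain ⟨T, hT⟩ := ih m (k + 1)
      refine ⟨_, Runs.loopL (c := T) (b := true) (l := x) rfl (Runs.push _ _ _) ?_⟩
      rw [show m + (true :: x).count false = m + x.count false by simp,
        show k + (true :: x).count true = k + 1 + x.count true by simp; omega]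
      exact hT

end Prog

theorem decidable_diagWords {t : ℕ → ℕ} {X : Set Word} {a : ℕ} (hX : KnowsDiag t X a) :
    DecidableRelativeTo X (diagWords t X) := by
  have key : ∀ x, ∃ s T, Prog.Runs X (Prog.decider a) (Store.input x) s T ∧
      (s.r1.head?.isSome = true ↔ x ∈ diagWords t X) := by
    intro x
    obtain ⟨T1, h1⟩ := Prog.runs_readInput (X := X) x 0 0
    rw [zero_add, zero_add] at h1
    by_cases hx : x.count true = 0
    · obtain ⟨n, rfl⟩ : ∃ n, x = zeros n := ⟨x.length, by
        rw [List.eq_replicate_iff]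
        refine ⟨rfl, fun b hb => ?_⟩
        rw [List.count_eq_zero] at hx
        cases b
        · rfl
        · exact absurd hb hx⟩
      rw [hx, List.count_replicate_self] at h1
      obtain ⟨s, T, h2, hs⟩ := Prog.runs_search hX n (n + budget t n + 1) 0 0 (Nat.zero_le _)
        (Nat.zero_le _) (fun i' hi' => absurd hi' (Nat.not_lt_zero _)) (by omega)
      rw [Nat.sub_zero] at h2
      exact ⟨s, _, h1.seq (Prog.Runs.popE rfl ((Prog.Runs.push 4 true _).seq h2)),
        hs.trans zeros_mem_diagWords.symm⟩
    · obtain ⟨k, hk⟩ := Nat.exists_eq_succ_of_ne_zero hx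
      rw [hk] at h1
      refine ⟨_, _, h1.seq (Prog.Runs.popL (b := true) (l := Prog.units k) rfl
        (Prog.Runs.skip _)), ?_⟩
      refine iff_of_false (by change ¬ (false = true); decide) ?_
      rintro ⟨n, -, rfl⟩
      exact hx (List.count_eq_zero.2 (by simp))
  refine ⟨(Prog.decider a).toTM, fun x => ?_⟩
  obtain ⟨s, T, ⟨n, -, hr⟩, hs⟩ := key x
  have := hr.haltsWithin
  constructor
  · intro hx
    rw [hs.2 hx] at this
    exact ⟨n, this⟩
  · intro hx
    rw [Bool.eq_false_iff.2 fun h => hx (hs.1 h)] at this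
    exact ⟨n, this⟩

/-! ### The oracle -/

/-- The machine `k` computes the binary representations of the values of `t`. -/
def ConstructedBy (k : ℕ) (t : ℕ → ℕ) : Prop :=
  ∃ T, (mach k).ComputesInTime ∅ (fun x => (Nat.bits (t x.length)).reverse) T

/-- A machine constructs at most one function, so that there are only countably many
time-constructible functions. -/
theorem ConstructedBy.unique {k : ℕ} {t t' : ℕ → ℕ} (h : ConstructedBy k t)
    (h' : ConstructedBy k t') : t = t' := by
  obtain ⟨T, hT⟩ := h
  obtain ⟨T', hT'⟩ := h'
  funext n
  obtain ⟨⟨b, hb⟩, ho⟩ := hT (zeros n)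
  obtain ⟨⟨b', hb'⟩, ho'⟩ := hT' (zeros n)
  rw [hb.cfgAt_eq_cfgAt hb', ho'] at ho
  simp only [List.length_replicate, List.reverse_inj] at ho
  refine (Nat.eq_of_testBit_eq fun i => ?_).symm
  rw [Nat.testBit_eq_inth, Nat.testBit_eq_inth, ho]

theorem TimeConstructible.exists_constructedBy {t : ℕ → ℕ} (h : TimeConstructible t) :
    ∃ k, ConstructedBy k t := by
  obtain ⟨-, M, c, hM⟩ := h
  obtain ⟨k, hk⟩ := exists_mach_sameBehaviour M
  refine ⟨k, fun n => c * (t n + 1), fun x => ?_⟩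
  obtain ⟨⟨b, hb⟩, ho⟩ := hM x
  exact ⟨⟨b, ((hk ∅ x _).1 b).2 hb⟩, (hk ∅ x _).2.trans ho⟩

/-- An enumeration that contains all time-constructible functions. -/
noncomputable def timeFun (a : ℕ) : ℕ → ℕ := Classical.epsilon (ConstructedBy a)

theorem exists_timeFun_eq {t : ℕ → ℕ} (h : TimeConstructible t) : ∃ a, timeFun a = t := by
  obtain ⟨k, hk⟩ := h.exists_constructedBy
  exact ⟨k, (Classical.epsilon_spec ⟨t, hk⟩ : ConstructedBy k _).unique hk⟩

/-- The languages for which there are certificates: the sets of accepted words have even indices and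
the diagonal sets odd ones. -/
noncomputable def certLang (l : ℕ) (X : Set Word) : Set Word :=
  if l % 2 = 0 then Accepted (l / 2) X else diagWords (timeFun (l / 2)) X

/-- What the oracle is to tell about itself.  The lengths of the words are `1`, `2`, `3` and `0`
modulo `4` for edges, nodes, certificates and streams. -/
inductive Spec (X : Set Word) : ℕ → Prop
  | edge {n} : EdgeCode n → Spec X (4 * n + 1)
  | node (N) : Spec X (4 * nodeNum N + 2)
  | cert {l d j T} : CertOK certLang l X j T →
      Spec X (Prog.certLength (Nat.pair l d) d (2 ^ j * (2 * T + 1)))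
  | pos (a n) : Spec X (streamLength a 0 (n + budget (timeFun a) n))
  | val {a n} : n ∈ Diag (timeFun a) X → Spec X (streamLength a 1 (n + budget (timeFun a) n))

theorem two_pow_mul_odd_inj : ∀ {i i' s s' : ℕ}, 2 ^ i * (2 * s + 1) = 2 ^ i' * (2 * s' + 1) →
    i = i' ∧ s = s'
  | 0, 0, s, s', h => ⟨rfl, by omega⟩
  | 0, i' + 1, s, s', h => by rw [pow_succ, mul_comm _ 2, mul_assoc] at h; omega
  | i + 1, 0, s, s', h => by rw [pow_succ, mul_comm _ 2, mul_assoc] at h; omega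
  | i + 1, i' + 1, s, s', h => by
    rw [pow_succ, pow_succ, mul_comm _ 2, mul_comm _ 2, mul_assoc, mul_assoc] at h
    have := two_pow_mul_odd_inj (Nat.eq_of_mul_eq_mul_left two_pos h)
    exact ⟨by omega, this.2⟩

theorem sq_injective : Function.Injective sq := by
  have : StrictMono sq := fun a b h => by unfold sq; nlinarith
  exact this.injective

theorem certLength_inj {l d j T l' d' j' T' : ℕ}
    (h : Prog.certLength (Nat.pair l d) d (2 ^ j * (2 * T + 1)) =
      Prog.certLength (Nat.pair l' d') d' (2 ^ j' * (2 * T' + 1))) :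
    l = l' ∧ d = d' ∧ j = j' ∧ T = T' := by
  unfold Prog.certLength at h
  obtain ⟨h1, h2⟩ := two_pow_mul_odd_inj
    (Nat.eq_of_mul_eq_mul_left four_pos (Nat.add_right_cancel h))
  obtain ⟨rfl, rfl⟩ := Nat.pair_eq_pair.1 h1
  obtain ⟨rfl, rfl⟩ := two_pow_mul_odd_inj (sq_injective.iterate d h2)
  exact ⟨rfl, rfl, rfl, rfl⟩

theorem streamLength_inj {a b N a' b' N' : ℕ} (hb : b < 2) (hb' : b' < 2)
    (h : streamLength a b N = streamLength a' b' N') : a = a' ∧ b = b' ∧ N = N' := by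
  unfold streamLength at h
  obtain ⟨h1, h2⟩ := two_pow_mul_odd_inj
    (Nat.eq_of_mul_eq_mul_left four_pos (Nat.add_right_cancel h))
  omega

theorem spec_edge {X : Set Word} {n : ℕ} : Spec X (4 * n + 1) ↔ EdgeCode n := by
  refine ⟨fun h => ?_, .edge⟩
  generalize hm : 4 * n + 1 = m at h
  cases h
  case edge n' h => rwa [show n = n' by omega]
  case node N => omega
  all_goals
    simp only [Prog.certLength, streamLength] at hm
    omega

theorem spec_node {X : Set Word} {n : ℕ} : Spec X (4 * n + 2) ↔ ∃ N, n = nodeNum N := by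
  refine ⟨fun h => ?_, fun ⟨N, hN⟩ => hN ▸ .node N⟩
  generalize hm : 4 * n + 2 = m at h
  cases h
  case node N => exact ⟨N, by omega⟩
  case edge n' h => omega
  all_goals
    simp only [Prog.certLength, streamLength] at hm
    omega

theorem spec_cert {X : Set Word} {l d j T : ℕ} :
    Spec X (Prog.certLength (Nat.pair l d) d (2 ^ j * (2 * T + 1))) ↔ CertOK certLang l X j T := by
  refine ⟨fun h => ?_, .cert⟩
  generalize hm : Prog.certLength (Nat.pair l d) d (2 ^ j * (2 * T + 1)) = m at h
  cases h
  case cert h =>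
    obtain ⟨rfl, rfl, rfl, rfl⟩ := certLength_inj hm
    exact h
  all_goals
    simp only [Prog.certLength, streamLength] at hm
    omega

theorem spec_pos {X : Set Word} {a N : ℕ} :
    Spec X (streamLength a 0 N) ↔ ∃ n, N = n + budget (timeFun a) n := by
  refine ⟨fun h => ?_, fun ⟨n, hn⟩ => hn ▸ .pos a n⟩
  generalize hm : streamLength a 0 N = m at h
  cases h
  case pos a' n =>
    obtain ⟨rfl, -, rfl⟩ := streamLength_inj two_pos two_pos hm
    exact ⟨n, rfl⟩
  case val a' n h =>
    exact absurd (streamLength_inj two_pos one_lt_two hm).2.1 zero_ne_one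
  all_goals
    simp only [Prog.certLength, streamLength] at hm
    omega

theorem spec_val {X : Set Word} {a n : ℕ} :
    Spec X (streamLength a 1 (n + budget (timeFun a) n)) ↔ n ∈ Diag (timeFun a) X := by
  refine ⟨fun h => ?_, .val⟩
  generalize hm : streamLength a 1 (n + budget (timeFun a) n) = m at h
  cases h
  case pos a' n =>
    exact absurd (streamLength_inj one_lt_two two_pos hm).2.1 one_ne_zero
  case val a' n' h =>
    obtain ⟨rfl, -, hn⟩ := streamLength_inj one_lt_two one_lt_two hm
    have : n = n' := by
      rcases lt_trichotomy n n' with hlt | rfl | hlt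
      · have := budget_mono (timeFun a) hlt.le
        omega
      · rfl
      · have := budget_mono (timeFun a) hlt.le
        omega
    exact this ▸ h
  all_goals
    simp only [Prog.certLength, streamLength] at hm
    omega

end OracleComplexity

open OracleComplexity
theorem mainTheorem3 (A : Set Word) (hA : ∀ w ∈ A, Even (enc w)) :
    ∃ O : Set Word,
      IsTally O ∧ (∀ w ∈ O, Odd (enc w)) ∧
      (∀ L ∈ PSPACE (O ∪ A), L.Nonempty → HasPOptimalProofSystem (O ∪ A) L) ∧
      (∀ t : ℕ → ℕ, TimeConstructible t →
        ∃ L : Set Word, DecidableRelativeTo (O ∪ A) L ∧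
          HasPOptimalProofSystem (O ∪ A) L ∧ L ∉ DTIME (O ∪ A) t) := by
  obtain ⟨O, hO, hodd, hspec⟩ := exists_oracle A hA Spec
  have hauto : KnowsAutomaton (O ∪ A) := by
    refine ⟨fun n => ?_, fun n => ?_⟩
    · rw [EdgeBit, hspec _ (by omega)]
      simp only [spec_edge]
      exact ⟨fun h => h _ (.refl _ _), fun h _ _ => h⟩
    · rw [NodeBit, hspec _ (by omega)]
      simp only [spec_node]
      exact ⟨fun h => h _ (.refl _ _), fun h _ _ => h⟩
  have hcert : HasCertificates certLang (O ∪ A) := by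
    intro l d j T
    rw [hspec _ (by unfold Prog.certLength; omega)]
    simp only [spec_cert]
  refine ⟨O, hO, hodd, fun L hL hne => ?_, fun t ht => ?_⟩
  · refine hasPOptimalProofSystem_of_mem_PSPACE hauto hcert (fun k => ⟨2 * k, ?_⟩) hL hne
    funext X
    simp [certLang]
  · obtain ⟨a, rfl⟩ := exists_timeFun_eq ht
    have hdiag : KnowsDiag (timeFun a) (O ∪ A) a := by
      refine ⟨fun N => ?_, fun n => ?_⟩
      · rw [hspec _ (by unfold streamLength; omega)]
        simp only [spec_pos]
        exact ⟨fun h => h _ (.refl _ _), fun h _ _ => h⟩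
      · rw [hspec _ (by unfold streamLength; omega)]
        simp only [spec_val]
        refine ⟨fun h => h _ (.refl _ _), fun h X' hX' => (mem_diag_congr (hX'.mono ?_)).1 h⟩
        have : 1 ≤ 2 ^ a := Nat.one_le_two_pow
        unfold streamLength
        nlinarith
    refine ⟨diagWords (timeFun a) (O ∪ A), decidable_diagWords hdiag, ?_,
      diagWords_notMem_DTIME _ _⟩
    have hl : certLang (2 * a + 1) = diagWords (timeFun a) := by
      funext X
      rw [certLang, if_neg (by omega), show (2 * a + 1) / 2 = a by omega]
    obtain ⟨n, hn, -⟩ := exists_mem_diag (timeFun a) (O ∪ A) 0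
    have hne : (certLang (2 * a + 1) (O ∪ A)).Nonempty := by
      rw [hl]
      exact ⟨_, zeros_mem_diagWords.2 hn⟩
    rw [← hl]
    refine hasPOptimalProofSystem_of_robust hauto hcert hne 0 fun k g hk hg =>
      ⟨budget (timeFun a) (4 * k), fun y τ m b X' hC hm hτ hX' => ?_⟩
    rw [hl] at hg ⊢
    exact robust_diagWords hk hg hC (by simp at hm; omega) hτ hX'
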